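/- Assume the generalized Riemann hypothesis for Dirichlet $L$-functions: for every Dirichlet character $\chi$, every zero of $L(s,\chi)$ with $0<\operatorname{Re} s<1$ satisfies $\operatorname{Re} s=1/2$. Notation. Write $e(x)=e^{2\pi i x}$. In the following sums $\sum^*_{a\,(q)}$ runs over the residues $a$ modulo $q$ with $(a,q)=1$, and $\bar d$ is the inverse of $d$ modulo $q$: $$R(n,q)=\sum^*_{a\,(q)}e\!\left(\frac{an}{q}\right),\qquad S(m,n;q)=\sum^*_{d\,(q)}e\!\left(\frac{md+n\bar d}{q}\right),\qquad \psi(n_1,n_2,q)=\sum^*_{u\,(q)}R(u+n_1,q)\,R(u+n_2,q).$$ Let $J_\nu$ be the Bessel function of the first kind, $\varphi$ Euler's function, $\mu$ the Möbius function and $\chi_0^{n}$ the principal character modulo $n$. Let $k_1,k_2\ge 2$ be even integers. Let $\phi$ be an even Schwartz function on $\mathbb R$ whose Fourier transform $\hat\phi(y)=\int_{\mathbb R}\phi(x)e^{-2\pi i xy}\,dx$ satisfies $\operatorname{supp}\hat\phi\subset(-\sigma,\sigma)$ for some $\sigma>0$, and let $\epsilon>0$. For a prime $N$ put $$R=\begin{cases}(k_1-k_2)^2(k_1+k_2)^2N^2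 & k_1\neq k_2,\\ k_1^2N^2 & k_1=k_2,\end{cases}$$ and for positive integers $m_1,m_2,b_1,b_2$ define $$Q^*(m_1^2,b_1N,m_2^2,b_2N)=\sum_p S(m_1^2,p;b_1N)\,S(m_2^2,p;b_2N)\,J_{k_1-1}\!\left(\frac{4\pi m_1\sqrt p}{b_1N}\right)J_{k_2-1}\!\left(\frac{4\pi m_2\sqrt p}{b_2N}\right)\frac{2\log p}{\sqrt p\,\log R}\,\hat\phi\!\left(\frac{\log p}{\log R}\right),$$ the sum being over all primes $p$, and $$I(b_1,b_2,m_1,m_2,N)=\int_0^\infty J_{k_1-1}\!\left(\frac{4\pi m_1y}{b_1N}\right)J_{k_2-1}\!\left(\frac{4\pi m_2y}{b_2N}\right)\hat\phi\!\left(2\,\frac{\log y}{\log R}\right)\frac{dy}{\log R}.$$ Proposition. Let $N$ be a prime and let $b_1,b_2,m_1,m_2$ be positive integers not divisible by $N$. Set $r=(b_1,b_2)$, and write $b_1=d_1r$ and $b_2=d_2r$, so that $(d_1,d_2)=1$. Then $$Q^*(m_1^2,b_1N,m_2^2,b_2N)=\frac{4\,\psi(m_1^2d_2^2,m_2^2d_1^2,Nr)}{\varphi(d_1d_2rN)}\,R(m_1^2,d_1)\,R(m_2^2,d_2)\,\mu(d_1d_2)\,\chi_0^{d_1d_2}(r)\,I(b_1,b_2,m_1,m_2,N)+O\!\left(m_1^3m_2^3\,N^{2\sigma-1/2+\epsilon}(b_1b_2)^{\epsilon}\right),$$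 where the implied constant depends only on $k_1,k_2,\phi,\sigma$ and $\epsilon$. -/

import Mathlib

open scoped FourierTransform

/-- The generalized Riemann hypothesis for Dirichlet `L`-functions: for every modulus `q ≥ 1` and
every Dirichlet character `χ` modulo `q` (primitive or not, principal or not), all zeros of
`L(s, χ)` in the open strip `0 < Re s < 1` lie on the line `Re s = 1/2`. -/
def GRHDirichlet : Prop :=
  ∀ (q : ℕ) [NeZero q] (χ : DirichletCharacter ℂ q) (s : ℂ),
    χ.LFunction s = 0 → 0 < s.re → s.re < 1 → s.re = 1 / 2

/-- `e(x) = exp(2 π i x)`. -/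
noncomputable def eAdd (x : ℝ) : ℂ := Complex.exp (2 * Real.pi * Complex.I * x)

/-- A reduced residue system modulo `q`: the `a` with `0 ≤ a < q` and `(a, q) = 1`. -/
def reducedResidues (q : ℕ) : Finset ℕ := (Finset.range q).filter fun a => Nat.Coprime a q

/-- The Ramanujan sum `R(n, q) = ∑_{a (q), (a, q) = 1} e(a n / q)`. -/
noncomputable def ramanujanSum (n : ℤ) (q : ℕ) : ℂ :=
  ∑ a ∈ reducedResidues q, eAdd ((a : ℝ) * (n : ℝ) / (q : ℝ))

/-- The Kloosterman sum `S(m, n; q) = ∑_{d (q), (d, q) = 1} e((m d + n d̄) / q)`, where `d̄` is the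
representative in `[0, q)` of the inverse of `d` modulo `q`. -/
noncomputable def kloostermanSum (m n : ℤ) (q : ℕ) : ℂ :=
  ∑ d ∈ reducedResidues q,
    eAdd (((m : ℝ) * (d : ℝ) + (n : ℝ) * (((d : ZMod q)⁻¹).val : ℝ)) / (q : ℝ))

/-- `ψ(n₁, n₂, r) = ∑_{u (r), (u, r) = 1} R(u + n₁, r) R(u + n₂, r)`. -/
noncomputable def psiSum (n₁ n₂ : ℤ) (r : ℕ) : ℂ :=
  ∑ u ∈ reducedResidues r, ramanujanSum ((u : ℤ) + n₁) r * ramanujanSum ((u : ℤ) + n₂) r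

/-- The Bessel function of the first kind `J_n` of integer order `n ≥ 0`, by Bessel's integral
`J_n(x) = (1/π) ∫_0^π cos(n θ - x sin θ) dθ`. -/
noncomputable def besselJ (n : ℕ) (x : ℝ) : ℝ :=
  (1 / Real.pi) * ∫ θ in (0 : ℝ)..Real.pi, Real.cos ((n : ℝ) * θ - x * Real.sin θ)

/-- The analytic conductor of the Rankin-Selberg convolutions of newforms of weights `k₁`, `k₂`
and of the same level `N`: it is `(k₁ - k₂)² (k₁ + k₂)² N²` if `k₁ ≠ k₂`, and `k₁² N²` if
`k₁ = k₂`. -/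
noncomputable def rsConductor (k₁ k₂ N : ℕ) : ℝ :=
  if k₁ = k₂ then (k₁ : ℝ) ^ 2 * (N : ℝ) ^ 2
  else ((k₁ : ℝ) - (k₂ : ℝ)) ^ 2 * ((k₁ : ℝ) + (k₂ : ℝ)) ^ 2 * (N : ℝ) ^ 2

/-- The Kloosterman-Bessel prime sum `Q*(m₁², b₁N, m₂², b₂N)`,
`∑_p S(m₁², p; b₁N) S(m₂², p; b₂N) J_{k₁-1}(4π m₁ √p / (b₁N)) J_{k₂-1}(4π m₂ √p / (b₂N))`
`· (2 log p / (√p log R)) φ̂(log p / log R)`. When `φ̂` has compact support, only finitely many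
primes contribute. -/
noncomputable def Qstar (k₁ k₂ : ℕ) (φ : SchwartzMap ℝ ℂ) (m₁ b₁ m₂ b₂ N : ℕ) : ℂ :=
  ∑' p : Nat.Primes,
    kloostermanSum ((m₁ : ℤ) ^ 2) ((p : ℕ) : ℤ) (b₁ * N) *
    kloostermanSum ((m₂ : ℤ) ^ 2) ((p : ℕ) : ℤ) (b₂ * N) *
    ((besselJ (k₁ - 1) (4 * Real.pi * (m₁ : ℝ) * √((p : ℕ) : ℝ) / ((b₁ : ℝ) * (N : ℝ))) : ℝ) : ℂ) *
    ((besselJ (k₂ - 1) (4 * Real.pi * (m₂ : ℝ) * √((p : ℕ) : ℝ) / ((b₂ : ℝ) * (N : ℝ))) : ℝ) : ℂ) *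
    ((2 * Real.log ((p : ℕ) : ℝ) /
      (√((p : ℕ) : ℝ) * Real.log (rsConductor k₁ k₂ N)) : ℝ) : ℂ) *
    𝓕 (φ : ℝ → ℂ) (Real.log ((p : ℕ) : ℝ) / Real.log (rsConductor k₁ k₂ N))

/-- The integral `I(b₁, b₂, m₁, m₂, N)`,
`∫_0^∞ J_{k₁-1}(4π m₁ y / (b₁N)) J_{k₂-1}(4π m₂ y / (b₂N)) φ̂(2 log y / log R) dy / log R`. -/
noncomputable def besselIntegral (k₁ k₂ : ℕ) (φ : SchwartzMap ℝ ℂ) (b₁ b₂ m₁ m₂ N : ℕ) : ℂ :=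
  ∫ y in Set.Ioi (0 : ℝ),
    ((besselJ (k₁ - 1) (4 * Real.pi * (m₁ : ℝ) * y / ((b₁ : ℝ) * (N : ℝ))) : ℝ) : ℂ) *
    ((besselJ (k₂ - 1) (4 * Real.pi * (m₂ : ℝ) * y / ((b₂ : ℝ) * (N : ℝ))) : ℝ) : ℂ) *
    𝓕 (φ : ℝ → ℂ) (2 * (Real.log y / Real.log (rsConductor k₁ k₂ N))) /
    ((Real.log (rsConductor k₁ k₂ N) : ℝ) : ℂ)

/-! Both Kloosterman sums depend on p only modulo q = d₁d₂rN, so for p not dividing q their product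
f(p) expands in Dirichlet characters modulo q. With v = log p and L = log R, the sum Q* is (2/L) ∑
f(p) log p · h(log p), where h(v) = e^{-v/2} J(αe^{v/2}) J(βe^{v/2}) φ̂(v/L), α = 4πm₁/(b₁N), β =
4πm₂/(b₂N). The weight h is smooth and vanishes for |v| ≥ σL, and h and h' are O(αβ e^{v/2}) because
|J_n(x)| ≤ |x| for n ≥ 1.

Principal character. Under RH its prime sum is ∫ h(v)e^v dv = 2L·I up to an error. Its coefficient
is the mean of f over the reduced residues a (`charCoeff_kloostermanProduct_one`). Opening both
Kloosterman sums, the sum over a collapses to a Ramanujan sum modulo q at d₂x̄ + d₁ȳ, which is prime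
to d₁d₂. If a prime divides both d₁d₂ and r, this vanishes; otherwise the Chinese remainder theorem
splits off μ(d₁d₂), R(m₁²,d₁) and R(m₂²,d₂) and leaves ψ modulo Nr.

Prime sums. GRH and Borel–Carathéodory give L'/L ≪ q^δ (1+t²)^{1/8} on Re s ≥ 1/2 + δ. Moving the
contour there and applying Plancherel to h' bounds each nonprincipal prime sum, and the error in the
principal one, by αβ q^δ R^{σ(1+δ)} (`GRHDirichlet.exists_norm_sum_primes_character_le`). Prime
powers, primes dividing q and the range v < 0 fit in the same bound.

Coefficients. Parseval and Cauchy–Schwarz bound ∑|coefficient| by (∑|f|²)^{1/2}, and a second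
Cauchy–Schwarz by fourth moments of single Kloosterman sums
(`ZMod.sum_norm_charCoeff_mul_pow_four_le`). These need no Weil bound: orthogonality reduces them to
counting a+b = c+d, ā+b̄ = c̄+d̄, which forces (c−a)(c−b)(a+b) = 0 (`ZMod.card_unit_quadruples_le`).
The total is at most about m₁m₂ b₁b₂ N^{3/2}. Against αβ ≍ m₁m₂/(b₁b₂N²) and R^σ ≍ N^{2σ} this
leaves N^{2σ−1/2}. -/

section

/-! ### Growth of Dirichlet L-functions and of (s − 1)ζ(s) for Re s > 0 -/

open MeasureTheory Set Filter Topology Asymptotics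

/-- The integral `∫_1^∞ B(t) t^{-s-1} dt` of a bounded function is holomorphic for `Re s > 0`. -/
theorem differentiableOn_integral_Ioi_one_cpow {B : ℝ → ℂ} (hB : Measurable B) {M : ℝ}
    (hM : ∀ t, 1 < t → ‖B t‖ ≤ M) :
    DifferentiableOn ℂ (fun s : ℂ => ∫ t in Ioi (1 : ℝ), B t * (t : ℂ) ^ (-(s + 1)))
      {s | 0 < s.re} := by
  classical
  set f : ℝ → ℂ := (Ioi (1 : ℝ)).indicator B with hf
  have hfm : Measurable f := hB.indicator measurableSet_Ioi
  have hM0 : 0 ≤ M := (norm_nonneg _).trans (hM 2 (by norm_num))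
  have hfb : ∀ t, ‖f t‖ ≤ M := by
    intro t
    by_cases ht : 1 < t
    · simpa [hf, ht] using hM t ht
    · simpa [hf, ht] using hM0
  have key : ∀ s : ℂ, (∫ t in Ioi (1 : ℝ), B t * (t : ℂ) ^ (-(s + 1))) = mellin f (-s) := by
    intro s
    have h1 : (fun t : ℝ => (t : ℂ) ^ (-s - 1) • f t)
        = (Ioi (1 : ℝ)).indicator (fun t => B t * (t : ℂ) ^ (-(s + 1))) := by
      ext t
      by_cases ht : 1 < t
      · simp [hf, ht, mul_comm, sub_eq_add_neg, add_comm]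
      · simp [hf, ht]
    rw [mellin, h1, setIntegral_indicator measurableSet_Ioi]
    congr 2
    ext t
    simp only [mem_inter_iff, mem_Ioi]
    constructor
    · intro h; exact ⟨by linarith, h⟩
    · exact fun h => h.2
  intro s hs
  simp_rw [key]
  refine DifferentiableAt.differentiableWithinAt ?_
  have hloc : LocallyIntegrableOn f (Ioi 0) := by
    refine LocallyIntegrable.locallyIntegrableOn ?_ _
    refine (locallyIntegrable_const M).mono hfm.aestronglyMeasurable ?_
    exact Eventually.of_forall fun t => by simpa [abs_of_nonneg hM0] using hfb t
  have h2 : DifferentiableAt ℂ (mellin f) (-s) := by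
    refine mellin_differentiableAt_of_isBigO_rpow (a := 0) (b := (-s).re - 1) hloc ?_ ?_ ?_ ?_
    -- The exponent a = 0 at infinity is boundedness of `f`. Near 0 `f` vanishes, so any b below
    -- Re(−s) is admissible.
    · refine IsBigO.of_bound M (Eventually.of_forall fun t => ?_)
      simpa using hfb t
    · simpa using hs
    · refine IsBigO.of_bound 0 ?_
      have : Ioo (0 : ℝ) 1 ∈ 𝓝[>] (0 : ℝ) := Ioo_mem_nhdsGT one_pos
      filter_upwards [this] with t ht
      have : f t = 0 := by simp [hf, not_lt.mpr ht.2.le]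
      simp [this]
    · simp
  exact h2.comp s differentiableAt_id.neg

theorem norm_integral_Ioi_one_cpow_le {B : ℝ → ℂ} {M : ℝ}
    (hM : ∀ t, 1 < t → ‖B t‖ ≤ M) {s : ℂ} (hs : 0 < s.re) :
    ‖∫ t in Ioi (1 : ℝ), B t * (t : ℂ) ^ (-(s + 1))‖ ≤ M / s.re := by
  have h1 : ∀ t ∈ Ioi (1 : ℝ), ‖B t * (t : ℂ) ^ (-(s + 1))‖ ≤ M * t ^ (-(s.re + 1)) := by
    intro t ht
    have ht0 : (0 : ℝ) < t := lt_trans one_pos ht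
    rw [norm_mul, Complex.norm_cpow_eq_rpow_re_of_pos ht0]
    simp only [Complex.neg_re, Complex.add_re, Complex.one_re]
    exact mul_le_mul_of_nonneg_right (hM t ht) (Real.rpow_nonneg ht0.le _)
  have hint : IntegrableOn (fun t : ℝ => M * t ^ (-(s.re + 1))) (Ioi 1) :=
    (integrableOn_Ioi_rpow_of_lt (by linarith) one_pos).const_mul M
  refine (norm_integral_le_of_norm_le hint
    ((ae_restrict_iff' measurableSet_Ioi).2 (Eventually.of_forall h1))).trans ?_
  rw [integral_const_mul, integral_Ioi_rpow_of_lt (by linarith) one_pos]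
  simp [div_eq_mul_inv]

/-- Complete periods cancel by orthogonality, and fewer than q terms of norm at most 1 remain. -/
theorem DirichletCharacter.norm_sum_Icc_le {q : ℕ} [NeZero q] {χ : DirichletCharacter ℂ q}
    (hχ : χ ≠ 1) (n : ℕ) : ‖∑ k ∈ Finset.Icc 1 n, χ k‖ ≤ q := by
  have hper : ∀ m : ℕ, ∑ k ∈ Finset.range (q * m), χ k = 0 := by
    have hs : ∑ a : ZMod q, χ a = 0 := MulChar.sum_eq_zero_of_ne_one hχ
    have hq : ∀ c : ℕ, ∑ k ∈ Finset.range q, χ ((q * c + k : ℕ) : ZMod q) = 0 := by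
      intro c
      rw [← hs]
      refine Finset.sum_bij (fun k _ => (k : ZMod q)) (by simp) ?_ ?_ ?_
      · intro a ha b hb hab
        have := congrArg ZMod.val hab
        rwa [ZMod.val_natCast_of_lt (Finset.mem_range.1 ha),
          ZMod.val_natCast_of_lt (Finset.mem_range.1 hb)] at this
      · intro b _
        exact ⟨b.val, Finset.mem_range.2 (ZMod.val_lt b), by simp⟩
      · intro a _; simp
    intro m
    induction m with
    | zero => simp
    | succ m ih => rw [Nat.mul_succ, Finset.sum_range_add, ih, hq, add_zero]
  have h0 : ∀ n : ℕ, ‖∑ k ∈ Finset.range n, χ k‖ ≤ (n % q : ℕ) := by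
    intro n
    conv_lhs => rw [← Nat.div_add_mod n q]
    rw [Finset.sum_range_add, hper, zero_add]
    refine (norm_sum_le _ _).trans ?_
    refine (Finset.sum_le_card_nsmul _ _ 1 fun k _ => DirichletCharacter.norm_le_one χ _).trans ?_
    simp
  -- Beyond modulus 1 the residue 0 is not a unit, so χ(0) = 0 and the sum may start at 0 instead of
  -- 1.
  rcases eq_or_ne q 1 with rfl | hq1
  · exact absurd (Subsingleton.elim χ 1) hχ
  have h2 : ∑ k ∈ Finset.Icc 1 n, χ k = ∑ k ∈ Finset.range (n + 1), χ k := by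
    have : Finset.range (n + 1) = insert 0 (Finset.Icc 1 n) := by
      ext k; simp; omega
    rw [this, Finset.sum_insert (by simp)]
    have : Nontrivial (ZMod q) := ZMod.nontrivial_iff.mpr hq1
    simp [MulChar.map_nonunit χ (not_isUnit_zero (M₀ := ZMod q))]
  rw [h2]
  exact (h0 _).trans (by exact_mod_cast (Nat.mod_lt _ (NeZero.pos q)).le)

theorem isPreconnected_re_pos : IsPreconnected {s : ℂ | 0 < s.re} :=
  (convex_halfSpace_re_gt 0).isPreconnected

/-- The identity theorem; it carries the partial-summation integrals from the region of absolute
convergence to Re s > 0. -/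
theorem eqOn_re_pos_of_eqOn_one_lt_re {f g : ℂ → ℂ} (hf : DifferentiableOn ℂ f {s | 0 < s.re})
    (hg : DifferentiableOn ℂ g {s | 0 < s.re}) (h : ∀ s : ℂ, 1 < s.re → f s = g s) :
    EqOn f g {s | 0 < s.re} := by
  have ho : IsOpen {s : ℂ | 0 < s.re} := isOpen_lt continuous_const Complex.continuous_re
  have ho1 : IsOpen {s : ℂ | 1 < s.re} := isOpen_lt continuous_const Complex.continuous_re
  refine AnalyticOnNhd.eqOn_of_preconnected_of_eventuallyEq (hf.analyticOnNhd ho)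
    (hg.analyticOnNhd ho) isPreconnected_re_pos (z₀ := 2) (by simp) ?_
  filter_upwards [ho1.mem_nhds (show (2 : ℂ) ∈ {s : ℂ | 1 < s.re} by simp)] with s hs using h s hs

theorem measurable_comp_floor (a : ℕ → ℂ) : Measurable fun t : ℝ => a ⌊t⌋₊ :=
  (measurable_from_nat (f := a)).comp Nat.measurable_floor

/-- Trivial bound for a nonprincipal Dirichlet `L`-function in the right half plane. -/
theorem DirichletCharacter.norm_LFunction_le {q : ℕ} [NeZero q] {χ : DirichletCharacter ℂ q}
    (hχ : χ ≠ 1) {s : ℂ} (hs : 0 < s.re) : ‖χ.LFunction s‖ ≤ ‖s‖ * (q / s.re) := by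
  set B : ℝ → ℂ := fun t => ∑ k ∈ Finset.Icc 1 ⌊t⌋₊, χ k with hBdef
  have hB : Measurable B := measurable_comp_floor fun n => ∑ k ∈ Finset.Icc 1 n, χ k
  have hM : ∀ t, 1 < t → ‖B t‖ ≤ q := fun t _ => DirichletCharacter.norm_sum_Icc_le hχ _
  have h1 : EqOn χ.LFunction
      (fun s => s * ∫ t in Ioi (1 : ℝ), B t * (t : ℂ) ^ (-(s + 1))) {s | 0 < s.re} := by
    refine eqOn_re_pos_of_eqOn_one_lt_re
      (DirichletCharacter.differentiable_LFunction hχ).differentiableOn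
      (differentiableOn_id.mul (differentiableOn_integral_Ioi_one_cpow hB hM)) ?_
    intro s hs
    rw [DirichletCharacter.LFunction_eq_LSeries χ hs]
    refine LSeries_eq_mul_integral _ (r := 0) le_rfl (by linarith)
      (DirichletCharacter.LSeriesSummable_of_one_lt_re χ hs) ?_
    refine IsBigO.of_bound q (Eventually.of_forall fun n => ?_)
    simpa using DirichletCharacter.norm_sum_Icc_le hχ n
  rw [h1 hs, norm_mul]
  exact mul_le_mul_of_nonneg_left (norm_integral_Ioi_one_cpow_le hM hs) (norm_nonneg _)

/-- Trivial bound for `(s - 1) ζ(s)` in the right half plane. -/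
theorem norm_riemannZeta₁_le {s : ℂ} (hs : 0 < s.re) :
    ‖riemannZeta₁ s‖ ≤ ‖s‖ + ‖s‖ * ‖s - 1‖ * (1 / s.re) := by
  set B : ℝ → ℂ := fun t => (⌊t⌋₊ : ℂ) - t with hBdef
  have hB : Measurable B :=
    (measurable_comp_floor fun n => (n : ℂ)).sub Complex.measurable_ofReal
  have hM : ∀ t, 1 < t → ‖B t‖ ≤ 1 := by
    intro t ht
    have h1 := Nat.floor_le (by linarith : 0 ≤ t)
    have h2 := Nat.lt_floor_add_one t
    have : B t = (((⌊t⌋₊ : ℝ) - t : ℝ) : ℂ) := by simp [hBdef]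
    rw [this, Complex.norm_real, Real.norm_eq_abs, abs_le]
    constructor <;> linarith
  -- Partial summation gives ζ(s) = s∫⌊t⌋t^{-s-1}dt. Replacing ⌊t⌋ by the bounded ⌊t⌋ − t splits off
  -- s/(s−1), which becomes the summand s after multiplication by s − 1.
  have h1 : EqOn riemannZeta₁
      (fun s => s + s * (s - 1) * ∫ t in Ioi (1 : ℝ), B t * (t : ℂ) ^ (-(s + 1)))
      {s | 0 < s.re} := by
    refine eqOn_re_pos_of_eqOn_one_lt_re
      differentiable_riemannZeta₁.differentiableOn
      (differentiableOn_id.add ((by fun_prop : DifferentiableOn ℂ (fun s : ℂ => s * (s - 1)) _).mul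
        (differentiableOn_integral_Ioi_one_cpow hB hM))) ?_
    intro s hs
    have hs1 : s ≠ 1 := by rintro rfl; simp at hs
    have hs1' : s - 1 ≠ 0 := sub_ne_zero.2 hs1
    have e1 : riemannZeta₁ s = (s - 1) * riemannZeta s := by
      rw [riemannZeta_eq_inv_sub_mul hs1]; field_simp
    have e2 : riemannZeta s = s * ∫ t in Ioi (1 : ℝ), (⌊t⌋₊ : ℂ) * (t : ℂ) ^ (-(s + 1)) := by
      rw [← LSeries_one_eq_riemannZeta hs]
      have := LSeries_eq_mul_integral (1 : ℕ → ℂ) (r := 1) zero_le_one (s := s) hs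
        (LSeriesSummable_one_iff.2 hs) ?_
      · rw [this]; simp
      · refine IsBigO.of_bound 1 (Eventually.of_forall fun n => ?_)
        simp
    have hI1 : IntegrableOn (fun t : ℝ => (t : ℂ) ^ (-s)) (Ioi 1) :=
      integrableOn_Ioi_cpow_of_lt (by simpa using hs) one_pos
    have hI2 : IntegrableOn (fun t : ℝ => B t * (t : ℂ) ^ (-(s + 1))) (Ioi 1) := by
      have hg : IntegrableOn (fun t : ℝ => t ^ (-(s.re + 1))) (Ioi 1) :=
        integrableOn_Ioi_rpow_of_lt (by linarith) one_pos
      refine hg.mono' (hB.mul (by fun_prop)).aestronglyMeasurable ?_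
      refine (ae_restrict_iff' measurableSet_Ioi).2 (Eventually.of_forall fun t ht => ?_)
      rw [norm_mul, Complex.norm_cpow_eq_rpow_re_of_pos (lt_trans one_pos ht)]
      simp only [Complex.neg_re, Complex.add_re, Complex.one_re]
      exact mul_le_of_le_one_left (Real.rpow_nonneg (lt_trans one_pos ht).le _) (hM t ht)
    have e3 : ∫ t in Ioi (1 : ℝ), (⌊t⌋₊ : ℂ) * (t : ℂ) ^ (-(s + 1))
        = (∫ t in Ioi (1 : ℝ), B t * (t : ℂ) ^ (-(s + 1))) + ∫ t in Ioi (1 : ℝ), (t : ℂ) ^ (-s) := by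
      rw [← integral_add hI2 hI1]
      refine setIntegral_congr_fun measurableSet_Ioi fun t ht => ?_
      have ht0 : (t : ℂ) ≠ 0 := by
        exact_mod_cast (lt_trans one_pos ht).ne'
      have : (t : ℂ) ^ (-s) = t * (t : ℂ) ^ (-(s + 1)) := by
        rw [show -s = 1 + -(s + 1) by ring, Complex.cpow_add _ _ ht0, Complex.cpow_one]
      simp only [this, hBdef]; ring
    have e4 : ∫ t in Ioi (1 : ℝ), (t : ℂ) ^ (-s) = 1 / (s - 1) := by
      rw [integral_Ioi_cpow_of_lt (by simpa using hs) one_pos]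
      have : (-s + 1) ≠ 0 := by intro h; apply hs1'; linear_combination -h
      simp
      rw [← neg_sub, show (1:ℂ) - s = -s + 1 by ring]
      field_simp
    rw [e1, e2, e3, e4]
    field_simp
    ring
  rw [h1 hs]
  refine (norm_add_le _ _).trans ?_
  rw [norm_mul, norm_mul]
  gcongr
  exact norm_integral_Ioi_one_cpow_le hM hs

end

/-! ### Logarithmic derivatives to the right of the critical line under GRH -/

section

open MeasureTheory Set Filter Topology Asymptotics

/-- Borel–Carathéodory for the logarithmic derivative of a nonvanishing function on a disc. -/
theorem norm_deriv_div_le_of_norm_le {f : ℂ → ℂ} {c : ℂ} {r R M : ℝ} (hr : 0 ≤ r) (hrR : r < R)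
    (hM : 1 < M) (hf : DifferentiableOn ℂ f (Metric.ball c R))
    (hf0 : ∀ z ∈ Metric.ball c R, f z ≠ 0)
    (hfM : ∀ z ∈ Metric.ball c R, ‖f z‖ ≤ M * ‖f c‖) {s : ℂ} (hs : ‖s - c‖ ≤ r) :
    ‖deriv f s / f s‖ ≤ 8 * R / (R - r) ^ 2 * Real.log M := by
  have hR : 0 < R := hr.trans_lt hrR
  have hlog : 0 < Real.log M := Real.log_pos hM
  have hcb : c ∈ Metric.ball c R := Metric.mem_ball_self hR
  have hder : DifferentiableOn ℂ (fun z => deriv f z / f z) (Metric.ball c R) :=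
    (hf.deriv Metric.isOpen_ball).div hf hf0
  -- `g` is the primitive of f'/f with g(c) = 0, that is, a branch of log(f/f(c)); its real part is
  -- at most log M.
  obtain ⟨g, hg0, hg⟩ := hder.isExactOn_ball.with_val_at c 0
  have hgd : DifferentiableOn ℂ g (Metric.ball c R) := fun z hz =>
    (hg z hz).differentiableAt.differentiableWithinAt
  have hexp : ∀ z ∈ Metric.ball c R, f z = f c * Complex.exp (g z) := by
    have hd : ∀ z ∈ Metric.ball c R, HasDerivAt (fun z => f z * Complex.exp (-g z)) 0 z := by
      intro z hz
      have h1 := (hf.differentiableAt (Metric.isOpen_ball.mem_nhds hz)).hasDerivAt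
      have h2 := h1.mul (hg z hz).neg.cexp
      refine h2.congr_deriv ?_
      have h3 : f z * (deriv f z / f z) = deriv f z := mul_div_cancel₀ _ (hf0 z hz)
      linear_combination -Complex.exp (-g z) * h3
    have hconst : ∀ {x y : ℂ}, x ∈ Metric.ball c R → y ∈ Metric.ball c R →
        f x * Complex.exp (-g x) = f y * Complex.exp (-g y) :=
      Metric.isOpen_ball.is_const_of_deriv_eq_zero (f := fun z => f z * Complex.exp (-g z))
      (convex_ball c R).isPreconnected
      (fun z hz => (hd z hz).differentiableAt.differentiableWithinAt)
      (fun z hz => (hd z hz).deriv)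
    intro z hz
    have h3 := hconst hz hcb
    simp only [hg0, neg_zero, Complex.exp_zero, mul_one] at h3
    rw [← h3, mul_assoc, ← Complex.exp_add]
    simp
  have hre : ∀ z ∈ Metric.ball c R, (g z).re ≤ Real.log M := by
    intro z hz
    have h1 := hfM z hz
    have hc0 : 0 < ‖f c‖ := norm_pos_iff.2 (hf0 c hcb)
    rw [hexp z hz, norm_mul, Complex.norm_exp, mul_comm] at h1
    have h2 := le_of_mul_le_mul_right h1 hc0
    rwa [Real.le_log_iff_exp_le (by linarith)]
  -- Half of the gap R − r is spent on Borel–Carathéodory for `g`, half on Cauchy's estimate for g':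
  -- 2R log M/ρ² = 8R log M/(R−r)².
  set ρ := (R - r) / 2 with hρ
  have hρ0 : 0 < ρ := by rw [hρ]; linarith
  have hsub : ∀ z, ‖z - s‖ ≤ ρ → ‖z - c‖ ≤ r + ρ := by
    intro z hz
    calc ‖z - c‖ = ‖(z - s) + (s - c)‖ := by ring_nf
      _ ≤ _ := by linarith [norm_add_le (z - s) (s - c)]
  have hrρ : r + ρ < R := by rw [hρ]; linarith
  have hgb : ∀ z, ‖z - s‖ ≤ ρ → ‖g z‖ ≤ 2 * Real.log M * R / ρ := by
    intro z hz
    have hz' := hsub z hz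
    have h1 := Complex.borelCaratheodory_zero (f := fun w => g (c + w)) (R := R) (z := z - c) hlog
      (hgd.comp (by fun_prop) (fun w hw => by simpa using hw))
      (fun w hw => hre _ (by simpa using hw)) hR (by simpa using hz'.trans_lt hrρ) (by simpa using hg0)
    simp only [add_sub_cancel] at h1
    refine h1.trans ?_
    have : ρ ≤ R - ‖z - c‖ := by
      have : r + ρ + ρ = R := by rw [hρ]; ring
      linarith
    gcongr
    linarith
  have hderg : deriv g s = deriv f s / f s :=
    (hg s (by simpa [dist_eq_norm] using hs.trans_lt hrR)).deriv
  have hcl : closure (Metric.ball s ρ) ⊆ Metric.ball c R := by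
    rw [closure_ball _ hρ0.ne']
    intro z hz
    simpa [dist_eq_norm] using (hsub z (by simpa [dist_eq_norm] using hz)).trans_lt hrρ
  have h5 := Complex.norm_deriv_le_of_forall_mem_sphere_norm_le hρ0
    (hgd.mono hcl).diffContOnCl
    (fun z hz => hgb z (by simpa [dist_eq_norm] using le_of_eq (Metric.mem_sphere.1 hz)))
  rw [← hderg]
  refine h5.trans (le_of_eq ?_)
  rw [hρ]
  have : R - r ≠ 0 := by linarith
  field_simp
  ring

/-- A function without zeros to the right of `1/2` and of polynomial growth has logarithmic
derivative of logarithmic growth to the right of `1/2 + δ`. -/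
theorem exists_norm_deriv_div_le (δ : ℝ) (hδ : 0 < δ) (hδ1 : δ ≤ 1) :
    ∃ C : ℝ, 0 < C ∧ ∀ (A : ℝ) (f : ℂ → ℂ), 1 ≤ A → Differentiable ℂ f →
      (∀ s : ℂ, 1 / 2 < s.re → f s ≠ 0) →
      (∀ s : ℂ, 1 / 2 < s.re → s.re < 4 → ‖f s‖ ≤ A * (|s.im| + 8) ^ 2) →
      (∀ t : ℝ, 1 / 3 ≤ ‖f (2 + t * Complex.I)‖) →
      ∀ s : ℂ, 1 / 2 + δ ≤ s.re → s.re ≤ 2 →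
        ‖deriv f s / f s‖ ≤ C * A ^ δ * (1 + s.im ^ 2) ^ (1 / 8 : ℝ) := by
  -- The disc of radius 3/2 about 2 + it touches Re s = 1/2, and the inner radius is 3/2 − δ. In the
  -- bracket, δ⁻¹ comes from log A ≤ A^δ/δ, and 8·600 from log(600u) ≤ 8(600u)^{1/8} with u = 1 +
  -- t².
  refine ⟨8 * (3 / 2) / δ ^ 2 * (δ⁻¹ + 8 * 600), by positivity, ?_⟩
  intro A f hA hf hf0 hfA hf2 s hs1 hs2
  set c : ℂ := 2 + s.im * Complex.I with hc
  have hcre : c.re = 2 := by simp [hc]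
  have hcim : c.im = s.im := by simp [hc]
  have hball : ∀ z ∈ Metric.ball c (3 / 2), 1 / 2 < z.re ∧ z.re < 4 ∧ |z.im| ≤ |s.im| + 2 := by
    intro z hz
    rw [Metric.mem_ball, dist_eq_norm] at hz
    have h1 := (Complex.abs_re_le_norm (z - c)).trans_lt hz
    have h2 := (Complex.abs_im_le_norm (z - c)).trans_lt hz
    rw [Complex.sub_re, hcre, abs_lt] at h1
    rw [Complex.sub_im, hcim] at h2
    refine ⟨by linarith, by linarith, ?_⟩
    have := abs_add_le (z.im - s.im) s.im
    rw [sub_add_cancel] at this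
    linarith
  -- The factor 3 compensates the lower bound |f(c)| ≥ 1/3 at the centre; 10 = 8 + 2 allows for the
  -- variation of Im z over the disc.
  set M : ℝ := 3 * A * (|s.im| + 10) ^ 2 with hM
  have ht0 : 0 ≤ |s.im| := abs_nonneg _
  have hM1 : 1 < M := by rw [hM]; nlinarith
  have h := norm_deriv_div_le_of_norm_le (f := f) (c := c) (r := 3 / 2 - δ) (R := 3 / 2) (M := M)
    (by linarith) (by linarith) hM1 hf.differentiableOn
    (fun z hz => hf0 z (hball z hz).1) ?_ (s := s) ?_
  · refine h.trans ?_
    have e : (3 / 2 - (3 / 2 - δ)) ^ 2 = δ ^ 2 := by ring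
    rw [e, mul_assoc (8 * (3 / 2) / δ ^ 2 * _), mul_assoc (8 * (3 / 2) / δ ^ 2)]
    refine mul_le_mul_of_nonneg_left ?_ (by positivity)
    have hA0 : 0 < A := by linarith
    have hAδ : 1 ≤ A ^ δ := Real.one_le_rpow hA hδ.le
    set u : ℝ := 1 + s.im ^ 2 with hu
    have hu1 : 1 ≤ u := by rw [hu]; nlinarith [sq_nonneg s.im]
    have hupow : 1 ≤ u ^ (1 / 8 : ℝ) := Real.one_le_rpow hu1 (by norm_num)
    have h1 : Real.log M = Real.log A + Real.log (3 * (|s.im| + 10) ^ 2) := by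
      rw [hM, show 3 * A * (|s.im| + 10) ^ 2 = A * (3 * (|s.im| + 10) ^ 2) by ring,
        Real.log_mul hA0.ne' (by positivity)]
    have h2 : Real.log A ≤ A ^ δ / δ := Real.log_le_rpow_div hA0.le hδ
    have h3 : Real.log (3 * (|s.im| + 10) ^ 2) ≤ 8 * 600 * u ^ (1 / 8 : ℝ) := by
      have h4 : 3 * (|s.im| + 10) ^ 2 ≤ 600 * u := by
        rw [hu, ← sq_abs s.im]; nlinarith [sq_nonneg (|s.im| - 1)]
      calc Real.log (3 * (|s.im| + 10) ^ 2) ≤ Real.log (600 * u) :=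
            Real.log_le_log (by positivity) h4
        _ ≤ (600 * u) ^ (1 / 8 : ℝ) / (1 / 8) :=
            Real.log_le_rpow_div (by positivity) (by norm_num)
        _ = 8 * (600 ^ (1 / 8 : ℝ) * u ^ (1 / 8 : ℝ)) := by
            rw [Real.mul_rpow (by norm_num) (by linarith)]; ring
        _ ≤ 8 * (600 * u ^ (1 / 8 : ℝ)) := by
            gcongr
            exact Real.rpow_le_self_of_one_le (by norm_num) (by norm_num)
        _ = _ := by ring
    rw [h1]
    calc Real.log A + Real.log (3 * (|s.im| + 10) ^ 2)
        ≤ A ^ δ / δ * u ^ (1 / 8 : ℝ) + 8 * 600 * u ^ (1 / 8 : ℝ) * A ^ δ := by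
          refine add_le_add ?_ ?_
          · exact h2.trans (le_mul_of_one_le_right (by positivity) hupow)
          · exact h3.trans (le_mul_of_one_le_right (by positivity) hAδ)
      _ = _ := by ring
  · intro z hz
    obtain ⟨h1, h2, h3⟩ := hball z hz
    have h4 := hf2 s.im
    rw [← hc] at h4
    calc ‖f z‖ ≤ A * (|z.im| + 8) ^ 2 := hfA z h1 h2
      _ ≤ A * (|s.im| + 10) ^ 2 := by gcongr A * ?_ ^ 2; linarith
      _ = M * (1 / 3) := by rw [hM]; ring
      _ ≤ M * ‖f c‖ := by gcongr
  · have : s - c = ((s.re - 2 : ℝ) : ℂ) := by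
      apply Complex.ext <;> simp [hc]
    rw [this, Complex.norm_real, Real.norm_eq_abs, abs_le]
    constructor <;> linarith

/-- The first term is 1 and the others add up to at most ζ(2) − 1 < 2/3. -/
theorem one_third_le_norm_LSeries {f : ℕ → ℂ} (h1 : f 1 = 1) (hf : ∀ n, ‖f n‖ ≤ 1) {s : ℂ}
    (hs : s.re = 2) : 1 / 3 ≤ ‖LSeries f s‖ := by
  have hsum : LSeriesSummable f s :=
    LSeriesSummable_of_le_const_mul_rpow (x := 1) (by rw [hs]; norm_num) ⟨1, fun n _ => by simpa using hf n⟩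
  have hz : HasSum (fun n : ℕ => 1 / (n : ℝ) ^ 2) (Real.pi ^ 2 / 6) := hasSum_zeta_two
  have hz2 : HasSum (fun n : ℕ => 1 / ((n + 2 : ℕ) : ℝ) ^ 2) (Real.pi ^ 2 / 6 - 1) := by
    have := (hasSum_nat_add_iff' 2).2 hz
    simpa [Finset.sum_range_succ] using this
  have hsplit : LSeries f s = 1 + ∑' n : ℕ, LSeries.term f s (n + 2) := by
    have := hsum.sum_add_tsum_nat_add 2
    rw [LSeries, ← this]
    simp [Finset.sum_range_succ, LSeries.term, h1]
  have hb : ‖∑' n : ℕ, LSeries.term f s (n + 2)‖ ≤ Real.pi ^ 2 / 6 - 1 := by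
    refine tsum_of_norm_bounded hz2 fun n => ?_
    rw [LSeries.norm_term_eq]
    simp only [Nat.add_eq_zero_iff, OfNat.ofNat_ne_zero, and_false, if_false, hs]
    have := hf (n + 2)
    rw [Real.rpow_two]
    gcongr
  have hpi : Real.pi ^ 2 / 6 - 1 ≤ 2 / 3 := by
    have := Real.pi_lt_d2
    nlinarith [Real.pi_pos]
  have h3 : ‖(1 : ℂ)‖ ≤ ‖LSeries f s‖ + ‖∑' n : ℕ, LSeries.term f s (n + 2)‖ := by
    have : (1 : ℂ) = LSeries f s - ∑' n : ℕ, LSeries.term f s (n + 2) := by rw [hsplit]; ring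
    conv_lhs => rw [this]
    exact norm_sub_le _ _
  rw [norm_one] at h3
  linarith

theorem GRHDirichlet.LFunction_ne_zero (h : GRHDirichlet) {q : ℕ} [NeZero q]
    {χ : DirichletCharacter ℂ q} {s : ℂ} (hχ : χ ≠ 1 ∨ s ≠ 1) (hs : 1 / 2 < s.re) :
    χ.LFunction s ≠ 0 := by
  rcases lt_or_ge s.re 1 with h1 | h1
  · intro h0
    have := h q χ s h0 (by linarith) h1
    linarith
  · exact DirichletCharacter.LFunction_ne_zero_of_one_le_re χ hχ h1

theorem GRHDirichlet.riemannZeta₁_ne_zero (h : GRHDirichlet) {s : ℂ} (hs : 1 / 2 < s.re) :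
    riemannZeta₁ s ≠ 0 := by
  rcases eq_or_ne s 1 with rfl | hs1
  · simp
  · have h0 := h.LFunction_ne_zero (q := 1) (χ := 1) (Or.inr hs1) hs
    rw [DirichletCharacter.LFunction_modOne_eq, riemannZeta_eq_inv_sub_mul hs1] at h0
    exact right_ne_zero_of_mul h0

theorem Complex.norm_le_abs_im_add_four {s : ℂ} (h1 : 1 / 2 < s.re) (h2 : s.re < 4) :
    ‖s‖ ≤ |s.im| + 4 := by
  have := Complex.norm_le_abs_re_add_abs_im s
  rw [abs_of_pos (by linarith : 0 < s.re)] at this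
  linarith

/-- The trivial bound |L(s,χ)| ≤ q|s|/Re s allows A = q, so the modulus enters only through log q ≪
q^δ. -/
theorem GRHDirichlet.exists_norm_logDeriv_LFunction_le (h : GRHDirichlet) {δ : ℝ} (hδ : 0 < δ)
    (hδ1 : δ ≤ 1) : ∃ C : ℝ, 0 < C ∧ ∀ (q : ℕ) [NeZero q] (χ : DirichletCharacter ℂ q), χ ≠ 1 →
      ∀ s : ℂ, 1 / 2 + δ ≤ s.re → s.re ≤ 2 →
        ‖deriv χ.LFunction s / χ.LFunction s‖ ≤ C * (q : ℝ) ^ δ * (1 + s.im ^ 2) ^ (1 / 8 : ℝ) := by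
  obtain ⟨C, hC, H⟩ := exists_norm_deriv_div_le δ hδ hδ1
  refine ⟨C, hC, fun q _ χ hχ => ?_⟩
  have hq : (1 : ℝ) ≤ q := by exact_mod_cast NeZero.one_le
  refine H q χ.LFunction hq (DirichletCharacter.differentiable_LFunction hχ)
    (fun s hs => h.LFunction_ne_zero (Or.inl hχ) hs) (fun s h1 h2 => ?_) (fun t => ?_)
  · have h3 := DirichletCharacter.norm_LFunction_le hχ (s := s) (by linarith)
    have h4 := Complex.norm_le_abs_im_add_four h1 h2
    have h5 : (q : ℝ) / s.re ≤ q * 2 := by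
      rw [div_le_iff₀ (by linarith)]; nlinarith
    have h0 := abs_nonneg s.im
    calc _ ≤ ‖s‖ * (q / s.re) := h3
      _ ≤ (|s.im| + 4) * (q * 2) := by gcongr
      _ ≤ _ := by
        have : (|s.im| + 4) * 2 ≤ (|s.im| + 8) ^ 2 := by nlinarith
        nlinarith
  · rw [DirichletCharacter.LFunction_eq_LSeries χ (by simp)]
    exact one_third_le_norm_LSeries (by simp) (fun n => DirichletCharacter.norm_le_one χ _) (by simp)

/-- The entire function (s−1)ζ(s) replaces ζ, whose logarithmic derivative has a pole at 1. On Re s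
= 2 the extra factor satisfies |s−1| ≥ 1, so the lower bound 1/3 survives; A = 3 suffices for the
growth. -/
theorem GRHDirichlet.exists_norm_logDeriv_riemannZeta₁_le (h : GRHDirichlet) {δ : ℝ} (hδ : 0 < δ)
    (hδ1 : δ ≤ 1) : ∃ C : ℝ, 0 < C ∧ ∀ s : ℂ, 1 / 2 + δ ≤ s.re → s.re ≤ 2 →
        ‖deriv riemannZeta₁ s / riemannZeta₁ s‖ ≤ C * (1 + s.im ^ 2) ^ (1 / 8 : ℝ) := by
  obtain ⟨C, hC, H⟩ := exists_norm_deriv_div_le δ hδ hδ1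
  refine ⟨C * 3 ^ δ, by positivity, ?_⟩
  refine H 3 riemannZeta₁ (by norm_num) differentiable_riemannZeta₁
    (fun s hs => h.riemannZeta₁_ne_zero hs) (fun s h1 h2 => ?_) (fun t => ?_)
  · have h3 := norm_riemannZeta₁_le (s := s) (by linarith)
    have h4 := Complex.norm_le_abs_im_add_four h1 h2
    have h5 : 1 / s.re ≤ 2 := by
      rw [div_le_iff₀ (by linarith)]; linarith
    have h6 : ‖s - 1‖ ≤ |s.im| + 5 := by
      have := norm_sub_le s 1
      rw [norm_one] at this
      linarith
    have h0 := abs_nonneg s.im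
    calc _ ≤ ‖s‖ + ‖s‖ * ‖s - 1‖ * (1 / s.re) := h3
      _ ≤ (|s.im| + 4) + (|s.im| + 4) * (|s.im| + 5) * 2 := by gcongr
      _ ≤ _ := by nlinarith
  · set s : ℂ := 2 + t * Complex.I with hs
    have hsre : s.re = 2 := by simp [hs]
    have hs1 : s ≠ 1 := by intro h; rw [h] at hsre; norm_num at hsre
    have hs1' : s - 1 ≠ 0 := sub_ne_zero.2 hs1
    have e1 : riemannZeta₁ s = (s - 1) * riemannZeta s := by
      rw [riemannZeta_eq_inv_sub_mul hs1]; field_simp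
    have h1 : 1 ≤ ‖s - 1‖ := by
      have := Complex.re_le_norm (s - 1)
      rw [Complex.sub_re, hsre, Complex.one_re] at this
      linarith
    have h2 : 1 / 3 ≤ ‖riemannZeta s‖ := by
      rw [← LSeries_one_eq_riemannZeta (by rw [hsre]; norm_num)]
      exact one_third_le_norm_LSeries (by simp) (fun n => by simp) hsre
    rw [e1, norm_mul]
    nlinarith

end

/-! ### Laplace transforms on vertical lines: decay, inversion, Plancherel, contour shifts -/

section

open MeasureTheory Set Filter Topology Asymptotics
open scoped ContDiff

/-- The two-sided Laplace transform `∫ h(v) e^{sv} dv`. -/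
noncomputable def laplaceTransform (h : ℝ → ℂ) (s : ℂ) : ℂ := ∫ v : ℝ, h v * Complex.exp (s * v)

section laplace

variable {h : ℝ → ℂ}

theorem integrable_mul_cexp (hc : Continuous h) (hs : HasCompactSupport h) (s : ℂ) :
    Integrable fun v : ℝ => h v * Complex.exp (s * v) :=
  (hc.mul (by fun_prop)).integrable_of_hasCompactSupport hs.mul_right

theorem integrable_norm_mul_exp (hc : Continuous h) (hs : HasCompactSupport h) (a : ℝ) :
    Integrable fun v : ℝ => ‖h v‖ * Real.exp (a * v) :=
  (hc.norm.mul (by fun_prop)).integrable_of_hasCompactSupport hs.norm.mul_right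

theorem differentiable_laplaceTransform (hc : Continuous h) (hs : HasCompactSupport h) :
    Differentiable ℂ (laplaceTransform h) := by
  intro s₀
  obtain ⟨R, hR0, hR⟩ : ∃ R : ℝ, 0 < R ∧ ∀ v, h v ≠ 0 → |v| ≤ R := by
    obtain ⟨R, hR0, hR⟩ := hs.isBounded.exists_pos_norm_le
    exact ⟨R, hR0, fun v hv => by simpa using hR v (subset_tsupport h hv)⟩
  set bound : ℝ → ℝ := fun v => ‖h v‖ * (R * Real.exp ((‖s₀‖ + 1) * R)) with hbound
  refine (hasDerivAt_integral_of_dominated_loc_of_deriv_le (μ := volume)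
    (F := fun (s : ℂ) (v : ℝ) => h v * Complex.exp (s * v))
    (F' := fun (s : ℂ) (v : ℝ) => h v * (Complex.exp (s * v) * v))
    (bound := bound) (Metric.ball_mem_nhds s₀ one_pos)
    (Eventually.of_forall fun s => (integrable_mul_cexp hc hs s).aestronglyMeasurable)
    (integrable_mul_cexp hc hs s₀) ?_ ?_ ?_ ?_).2.differentiableAt
  · exact (hc.mul (by fun_prop)).aestronglyMeasurable
  · refine Eventually.of_forall fun v s hsb => ?_
    by_cases hv : h v = 0
    · simp [hv, hbound]
    have hvR := hR v hv
    rw [hbound, norm_mul, norm_mul, Complex.norm_exp, Complex.norm_real, Real.norm_eq_abs,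
      mul_comm (Real.exp _)]
    have hsn : ‖s‖ ≤ ‖s₀‖ + 1 := by
      rw [Metric.mem_ball, dist_eq_norm] at hsb
      have := norm_add_le (s - s₀) s₀
      rw [sub_add_cancel] at this
      linarith
    have : (s * v).re ≤ (‖s₀‖ + 1) * R := by
      refine (Complex.re_le_norm _).trans ?_
      rw [norm_mul, Complex.norm_real, Real.norm_eq_abs]
      gcongr
    refine mul_le_mul_of_nonneg_left ?_ (norm_nonneg _)
    exact mul_le_mul hvR (Real.exp_le_exp.2 this) (Real.exp_pos _).le hR0.le
  · exact (hc.norm.mul continuous_const).integrable_of_hasCompactSupport hs.norm.mul_right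
  · refine Eventually.of_forall fun v s _ => ?_
    have h1 : HasDerivAt (fun s : ℂ => s * (v : ℂ)) v s := by
      simpa using (hasDerivAt_id s).mul_const (v : ℂ)
    exact h1.cexp.const_mul (h v)

theorem norm_laplaceTransform_le (h : ℝ → ℂ) (s : ℂ) :
    ‖laplaceTransform h s‖ ≤ ∫ v : ℝ, ‖h v‖ * Real.exp (s.re * v) := by
  refine (norm_integral_le_integral_norm _).trans (le_of_eq ?_)
  congr 1
  ext v
  rw [norm_mul, Complex.norm_exp]
  simp

theorem laplaceTransform_deriv (hd : ContDiff ℝ 1 h) (hs : HasCompactSupport h) (s : ℂ) :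
    laplaceTransform (deriv h) s = -s * laplaceTransform h s := by
  have hc := hd.continuous
  have hc' : Continuous (deriv h) := hd.continuous_deriv le_rfl
  have hs' : HasCompactSupport (deriv h) := hs.deriv
  have he : ∀ v : ℝ, HasDerivAt (fun v : ℝ => Complex.exp (s * v)) (s * Complex.exp (s * v)) v := by
    intro v
    have h1 : HasDerivAt (fun v : ℝ => s * (v : ℂ)) s v := by
      simpa using (Complex.ofRealCLM.hasDerivAt (x := v)).const_mul s
    simpa [mul_comm] using h1.cexp
  have h1 := integral_mul_deriv_eq_deriv_mul_of_integrable (u := h)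
    (v := fun v : ℝ => Complex.exp (s * v)) (u' := deriv h) (v' := fun v : ℝ => s * Complex.exp (s * v))
    (fun v _ => (hd.differentiable one_ne_zero v).hasDerivAt) (fun v _ => he v)
    (((hc.mul (by fun_prop)).integrable_of_hasCompactSupport hs.mul_right))
    (integrable_mul_cexp hc' hs' s) (integrable_mul_cexp hc hs s)
  have h2 : ∫ v : ℝ, h v * (s * Complex.exp (s * v)) = s * laplaceTransform h s := by
    rw [laplaceTransform, ← integral_const_mul]
    congr 1; ext v; ring
  rw [h2] at h1
  rw [laplaceTransform, neg_mul, h1, neg_neg]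

/-- Uniform quadratic decay of the Laplace transform in vertical strips. -/
theorem exists_norm_laplaceTransform_le (hd : ContDiff ℝ 2 h) (hs : HasCompactSupport h) (a b : ℝ)
    (ha : 0 < a) : ∃ C, 0 ≤ C ∧ ∀ s : ℂ, a ≤ s.re → s.re ≤ b →
      ‖laplaceTransform h s‖ ≤ C / (1 + s.im ^ 2) := by
  have hd1 : ContDiff ℝ 1 h := hd.of_le (by norm_num)
  have hd' : ContDiff ℝ 1 (deriv h) := hd.deriv' (n := 1)
  have hs' : HasCompactSupport (deriv h) := hs.deriv
  have hc'' : Continuous (deriv (deriv h)) := hd'.continuous_deriv le_rfl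
  set g := deriv (deriv h) with hg
  have hsg : HasCompactSupport g := hs'.deriv
  have hIa := integrable_norm_mul_exp hc'' hsg a
  have hIb := integrable_norm_mul_exp hc'' hsg b
  set B := ∫ v : ℝ, (‖g v‖ * Real.exp (a * v) + ‖g v‖ * Real.exp (b * v)) with hB
  have hB0 : 0 ≤ B := integral_nonneg fun v => by positivity
  -- `B` bounds the transform of h'' throughout the strip, since e^{Re(s)v} ≤ e^{av} + e^{bv}. The
  -- other factor comes from 1 + t² ≤ (1 + 1/a²)|s|² for Re s ≥ a.
  refine ⟨B * (1 + 1 / a ^ 2), by positivity, fun s h1 h2 => ?_⟩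
  have hs0 : 0 < s.re := ha.trans_le h1
  have e : laplaceTransform g s = s ^ 2 * laplaceTransform h s := by
    rw [hg, laplaceTransform_deriv hd' hs', laplaceTransform_deriv hd1 hs]; ring
  have h3 : ‖laplaceTransform g s‖ ≤ B := by
    refine (norm_laplaceTransform_le g s).trans ?_
    refine integral_mono (integrable_norm_mul_exp hc'' hsg _) (hIa.add hIb) fun v => ?_
    simp only [← mul_add]
    gcongr
    rcases le_total 0 v with hv | hv
    · have : Real.exp (s.re * v) ≤ Real.exp (b * v) := Real.exp_le_exp.2 (by gcongr)
      linarith [Real.exp_pos (a * v)]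
    · have : Real.exp (s.re * v) ≤ Real.exp (a * v) := Real.exp_le_exp.2 (by nlinarith)
      linarith [Real.exp_pos (b * v)]
  rw [e, norm_mul, norm_pow, Complex.sq_norm, Complex.normSq_apply] at h3
  rw [le_div_iff₀ (by positivity)]
  have h4 : 1 + s.im ^ 2 ≤ (1 + 1 / a ^ 2) * (s.re * s.re + s.im * s.im) := by
    have : a ^ 2 ≤ s.re * s.re := by nlinarith
    have h5 : 1 ≤ 1 / a ^ 2 * (s.re * s.re) := by
      rw [one_div, inv_mul_eq_div, le_div_iff₀ (by positivity)]; linarith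
    have h6 : 0 ≤ 1 / a ^ 2 * (s.im * s.im) := by
      have := mul_self_nonneg s.im; positivity
    nlinarith [mul_self_nonneg s.re]
  have hn := norm_nonneg (laplaceTransform h s)
  calc ‖laplaceTransform h s‖ * (1 + s.im ^ 2)
      ≤ ‖laplaceTransform h s‖ * ((1 + 1 / a ^ 2) * (s.re * s.re + s.im * s.im)) := by gcongr
    _ = ((s.re * s.re + s.im * s.im) * ‖laplaceTransform h s‖) * (1 + 1 / a ^ 2) := by ring
    _ ≤ _ := by gcongr

/-- The Laplace transform on a vertical line is a Fourier transform. -/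
theorem fourier_mul_exp_eq_laplaceTransform (h : ℝ → ℂ) (σ ξ : ℝ) :
    𝓕 (fun v : ℝ => h v * Complex.exp (σ * v)) ξ
      = laplaceTransform h (σ + (-2 * Real.pi * ξ : ℝ) * Complex.I) := by
  rw [Real.fourier_real_eq_integral_exp_smul, laplaceTransform]
  congr 1
  ext v
  rw [smul_eq_mul, mul_comm, mul_assoc, ← Complex.exp_add]
  congr 2
  push_cast
  ring

theorem continuous_laplaceTransform_line (hc : Continuous h) (hs : HasCompactSupport h) (σ : ℝ) :
    Continuous fun t : ℝ => laplaceTransform h (σ + t * Complex.I) :=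
  (differentiable_laplaceTransform hc hs).continuous.comp (by fun_prop)

theorem integrable_laplaceTransform_line (hd : ContDiff ℝ 2 h) (hs : HasCompactSupport h) {σ : ℝ}
    (hσ : 0 < σ) : Integrable fun t : ℝ => laplaceTransform h (σ + t * Complex.I) := by
  obtain ⟨C, hC, H⟩ := exists_norm_laplaceTransform_le hd hs σ σ hσ
  refine (integrable_inv_one_add_sq.const_mul C).mono'
    (continuous_laplaceTransform_line hd.continuous hs σ).aestronglyMeasurable
    (Eventually.of_forall fun t => ?_)
  simpa [div_eq_mul_inv] using H (σ + t * Complex.I) (by simp) (by simp)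

/-- Inversion of the Laplace transform along a vertical line. -/
theorem laplaceTransform_inversion (hd : ContDiff ℝ 2 h) (hs : HasCompactSupport h) {σ : ℝ}
    (hσ : 0 < σ) (v : ℝ) :
    h v = (1 / (2 * Real.pi) : ℝ) *
      ∫ t : ℝ, laplaceTransform h (σ + t * Complex.I) * Complex.exp (-(σ + t * Complex.I) * v) := by
  have hpi := Real.pi_pos
  set G : ℝ → ℂ := fun v : ℝ => h v * Complex.exp (σ * v) with hG
  have hGc : Continuous G := hd.continuous.mul (by fun_prop)
  have hGi : Integrable G := integrable_mul_cexp hd.continuous hs σ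
  have hF : 𝓕 G = fun ξ : ℝ => laplaceTransform h (σ + (-2 * Real.pi * ξ : ℝ) * Complex.I) := by
    ext ξ; exact fourier_mul_exp_eq_laplaceTransform h σ ξ
  have hFi : Integrable (𝓕 G) := by
    rw [hF]
    exact (integrable_laplaceTransform_line hd hs hσ).comp_mul_left' (by positivity : -2 * Real.pi ≠ 0)
  have h1 := congrFun (hGc.fourierInv_fourier_eq hGi hFi) v
  rw [hF, Real.fourierInv_eq'] at h1
  have h2 : h v = G v * Complex.exp (-(σ * v)) := by
    rw [hG]; simp only; rw [mul_assoc, ← Complex.exp_add]; simp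
  set k : ℝ → ℂ := fun t => laplaceTransform h (σ + t * Complex.I) *
    Complex.exp (-(σ + t * Complex.I) * v) with hk
  have h3 := Measure.integral_comp_mul_left k (-2 * Real.pi)
  rw [h2, ← h1, ← integral_mul_const]
  have h4 : |(-2 * Real.pi)⁻¹| = 1 / (2 * Real.pi) := by
    rw [abs_inv, abs_mul, abs_of_pos hpi]; simp
  rw [h4] at h3
  have h5 : ((1 / (2 * Real.pi) : ℝ) : ℂ) * integral volume k = (1 / (2 * Real.pi)) • integral volume k :=
    (Complex.real_smul).symm
  rw [h5, ← h3]
  congr 1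
  ext ξ
  rw [hk]
  simp only [smul_eq_mul]
  rw [mul_comm (Complex.exp _), mul_assoc, ← Complex.exp_add]
  congr 2
  simp only [inner]
  push_cast
  simp
  ring

/-- Plancherel's identity for the Laplace transform along a vertical line. -/
theorem integral_norm_sq_laplaceTransform (hd : ContDiff ℝ ∞ h) (hs : HasCompactSupport h) (σ : ℝ) :
    ∫ t : ℝ, ‖laplaceTransform h (σ + t * Complex.I)‖ ^ 2
      = 2 * Real.pi * ∫ v : ℝ, ‖h v‖ ^ 2 * Real.exp (2 * σ * v) := by
  have hpi := Real.pi_pos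
  set G : ℝ → ℂ := fun v : ℝ => h v * Complex.exp (σ * v) with hG
  have hGs : HasCompactSupport G := hs.mul_right
  have hGd : ContDiff ℝ ∞ G :=
    hd.mul (Complex.contDiff_exp.comp (contDiff_const.mul Complex.ofRealCLM.contDiff))
  -- h(v)e^{σv} is smooth of compact support, hence Schwartz. The change of variable t = −2πξ
  -- produces the factor 2π.
  have h1 := SchwartzMap.integral_norm_sq_fourier (hGs.toSchwartzMap hGd)
  rw [SchwartzMap.fourier_coe] at h1
  have h2 : ((hGs.toSchwartzMap hGd : SchwartzMap ℝ ℂ) : ℝ → ℂ) = G := rfl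
  rw [h2] at h1
  have h3 : ∀ ξ, 𝓕 G ξ = laplaceTransform h (σ + (-2 * Real.pi * ξ : ℝ) * Complex.I) :=
    fun ξ => fourier_mul_exp_eq_laplaceTransform h σ ξ
  simp_rw [h3] at h1
  have h4 := Measure.integral_comp_mul_left
    (fun t : ℝ => ‖laplaceTransform h (σ + t * Complex.I)‖ ^ 2) (-2 * Real.pi)
  have h5 : |(-2 * Real.pi)⁻¹| = (2 * Real.pi)⁻¹ := by
    rw [abs_inv, abs_mul, abs_of_pos hpi]; simp
  rw [h1, h5, smul_eq_mul, eq_inv_mul_iff_mul_eq₀ (by positivity)] at h4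
  rw [← h4]
  congr 1
  congr 1
  ext v
  rw [hG, norm_mul, Complex.norm_exp, mul_pow, ← Real.exp_nat_mul]
  congr 2
  simp
  ring

end laplace

theorem integrable_one_add_sq_rpow_neg : Integrable fun t : ℝ => (1 + t ^ 2) ^ (-(3 / 4) : ℝ) := by
  have := integrable_rpow_neg_one_add_norm_sq (E := ℝ) (μ := volume) (r := 3 / 2) (by simp; norm_num)
  refine this.congr (Eventually.of_forall fun t => ?_)
  simp only [Real.norm_eq_abs, sq_abs]
  norm_num

/-- Shifting a vertical contour for a function of sufficient decay. -/
theorem integral_vertical_line_eq {f : ℂ → ℂ} {a b C : ℝ} (hab : a ≤ b)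
    (hf : ∀ s : ℂ, a ≤ s.re → s.re ≤ b → DifferentiableAt ℂ f s)
    (hb : ∀ s : ℂ, a ≤ s.re → s.re ≤ b → ‖f s‖ ≤ C * (1 + s.im ^ 2) ^ (-(3 / 4) : ℝ)) :
    ∫ t : ℝ, f (a + t * Complex.I) = ∫ t : ℝ, f (b + t * Complex.I) := by
  have hint : ∀ σ : ℝ, a ≤ σ → σ ≤ b → Integrable fun t : ℝ => f (σ + t * Complex.I) := by
    intro σ h1 h2
    refine (integrable_one_add_sq_rpow_neg.const_mul C).mono' ?_ (Eventually.of_forall fun t => ?_)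
    · refine Continuous.aestronglyMeasurable (continuous_iff_continuousAt.2 fun t => ?_)
      have : ContinuousAt f (σ + t * Complex.I) := (hf _ (by simpa) (by simpa)).continuousAt
      exact ContinuousAt.comp (f := fun t : ℝ => (σ : ℂ) + t * Complex.I) this (by fun_prop)
    · simpa using hb (σ + t * Complex.I) (by simpa) (by simpa)
  have hlim : ∀ σ : ℝ, a ≤ σ → σ ≤ b → Tendsto (fun T : ℝ => ∫ t in (-T)..T, f (σ + t * Complex.I))
      atTop (𝓝 (∫ t : ℝ, f (σ + t * Complex.I))) := fun σ h1 h2 =>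
    intervalIntegral_tendsto_integral (hint σ h1 h2) tendsto_neg_atTop_atBot tendsto_id
  have hdec : Tendsto (fun T : ℝ => C * (1 + T ^ 2) ^ (-(3 / 4) : ℝ) * |b - a|) atTop (𝓝 0) := by
    have h1 : Tendsto (fun T : ℝ => 1 + T ^ 2) atTop atTop :=
      tendsto_atTop_add_const_left _ _ (tendsto_pow_atTop two_ne_zero)
    have h2 := (tendsto_rpow_neg_atTop (by norm_num : (0 : ℝ) < 3 / 4)).comp h1
    simpa using (h2.const_mul C).mul_const |b - a|
  -- The signs e = ±1 give the two horizontal edges; their length is fixed and the integrand decays.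
  have hhor : ∀ e : ℝ, e ^ 2 = 1 → Tendsto (fun T : ℝ => ∫ x in a..b, f (x + (e * T : ℝ) * Complex.I))
      atTop (𝓝 0) := by
    intro e he
    refine squeeze_zero_norm (fun T => ?_) hdec
    refine intervalIntegral.norm_integral_le_of_norm_le_const fun x hx => ?_
    rw [uIoc_of_le hab] at hx
    have := hb (x + (e * T : ℝ) * Complex.I) (by simpa using hx.1.le) (by simpa using hx.2)
    simpa [mul_pow, he] using this
  have hrect : ∀ T : ℝ, (∫ x in a..b, f (x + (-1 * T : ℝ) * Complex.I))
      - (∫ x in a..b, f (x + (1 * T : ℝ) * Complex.I))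
      + Complex.I • (∫ t in (-T)..T, f (b + t * Complex.I))
      - Complex.I • (∫ t in (-T)..T, f (a + t * Complex.I)) = 0 := by
    intro T
    have := Complex.integral_boundary_rect_eq_zero_of_differentiableOn f
      (a + (-T : ℝ) * Complex.I) (b + (T : ℝ) * Complex.I) ?_
    · simpa using this
    · intro s hs
      rw [Complex.mem_reProdIm] at hs
      have h1 : s.re ∈ Icc a b := by simpa [uIcc_of_le hab] using hs.1
      exact (hf s h1.1 h1.2).differentiableWithinAt
  have htot := (((hhor (-1) (by norm_num)).sub (hhor 1 (by norm_num))).add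
    ((hlim b hab le_rfl).const_smul Complex.I)).sub ((hlim a le_rfl hab).const_smul Complex.I)
  have hzero := tendsto_nhds_unique htot
    ((tendsto_const_nhds (x := (0 : ℂ))).congr fun T => (hrect T).symm)
  simp only [sub_zero, zero_add, smul_eq_mul, ← mul_sub] at hzero
  have := (mul_eq_zero.1 hzero).resolve_left Complex.I_ne_zero
  exact (sub_eq_zero.1 this).symm

/-- Cauchy–Schwarz bound for the contour integral of a Laplace transform against a function of slow
growth. -/
theorem norm_integral_laplaceTransform_mul_le {h : ℝ → ℂ} (hd : ContDiff ℝ ∞ h)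
    (hs : HasCompactSupport h) {F : ℂ → ℂ} {σ A : ℝ} (hσ : 1 / 2 ≤ σ) (hA : 0 ≤ A)
    (hFc : Continuous fun t : ℝ => F (σ + t * Complex.I))
    (hF : ∀ t : ℝ, ‖F (σ + t * Complex.I)‖ ≤ A * (1 + t ^ 2) ^ (1 / 8 : ℝ)) :
    ‖∫ t : ℝ, laplaceTransform h (σ + t * Complex.I) * F (σ + t * Complex.I)‖ ≤
      (2 * √(∫ t : ℝ, (1 + t ^ 2) ^ (-(3 / 4) : ℝ)) * √(2 * Real.pi)) * A *
        √(∫ v : ℝ, ‖deriv h v‖ ^ 2 * Real.exp (2 * σ * v)) := by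
  have hd1 : ContDiff ℝ 1 h := hd.of_le (by exact_mod_cast le_top)
  have hdd : ContDiff ℝ ∞ (deriv h) := hd.deriv' (n := ∞)
  set s : ℝ → ℂ := fun t => σ + t * Complex.I with hsdef
  -- |s|² = σ² + t² ≥ 1/4 + t² because σ ≥ 1/2.
  have hsn : ∀ t, (1 + t ^ 2) / 4 ≤ ‖s t‖ ^ 2 := by
    intro t
    rw [Complex.sq_norm, Complex.normSq_apply]
    simp [hsdef]
    nlinarith [sq_nonneg t]
  have hs0 : ∀ t, s t ≠ 0 := by
    intro t h0
    have := congrArg Complex.re h0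
    simp [hsdef] at this
    linarith
  -- A factor s is moved from F to the transform, where it becomes a derivative of h. Then F/s is
  -- square integrable, as |F/s|² ≪ (1+t²)^{1/4−1}, and the other factor is controlled by Plancherel
  -- for h'.
  set u : ℝ → ℂ := fun t => laplaceTransform (deriv h) (s t) with hu
  set w : ℝ → ℂ := fun t => F (s t) / s t with hw
  have hsc : Continuous s := by fun_prop
  have huc : Continuous u := continuous_laplaceTransform_line hdd.continuous hs.deriv σ
  have hwc : Continuous w := hFc.div hsc hs0
  have hprod : ∀ t, ‖laplaceTransform h (s t) * F (s t)‖ = ‖u t‖ * ‖w t‖ := by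
    intro t
    rw [hu, hw]
    simp only
    rw [laplaceTransform_deriv hd1 hs, norm_mul, norm_mul, norm_neg, norm_div]
    have := norm_ne_zero_iff.2 (hs0 t)
    field_simp
  have hwb : ∀ t, ‖w t‖ ^ 2 ≤ 4 * A ^ 2 * (1 + t ^ 2) ^ (-(3 / 4) : ℝ) := by
    intro t
    have hp : (0 : ℝ) < 1 + t ^ 2 := by positivity
    rw [hw, norm_div, div_pow, div_le_iff₀ (by have := norm_pos_iff.2 (hs0 t); positivity)]
    calc ‖F (s t)‖ ^ 2 ≤ (A * (1 + t ^ 2) ^ (1 / 8 : ℝ)) ^ 2 := by gcongr; exact hF t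
      _ = A ^ 2 * (1 + t ^ 2) ^ (1 / 4 : ℝ) := by
        rw [mul_pow, ← Real.rpow_natCast ((1 + t ^ 2) ^ (1 / 8 : ℝ)), ← Real.rpow_mul hp.le]; norm_num
      _ = 4 * A ^ 2 * (1 + t ^ 2) ^ (-(3 / 4) : ℝ) * ((1 + t ^ 2) / 4) := by
        have : (1 + t ^ 2) ^ (1 / 4 : ℝ) = (1 + t ^ 2) ^ (-(3 / 4) : ℝ) * (1 + t ^ 2) := by
          conv_rhs => rw [← Real.rpow_one (1 + t ^ 2), ← Real.rpow_mul hp.le]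
          rw [← Real.rpow_add hp]; norm_num
        rw [this]; ring
      _ ≤ _ := by gcongr; exact hsn t
  have hwi : Integrable fun t => ‖w t‖ ^ 2 := by
    refine (integrable_one_add_sq_rpow_neg.const_mul (4 * A ^ 2)).mono'
      (by fun_prop) (Eventually.of_forall fun t => ?_)
    rw [Real.norm_of_nonneg (by positivity)]
    exact hwb t
  have hui : Integrable fun t => ‖u t‖ ^ 2 := by
    obtain ⟨C, hC, H⟩ := exists_norm_laplaceTransform_le
      (contDiff_infty.1 hdd 2) hs.deriv σ σ (by linarith)
    refine (integrable_inv_one_add_sq.const_mul (C ^ 2)).mono'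
      (by fun_prop) (Eventually.of_forall fun t => ?_)
    rw [Real.norm_of_nonneg (by positivity)]
    have h1 := H (s t) (by simp [hsdef]) (by simp [hsdef])
    have h2 : (s t).im = t := by simp [hsdef]
    rw [h2] at h1
    calc ‖u t‖ ^ 2 ≤ (C / (1 + t ^ 2)) ^ 2 := by gcongr
      _ = C ^ 2 * ((1 + t ^ 2)⁻¹ * (1 + t ^ 2)⁻¹) := by ring
      _ ≤ C ^ 2 * ((1 + t ^ 2)⁻¹ * 1) := by
        gcongr
        exact inv_le_one_of_one_le₀ (by nlinarith [sq_nonneg t])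
      _ = _ := by ring
  have hCS : ∫ t, ‖u t‖ * ‖w t‖ ≤ √(∫ t, ‖u t‖ ^ 2) * √(∫ t, ‖w t‖ ^ 2) := by
    have hm := fun (g : ℝ → ℂ) (hg : Continuous g) (hi : Integrable fun t => ‖g t‖ ^ 2) =>
      (memLp_two_iff_integrable_sq_norm hg.aestronglyMeasurable).2 hi
    have := integral_mul_norm_le_Lp_mul_Lq (μ := volume) (f := u) (g := w)
      (Real.holderConjugate_iff.2 ⟨by norm_num, by norm_num⟩ : Real.HolderConjugate 2 2)
      (by simpa using hm u huc hui) (by simpa using hm w hwc hwi)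
    simpa [Real.sqrt_eq_rpow] using this
  have h1 : ‖∫ t : ℝ, laplaceTransform h (s t) * F (s t)‖ ≤ ∫ t, ‖u t‖ * ‖w t‖ := by
    refine (norm_integral_le_integral_norm _).trans (le_of_eq ?_)
    congr 1; ext t; exact hprod t
  have h2 : √(∫ t, ‖w t‖ ^ 2) ≤ 2 * A * √(∫ t : ℝ, (1 + t ^ 2) ^ (-(3 / 4) : ℝ)) := by
    have : ∫ t, ‖w t‖ ^ 2 ≤ (2 * A) ^ 2 * ∫ t : ℝ, (1 + t ^ 2) ^ (-(3 / 4) : ℝ) := by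
      rw [← integral_const_mul]
      refine integral_mono hwi (integrable_one_add_sq_rpow_neg.const_mul _) fun t => ?_
      refine (hwb t).trans (le_of_eq ?_); ring
    refine (Real.sqrt_le_sqrt this).trans (le_of_eq ?_)
    rw [Real.sqrt_mul (by positivity), Real.sqrt_sq (by positivity)]
  have h3 : √(∫ t, ‖u t‖ ^ 2)
      = √(2 * Real.pi) * √(∫ v : ℝ, ‖deriv h v‖ ^ 2 * Real.exp (2 * σ * v)) := by
    rw [← Real.sqrt_mul (by positivity), ← integral_norm_sq_laplaceTransform hdd hs.deriv σ]
  refine (h1.trans hCS).trans ?_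
  rw [h3]
  calc _ ≤ √(2 * Real.pi) * √(∫ v : ℝ, ‖deriv h v‖ ^ 2 * Real.exp (2 * σ * v)) *
        (2 * A * √(∫ t : ℝ, (1 + t ^ 2) ^ (-(3 / 4) : ℝ))) := by gcongr
    _ = _ := by ring

end

/-! ### Smoothed sums over prime powers under GRH -/

section

open MeasureTheory Set Filter Topology Asymptotics
open scoped ContDiff

/-- Smoothed sum of the coefficients of a Dirichlet series as a contour integral. -/
theorem hasSum_mul_log_eq_integral {a : ℕ → ℂ} (ha0 : a 0 = 0) {h : ℝ → ℂ} (hd : ContDiff ℝ 2 h)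
    (hs : HasCompactSupport h) {σ : ℝ} (hσ : 0 < σ) (ha : LSeriesSummable a σ) :
    HasSum (fun n : ℕ => a n * h (Real.log n)) ((1 / (2 * Real.pi) : ℝ) *
      ∫ t : ℝ, laplaceTransform h (σ + t * Complex.I) * LSeries a (σ + t * Complex.I)) := by
  set Φ : ℝ → ℂ := fun t => laplaceTransform h (σ + t * Complex.I) with hΦ
  have hΦi : Integrable Φ := integrable_laplaceTransform_line hd hs hσ
  set F : ℕ → ℝ → ℂ := fun n t => Φ t * LSeries.term a (σ + t * Complex.I) n with hF
  have hterm : ∀ (n : ℕ) (t : ℝ), LSeries.term a (σ + t * Complex.I) n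
      = a n * Complex.exp (-(σ + t * Complex.I) * Real.log n) := by
    intro n t
    rcases eq_or_ne n 0 with rfl | hn
    · simp [ha0]
    · rw [LSeries.term_of_ne_zero hn, Complex.cpow_def_of_ne_zero (by exact_mod_cast hn), div_eq_mul_inv,
        ← Complex.exp_neg, Complex.natCast_log]
      congr 2
      ring
  have hnorm : ∀ (n : ℕ) (t : ℝ), ‖LSeries.term a (σ + t * Complex.I) n‖ = ‖LSeries.term a σ n‖ := by
    intro n t
    rw [LSeries.norm_term_eq, LSeries.norm_term_eq]; simp
  have hFi : ∀ n, Integrable (F n) := by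
    intro n
    refine (hΦi.norm.mul_const ‖LSeries.term a σ n‖).mono' ?_ (Eventually.of_forall fun t => ?_)
    · refine Continuous.aestronglyMeasurable ?_
      simp only [hF, hterm]
      exact (continuous_laplaceTransform_line hd.continuous hs σ).mul (by fun_prop)
    · rw [hF, norm_mul, hnorm]
  have hsum : Summable fun n => ∫ t, ‖F n t‖ := by
    have : ∀ n, ∫ t, ‖F n t‖ = (∫ t, ‖Φ t‖) * ‖LSeries.term a σ n‖ := by
      intro n
      rw [← integral_mul_const]
      congr 1; ext t
      rw [hF, norm_mul, hnorm]
    simp_rw [this]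
    exact ha.norm.mul_left _
  have key := (hasSum_integral_of_summable_integral_norm hFi hsum).mul_left
    (((1 / (2 * Real.pi) : ℝ)) : ℂ)
  have e1 : ∀ n : ℕ, ((1 / (2 * Real.pi) : ℝ) : ℂ) * ∫ t, F n t = a n * h (Real.log n) := by
    intro n
    have : ∫ t, F n t = a n * ∫ t : ℝ, laplaceTransform h (σ + t * Complex.I) *
        Complex.exp (-(σ + t * Complex.I) * Real.log n) := by
      rw [← integral_const_mul]
      refine integral_congr_ae (Eventually.of_forall fun t => ?_)
      simp only [hF, hterm]
      ring
    rw [laplaceTransform_inversion hd hs hσ (Real.log n), this]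
    ring
  have e2 : ∀ t, ∑' n, F n t = Φ t * LSeries a (σ + t * Complex.I) := fun t => tsum_mul_left
  simp_rw [e1, e2] at key
  exact key

/-- Insert the inversion formula and use ∫_0^∞ e^{-(s−1)v}dv = 1/(s−1) for Re s > 1. The result
identifies the contribution of the pole of −ζ'/ζ without computing a residue. -/
theorem integral_Ioi_mul_exp_eq_integral {h : ℝ → ℂ} (hd : ContDiff ℝ 2 h)
    (hs : HasCompactSupport h) {σ : ℝ} (hσ : 1 < σ) :
    ∫ v in Ioi (0 : ℝ), h v * Complex.exp v = (1 / (2 * Real.pi) : ℝ) *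
      ∫ t : ℝ, laplaceTransform h (σ + t * Complex.I) * (1 / (σ + t * Complex.I - 1)) := by
  have hσ0 : 0 < σ := by linarith
  set Φ : ℝ → ℂ := fun t => laplaceTransform h (σ + t * Complex.I) with hΦ
  have hΦi : Integrable Φ := integrable_laplaceTransform_line hd hs hσ0
  set w : ℝ → ℝ → ℂ := fun v t => Φ t * Complex.exp (-(σ + t * Complex.I - 1) * v) with hw
  have h1 : ∀ v : ℝ, h v * Complex.exp v = (1 / (2 * Real.pi) : ℝ) * ∫ t, w v t := by
    intro v
    rw [laplaceTransform_inversion hd hs hσ0 v, mul_assoc, ← integral_mul_const]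
    congr 2
    ext t
    rw [hw, mul_assoc, ← Complex.exp_add]
    congr 2
    ring
  have h2 : ∀ t : ℝ, ∫ v in Ioi (0 : ℝ), w v t = Φ t * (1 / (σ + t * Complex.I - 1)) := by
    intro t
    rw [hw, integral_const_mul, integral_exp_mul_complex_Ioi (by simp; linarith)]
    simp only [Complex.ofReal_zero, mul_zero, Complex.exp_zero]
    rw [neg_div_neg_eq]
  simp_rw [h1]
  rw [integral_const_mul, integral_integral_swap]
  · simp_rw [h2, hΦ]
  · have hexp : Integrable (fun v : ℝ => Real.exp (-(σ - 1) * v)) (volume.restrict (Ioi 0)) :=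
      integrableOn_exp_mul_Ioi (by linarith) 0
    refine (hexp.mul_prod hΦi.norm).mono' ?_ (Eventually.of_forall fun z => ?_)
    · refine Continuous.aestronglyMeasurable ?_
      have h3 := (continuous_laplaceTransform_line hd.continuous hs σ).comp continuous_snd (X := ℝ × ℝ)
      exact h3.mul (by fun_prop)
    · rw [Function.uncurry_def, hw, norm_mul, Complex.norm_exp, mul_comm]
      simp

/-- Moving the line of integration from `Re s = 2` to `Re s = 1/2 + δ`. -/
theorem norm_integral_laplaceTransform_mul_line_two_le {δ : ℝ} (hδ : 0 < δ) (hδ1 : δ ≤ 1)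
    {h : ℝ → ℂ} (hd : ContDiff ℝ ∞ h) (hs : HasCompactSupport h) {F : ℂ → ℂ} {A : ℝ} (hA : 0 ≤ A)
    (hFd : ∀ s : ℂ, 1 / 2 < s.re → DifferentiableAt ℂ F s)
    (hF : ∀ s : ℂ, 1 / 2 + δ ≤ s.re → s.re ≤ 2 → ‖F s‖ ≤ A * (1 + s.im ^ 2) ^ (1 / 8 : ℝ)) :
    ‖∫ t : ℝ, laplaceTransform h ((2 : ℝ) + t * Complex.I) * F ((2 : ℝ) + t * Complex.I)‖ ≤
      (2 * √(∫ t : ℝ, (1 + t ^ 2) ^ (-(3 / 4) : ℝ)) * √(2 * Real.pi)) * A *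
        √(∫ v : ℝ, ‖deriv h v‖ ^ 2 * Real.exp ((1 + 2 * δ) * v)) := by
  have hd2 : ContDiff ℝ 2 h := contDiff_infty.1 hd 2
  obtain ⟨B, hB, HB⟩ := exists_norm_laplaceTransform_le hd2 hs (1 / 2 + δ) 2 (by linarith)
  -- The product decays like (1+t²)^{−1+1/8}, which is better than the exponent −3/4 needed for the
  -- shift.
  have e2 := integral_vertical_line_eq (f := fun s => laplaceTransform h s * F s)
    (a := 1 / 2 + δ) (b := 2) (C := B * A) (by linarith)
    (fun s h1 h2 => (differentiable_laplaceTransform hd.continuous hs s).mul (hFd s (by linarith))) ?_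
  · rw [← e2]
    have h3 := norm_integral_laplaceTransform_mul_le hd hs (F := F) (σ := 1 / 2 + δ) (A := A)
      (by linarith) hA ?_ ?_
    · rw [show 2 * (1 / 2 + δ) = 1 + 2 * δ by ring] at h3
      exact h3
    · refine continuous_iff_continuousAt.2 fun t => ?_
      have : ContinuousAt F ((1 / 2 + δ : ℝ) + t * Complex.I) :=
        (hFd _ (by simp; linarith)).continuousAt
      exact ContinuousAt.comp (f := fun t : ℝ => ((1 / 2 + δ : ℝ) : ℂ) + t * Complex.I) this
        (by fun_prop)
    · intro t
      simpa using hF ((1 / 2 + δ : ℝ) + t * Complex.I) (by simp) (by simp; linarith)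
  · intro s h1 h2
    have hp : (0 : ℝ) < 1 + s.im ^ 2 := by positivity
    rw [norm_mul]
    calc _ ≤ B / (1 + s.im ^ 2) * (A * (1 + s.im ^ 2) ^ (1 / 8 : ℝ)) := by
          gcongr
          · exact HB s h1 h2
          · exact hF s h1 h2
      _ = B * A * ((1 + s.im ^ 2) ^ (-1 : ℝ) * (1 + s.im ^ 2) ^ (1 / 8 : ℝ)) := by
          rw [Real.rpow_neg_one]; ring
      _ = B * A * (1 + s.im ^ 2) ^ (-(7 / 8) : ℝ) := by
          rw [← Real.rpow_add hp]; norm_num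
      _ ≤ _ := by
          refine mul_le_mul_of_nonneg_left ?_ (by positivity)
          exact Real.rpow_le_rpow_of_exponent_le (by nlinarith [sq_nonneg s.im]) (by norm_num)

/-- Under GRH, square-root cancellation in sums of `χ(n) Λ(n)` against a smooth weight. -/
theorem GRHDirichlet.exists_norm_tsum_vonMangoldt_character_le (hG : GRHDirichlet) {δ : ℝ}
    (hδ : 0 < δ) (hδ1 : δ ≤ 1) : ∃ C : ℝ, 0 ≤ C ∧ ∀ (q : ℕ) [NeZero q] (χ : DirichletCharacter ℂ q),
      χ ≠ 1 → ∀ h : ℝ → ℂ, ContDiff ℝ ∞ h → HasCompactSupport h →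
        ‖∑' n : ℕ, χ n * ArithmeticFunction.vonMangoldt n * h (Real.log n)‖ ≤
          C * (q : ℝ) ^ δ * √(∫ v : ℝ, ‖deriv h v‖ ^ 2 * Real.exp ((1 + 2 * δ) * v)) := by
  obtain ⟨C, hC, H⟩ := hG.exists_norm_logDeriv_LFunction_le hδ hδ1
  set D := 2 * √(∫ t : ℝ, (1 + t ^ 2) ^ (-(3 / 4) : ℝ)) * √(2 * Real.pi) with hD
  refine ⟨(1 / (2 * Real.pi)) * D * C, by positivity, fun q _ χ hχ h hd hs => ?_⟩
  have hd2 : ContDiff ℝ 2 h := contDiff_infty.1 hd 2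
  set F : ℂ → ℂ := fun s => deriv χ.LFunction s / χ.LFunction s with hF
  have hFd : ∀ s : ℂ, 1 / 2 < s.re → DifferentiableAt ℂ F s := fun s hs1 =>
    ((DirichletCharacter.differentiable_LFunction hχ).deriv s).div
      (DirichletCharacter.differentiable_LFunction hχ s) (hG.LFunction_ne_zero (Or.inl hχ) hs1)
  have hsum := hasSum_mul_log_eq_integral
    (a := fun n => χ n * ArithmeticFunction.vonMangoldt n) (by simp) hd2 hs (σ := 2) two_pos
    (DirichletCharacter.LSeriesSummable_twist_vonMangoldt χ (by simp))
  have e1 : ∀ t : ℝ, LSeries (fun n => χ n * ArithmeticFunction.vonMangoldt n)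
      ((2 : ℝ) + t * Complex.I) = -F ((2 : ℝ) + t * Complex.I) := by
    intro t
    have h2 : 1 < ((2 : ℝ) + t * Complex.I : ℂ).re := by simp
    have := DirichletCharacter.LSeries_twist_vonMangoldt_eq χ h2
    simp only [hF]
    rw [DirichletCharacter.LFunction_eq_LSeries χ h2,
      DirichletCharacter.deriv_LFunction_eq_deriv_LSeries χ h2, ← neg_div, ← this]
    rfl
  rw [hsum.tsum_eq]
  simp_rw [e1, mul_neg]
  rw [integral_neg, mul_neg, norm_neg, norm_mul, Complex.norm_real,
    Real.norm_of_nonneg (by positivity)]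
  have := norm_integral_laplaceTransform_mul_line_two_le hδ hδ1 hd hs (F := F)
    (A := C * (q : ℝ) ^ δ) (by positivity) hFd (H q χ hχ)
  calc _ ≤ 1 / (2 * Real.pi) * (D * (C * (q : ℝ) ^ δ) *
        √(∫ v : ℝ, ‖deriv h v‖ ^ 2 * Real.exp ((1 + 2 * δ) * v))) := by gcongr
    _ = _ := by ring

/-- Under RH, the smooth prime number theorem with square-root error term. -/
theorem GRHDirichlet.exists_norm_tsum_vonMangoldt_sub_integral_le (hG : GRHDirichlet) {δ : ℝ}
    (hδ : 0 < δ) (hδ1 : δ ≤ 1) : ∃ C : ℝ, 0 ≤ C ∧ ∀ h : ℝ → ℂ, ContDiff ℝ ∞ h →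
      HasCompactSupport h →
        ‖∑' n : ℕ, (ArithmeticFunction.vonMangoldt n : ℂ) * h (Real.log n)
            - ∫ v in Ioi (0 : ℝ), h v * Complex.exp v‖ ≤
          C * √(∫ v : ℝ, ‖deriv h v‖ ^ 2 * Real.exp ((1 + 2 * δ) * v)) := by
  obtain ⟨C, hC, H⟩ := hG.exists_norm_logDeriv_riemannZeta₁_le hδ hδ1
  set D := 2 * √(∫ t : ℝ, (1 + t ^ 2) ^ (-(3 / 4) : ℝ)) * √(2 * Real.pi) with hD
  refine ⟨(1 / (2 * Real.pi)) * D * C, by positivity, fun h hd hs => ?_⟩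
  have hd2 : ContDiff ℝ 2 h := contDiff_infty.1 hd 2
  set F : ℂ → ℂ := fun s => deriv riemannZeta₁ s / riemannZeta₁ s with hF
  have hFd : ∀ s : ℂ, 1 / 2 < s.re → DifferentiableAt ℂ F s := fun s hs1 =>
    (differentiable_riemannZeta₁.deriv s).div
      (differentiable_riemannZeta₁ s) (hG.riemannZeta₁_ne_zero hs1)
  have hsum := hasSum_mul_log_eq_integral
    (a := fun n => (ArithmeticFunction.vonMangoldt n : ℂ)) (by simp) hd2 hs (σ := 2) two_pos
    (ArithmeticFunction.LSeriesSummable_vonMangoldt (by simp))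
  -- −ζ'/ζ = 1/(s−1) − F with F the logarithmic derivative of (s−1)ζ(s). The first part reproduces
  -- the integral over v > 0, and F is holomorphic for Re s > 1/2, so only F is moved.
  have e1 : ∀ t : ℝ, LSeries (fun n => (ArithmeticFunction.vonMangoldt n : ℂ))
      ((2 : ℝ) + t * Complex.I) =
        1 / ((2 : ℝ) + t * Complex.I - 1) - F ((2 : ℝ) + t * Complex.I) := by
    intro t
    set s : ℂ := (2 : ℝ) + t * Complex.I with hsdef
    have h2 : 1 < s.re := by simp [hsdef]
    have hs1 : s ≠ 1 := by intro h0; rw [h0] at h2; simp at h2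
    have hs1' : s - 1 ≠ 0 := sub_ne_zero.2 hs1
    have hz : riemannZeta s ≠ 0 := riemannZeta_ne_zero_of_one_lt_re h2
    have heq : riemannZeta₁ =ᶠ[𝓝 s] fun z => (z - 1) * riemannZeta z := by
      filter_upwards [isOpen_ne.mem_nhds hs1] with z hz
      rw [riemannZeta_eq_inv_sub_mul hz, mul_inv_cancel_left₀ (sub_ne_zero.2 hz)]
    have hder : deriv riemannZeta₁ s = riemannZeta s + (s - 1) * deriv riemannZeta s := by
      rw [heq.deriv_eq]
      have := ((hasDerivAt_id s).sub_const 1).mul (differentiableAt_riemannZeta hs1).hasDerivAt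
      refine (HasDerivAt.deriv this).trans ?_
      simp
    rw [ArithmeticFunction.LSeries_vonMangoldt_eq_deriv_riemannZeta_div h2]
    simp only [hF]
    rw [hder, heq.eq_of_nhds]
    field_simp
    ring
  rw [hsum.tsum_eq, integral_Ioi_mul_exp_eq_integral hd2 hs one_lt_two]
  have hΦ := integrable_laplaceTransform_line hd2 hs two_pos
  have hne : ∀ t : ℝ, ((2 : ℝ) + t * Complex.I - 1 : ℂ) ≠ 0 := by
    intro t h0
    have := congrArg Complex.re h0
    norm_num at this
  have hinv : Continuous fun t : ℝ => 1 / ((2 : ℝ) + t * Complex.I - 1 : ℂ) :=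
    continuous_const.div (by fun_prop) hne
  have hi1 : Integrable fun t : ℝ => laplaceTransform h ((2 : ℝ) + t * Complex.I) *
      (1 / ((2 : ℝ) + t * Complex.I - 1)) := by
    refine hΦ.norm.mono' ?_ (Eventually.of_forall fun t => ?_)
    · exact ((continuous_laplaceTransform_line hd.continuous hs 2).mul hinv).aestronglyMeasurable
    · rw [norm_mul]
      refine mul_le_of_le_one_right (norm_nonneg _) ?_
      rw [norm_div, norm_one, div_le_one (norm_pos_iff.2 (hne t))]
      have := Complex.re_le_norm ((2 : ℝ) + t * Complex.I - 1 : ℂ)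
      norm_num at this
      simpa using this
  have e3 : ∀ t : ℝ, laplaceTransform h ((2 : ℝ) + t * Complex.I) * F ((2 : ℝ) + t * Complex.I)
      = laplaceTransform h ((2 : ℝ) + t * Complex.I) * (1 / ((2 : ℝ) + t * Complex.I - 1))
        - laplaceTransform h ((2 : ℝ) + t * Complex.I) *
          LSeries (fun n => (ArithmeticFunction.vonMangoldt n : ℂ)) ((2 : ℝ) + t * Complex.I) := by
    intro t; rw [e1]; ring
  have hi2 : Integrable fun t : ℝ => laplaceTransform h ((2 : ℝ) + t * Complex.I) *
      LSeries (fun n => (ArithmeticFunction.vonMangoldt n : ℂ)) ((2 : ℝ) + t * Complex.I) := by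
    refine (hΦ.norm.mul_const (∑' n, ‖LSeries.term
      (fun n => (ArithmeticFunction.vonMangoldt n : ℂ)) (2 : ℝ) n‖)).mono' ?_
      (Eventually.of_forall fun t => ?_)
    · refine ((continuous_laplaceTransform_line hd.continuous hs 2).mul ?_).aestronglyMeasurable
      simp_rw [e1]
      refine hinv.sub (continuous_iff_continuousAt.2 fun t => ?_)
      have : ContinuousAt F ((2 : ℝ) + t * Complex.I) := (hFd _ (by simp; norm_num)).continuousAt
      exact ContinuousAt.comp (f := fun t : ℝ => ((2 : ℝ) : ℂ) + t * Complex.I) this (by fun_prop)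
    · rw [norm_mul]
      refine mul_le_mul_of_nonneg_left ?_ (norm_nonneg _)
      have hn : ∀ n, ‖LSeries.term (fun n => (ArithmeticFunction.vonMangoldt n : ℂ))
          ((2 : ℝ) + t * Complex.I) n‖ = ‖LSeries.term
            (fun n => (ArithmeticFunction.vonMangoldt n : ℂ)) (2 : ℝ) n‖ := by
        intro n
        rw [LSeries.norm_term_eq, LSeries.norm_term_eq]; simp
      have hS := (ArithmeticFunction.LSeriesSummable_vonMangoldt (s := (2 : ℝ)) (by simp)).norm
      have h4 := norm_tsum_le_tsum_norm (f := LSeries.term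
        (fun n => (ArithmeticFunction.vonMangoldt n : ℂ)) ((2 : ℝ) + t * Complex.I))
        (by simp_rw [hn]; exact hS)
      simp_rw [hn] at h4
      exact h4
  have := norm_integral_laplaceTransform_mul_line_two_le hδ hδ1 hd hs (F := F)
    (A := C) hC.le hFd H
  simp_rw [e3] at this
  rw [integral_sub hi1 hi2, norm_sub_rev] at this
  rw [← mul_sub, norm_mul, Complex.norm_real, Real.norm_of_nonneg (by positivity)]
  calc _ ≤ 1 / (2 * Real.pi) * (D * C *
        √(∫ v : ℝ, ‖deriv h v‖ ^ 2 * Real.exp ((1 + 2 * δ) * v))) := by gcongr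
    _ = _ := by ring

end

/-! ### The divisor bound and the fourth moment of Kloosterman sums -/

section

open Finset

/-- The divisor bound. -/
theorem exists_card_divisors_le_rpow {ε : ℝ} (hε : 0 < ε) :
    ∃ C : ℝ, 1 ≤ C ∧ ∀ n : ℕ, n ≠ 0 → (n.divisors.card : ℝ) ≤ C * (n : ℝ) ^ ε := by
  have hlog2 : 0 < Real.log 2 := Real.log_pos one_lt_two
  -- Primes p ≥ P satisfy p^ε ≥ 2, so v + 1 ≤ 2^v ≤ p^{vε} without loss. Each of the fewer than P
  -- smaller primes costs a factor c, chosen so that v + 1 ≤ c(1 + εv log 2) ≤ c·2^{εv}.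
  set c : ℝ := 1 + 1 / (ε * Real.log 2) with hc
  have hc1 : 1 ≤ c := by rw [hc]; have : 0 < 1 / (ε * Real.log 2) := by positivity
                         linarith
  set P : ℕ := ⌈(2 : ℝ) ^ (1 / ε)⌉₊ with hP
  have hlocal : ∀ p v : ℕ, p.Prime →
      ((v + 1 : ℕ) : ℝ) ≤ (if p < P then c else 1) * ((p : ℝ) ^ v) ^ ε := by
    intro p v hp
    have hp0 : (0 : ℝ) < p := by exact_mod_cast hp.pos
    have hpe : ((p : ℝ) ^ v) ^ ε = ((p : ℝ) ^ ε) ^ v := by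
      rw [← Real.rpow_natCast, ← Real.rpow_mul hp0.le, mul_comm, Real.rpow_mul hp0.le,
        Real.rpow_natCast]
    split_ifs with h
    · have h2 : (2 : ℝ) ^ ε ≤ (p : ℝ) ^ ε :=
        Real.rpow_le_rpow zero_le_two (by exact_mod_cast hp.two_le) hε.le
      have h3 : 1 + ε * v * Real.log 2 ≤ ((2 : ℝ) ^ ε) ^ v := by
        rw [← Real.rpow_natCast, ← Real.rpow_mul zero_le_two, Real.rpow_def_of_pos two_pos]
        have := Real.add_one_le_exp (Real.log 2 * (ε * v))
        linarith
      calc ((v + 1 : ℕ) : ℝ) ≤ c * (1 + ε * v * Real.log 2) := by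
            have e : (1 / (ε * Real.log 2)) * (ε * v * Real.log 2) = v := by field_simp
            have e0 : 0 ≤ ε * v * Real.log 2 := by positivity
            have e1 : 0 < 1 / (ε * Real.log 2) := by positivity
            rw [hc]; push_cast
            nlinarith
        _ ≤ c * ((2 : ℝ) ^ ε) ^ v := by gcongr
        _ ≤ c * ((p : ℝ) ^ ε) ^ v := by gcongr
        _ = _ := by rw [hpe]
    · push Not at h
      have h1 : (2 : ℝ) ≤ (p : ℝ) ^ ε := by
        have h2 : (2 : ℝ) ^ (1 / ε) ≤ p := (Nat.le_ceil _).trans (by exact_mod_cast h)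
        calc (2 : ℝ) = ((2 : ℝ) ^ (1 / ε)) ^ ε := by
              rw [← Real.rpow_mul zero_le_two, one_div_mul_cancel hε.ne', Real.rpow_one]
          _ ≤ _ := Real.rpow_le_rpow (by positivity) h2 hε.le
      rw [one_mul, hpe]
      calc ((v + 1 : ℕ) : ℝ) ≤ (2 : ℝ) ^ v := by exact_mod_cast Nat.lt_two_pow_self
        _ ≤ _ := by gcongr
  refine ⟨c ^ P, one_le_pow₀ hc1, fun n hn => ?_⟩
  rw [Nat.card_divisors hn]
  have hprod : (n : ℝ) ^ ε = ∏ p ∈ n.primeFactors, ((p : ℝ) ^ (n.factorization p)) ^ ε := by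
    rw [Real.finsetProd_rpow _ _ (fun i _ => by positivity)]
    congr 1
    conv_lhs => rw [← Nat.prod_factorization_pow_eq_self hn]
    simp [Finsupp.prod]
  rw [hprod]
  push_cast
  calc ∏ x ∈ n.primeFactors, ((n.factorization x : ℝ) + 1)
      ≤ ∏ p ∈ n.primeFactors, (if p < P then c else 1) * ((p : ℝ) ^ (n.factorization p)) ^ ε := by
        refine prod_le_prod (fun i _ => by positivity) fun p hp => ?_
        have := hlocal p (n.factorization p) (Nat.prime_of_mem_primeFactors hp)
        push_cast at this
        exact this
    _ = (∏ p ∈ n.primeFactors, if p < P then c else 1) *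
        ∏ p ∈ n.primeFactors, ((p : ℝ) ^ (n.factorization p)) ^ ε := prod_mul_distrib
    _ ≤ _ := by
        refine mul_le_mul_of_nonneg_right ?_ (prod_nonneg fun i _ => by positivity)
        rw [prod_ite, prod_const_one, mul_one, prod_const]
        refine pow_le_pow_right₀ hc1 ?_
        calc _ ≤ (range P).card := card_le_card fun p hp => by
              rw [mem_filter] at hp; exact mem_range.2 hp.2
          _ = P := card_range P

/-- n = ∑_{d ∣ n} φ(d), and each φ(d) is at most φ(n). -/
theorem Nat.le_card_divisors_mul_totient (n : ℕ) : n ≤ n.divisors.card * n.totient := by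
  rcases n.eq_zero_or_pos with rfl | hn
  · simp
  conv_lhs => rw [← Nat.sum_totient n]
  rw [← smul_eq_mul]
  exact sum_le_card_nsmul _ _ _ fun d hd =>
    Nat.le_of_dvd (Nat.totient_pos.2 hn) (Nat.totient_dvd_of_dvd (Nat.dvd_of_mem_divisors hd))

theorem Nat.card_range_filter_dvd {q d : ℕ} (hd : d ∣ q) (hq : 0 < q) :
    ((range q).filter (d ∣ ·)).card = q / d := by
  obtain ⟨e, rfl⟩ := hd
  have hd0 : 0 < d := Nat.pos_of_mul_pos_right hq |> fun h => Nat.pos_of_ne_zero (by rintro rfl; simp at hq)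
  rw [Nat.mul_div_cancel_left _ hd0]
  have : (range (d * e)).filter (d ∣ ·) = (range e).image (d * ·) := by
    ext x
    simp only [mem_filter, mem_range, mem_image]
    constructor
    · rintro ⟨h1, y, rfl⟩
      exact ⟨y, lt_of_mul_lt_mul_left h1 hd0.le, rfl⟩
    · rintro ⟨y, h1, rfl⟩
      exact ⟨Nat.mul_lt_mul_of_pos_left h1 hd0, dvd_mul_right _ _⟩
  rw [this, Finset.card_image_of_injective _ (fun a b h => Nat.eq_of_mul_eq_mul_left hd0 h), Finset.card_range]

/-- Bound the gcd by the sum of all common divisors and exchange sums: each d ∣ q contributes d ·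
(q/d) = q. -/
theorem Nat.sum_range_gcd_le {q : ℕ} (hq : 0 < q) :
    ∑ x ∈ range q, Nat.gcd x q ≤ q * q.divisors.card := by
  calc ∑ x ∈ range q, Nat.gcd x q ≤ ∑ x ∈ range q, ∑ d ∈ q.divisors, if d ∣ x then d else 0 := by
        refine sum_le_sum fun x _ => ?_
        have hmem : Nat.gcd x q ∈ q.divisors := Nat.mem_divisors.2 ⟨Nat.gcd_dvd_right _ _, hq.ne'⟩
        refine le_trans ?_ (single_le_sum (f := fun d => if d ∣ x then d else 0)
          (fun _ _ => Nat.zero_le _) hmem)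
        simp [Nat.gcd_dvd_left]
    _ = ∑ d ∈ q.divisors, ∑ x ∈ range q, if d ∣ x then d else 0 := sum_comm
    _ = ∑ d ∈ q.divisors, q := by
        refine sum_congr rfl fun d hd => ?_
        have hdq := Nat.dvd_of_mem_divisors hd
        rw [← sum_filter, sum_const, Nat.card_range_filter_dvd hdq hq, smul_eq_mul,
          Nat.div_mul_cancel hdq]
    _ = _ := by rw [sum_const, smul_eq_mul, mul_comm]

section ZModCounting

variable {q : ℕ} [NeZero q]

theorem ZMod.sum_eq_sum_range {M : Type*} [AddCommMonoid M] (f : ℕ → M) :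
    ∑ x : ZMod q, f x.val = ∑ x ∈ range q, f x := by
  refine sum_bij (fun x _ => x.val) (fun x _ => mem_range.2 (ZMod.val_lt x))
    (fun a _ b _ h => ZMod.val_injective q h) (fun b hb => ?_) (fun _ _ => rfl)
  exact ⟨(b : ZMod q), mem_univ _, ZMod.val_natCast_of_lt (mem_range.1 hb)⟩

/-- Such z is annihilated by both a and q, hence by their gcd g, and a cyclic group has at most g
elements annihilated by g. -/
theorem ZMod.card_filter_mul_eq_zero_le (a : ZMod q) :
    (univ.filter fun z : ZMod q => a * z = 0).card ≤ Nat.gcd a.val q := by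
  have hg : 0 < Nat.gcd a.val q := Nat.gcd_pos_of_pos_right _ (NeZero.pos q)
  refine le_trans (card_le_card fun z hz => ?_)
    (IsAddCyclic.card_nsmul_eq_zero_le (α := ZMod q) hg)
  simp only [mem_filter, mem_univ, true_and] at hz ⊢
  have h1 : a.val • z = 0 := by rw [nsmul_eq_mul, ZMod.natCast_zmod_val, hz]
  have h2 : q • z = 0 := by simp
  exact addOrderOf_dvd_iff_nsmul_eq_zero.1
    (Nat.dvd_gcd (addOrderOf_dvd_iff_nsmul_eq_zero.2 h1) (addOrderOf_dvd_iff_nsmul_eq_zero.2 h2))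

theorem ZMod.card_filter_mul_eq_le (a b : ZMod q) :
    (univ.filter fun z : ZMod q => a * z = b).card ≤ Nat.gcd a.val q := by
  rcases (univ.filter fun z : ZMod q => a * z = b).eq_empty_or_nonempty with h | ⟨z₀, hz₀⟩
  · rw [h]; simp
  · refine le_trans ?_ (ZMod.card_filter_mul_eq_zero_le a)
    simp only [mem_filter, mem_univ, true_and] at hz₀
    refine card_le_card_of_injOn (fun z => z - z₀) (fun z hz => ?_) (fun x _ y _ h => by simpa using h)
    simp only [mem_coe, mem_filter, mem_univ, true_and] at hz ⊢
    rw [mul_sub, hz, hz₀, sub_self]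

theorem ZMod.gcd_val_mul_le (x y : ZMod q) :
    Nat.gcd (x * y).val q ≤ Nat.gcd x.val q * Nat.gcd y.val q := by
  have h0 := Nat.gcd_pos_of_pos_right x.val (NeZero.pos q)
  have h1 := Nat.gcd_pos_of_pos_right y.val (NeZero.pos q)
  rw [ZMod.val_mul, (Nat.mod_modEq _ q).gcd_eq]
  exact Nat.le_of_dvd (Nat.mul_pos h0 h1) (Nat.gcd_mul_left_dvd_mul_gcd q x.val y.val)

/-- The number of triples modulo `q` with vanishing product. -/
theorem ZMod.card_filter_mul_mul_eq_zero_le :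
    (univ.filter fun z : ZMod q × ZMod q × ZMod q => z.1 * z.2.1 * z.2.2 = 0).card
      ≤ (q * q.divisors.card) ^ 2 := by
  have hs : ∑ x : ZMod q, Nat.gcd x.val q ≤ q * q.divisors.card := by
    rw [ZMod.sum_eq_sum_range (fun x => Nat.gcd x q)]
    exact Nat.sum_range_gcd_le (NeZero.pos q)
  rw [card_filter, Fintype.sum_prod_type]
  calc _ = ∑ x : ZMod q, ∑ y : ZMod q, (univ.filter fun z : ZMod q => x * y * z = 0).card := by
        refine sum_congr rfl fun x _ => ?_
        rw [Fintype.sum_prod_type]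
        simp only [card_filter]
    _ ≤ ∑ x : ZMod q, ∑ y : ZMod q, Nat.gcd x.val q * Nat.gcd y.val q :=
        sum_le_sum fun x _ => sum_le_sum fun y _ =>
          (ZMod.card_filter_mul_eq_zero_le _).trans (ZMod.gcd_val_mul_le x y)
    _ = (∑ x : ZMod q, Nat.gcd x.val q) ^ 2 := by rw [sq, sum_mul_sum]
    _ ≤ _ := Nat.pow_le_pow_left hs 2

/-- The solutions in units of `a + b = c + d`, `a⁻¹ + b⁻¹ = c⁻¹ + d⁻¹`. -/
theorem ZMod.card_unit_quadruples_le :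
    (univ.filter fun z : ((ZMod q)ˣ × (ZMod q)ˣ) × ((ZMod q)ˣ × (ZMod q)ˣ) =>
      (z.1.1 : ZMod q) + z.1.2 = z.2.1 + z.2.2 ∧
      ((z.1.1⁻¹ : (ZMod q)ˣ) : ZMod q) + ((z.1.2⁻¹ : (ZMod q)ˣ) : ZMod q) =
        ((z.2.1⁻¹ : (ZMod q)ˣ) : ZMod q) + ((z.2.2⁻¹ : (ZMod q)ˣ) : ZMod q)).card
      ≤ 2 * (q * q.divisors.card) ^ 2 := by
  set S := univ.filter fun z : ((ZMod q)ˣ × (ZMod q)ˣ) × ((ZMod q)ˣ × (ZMod q)ˣ) =>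
      (z.1.1 : ZMod q) + z.1.2 = z.2.1 + z.2.2 ∧
      ((z.1.1⁻¹ : (ZMod q)ˣ) : ZMod q) + ((z.1.2⁻¹ : (ZMod q)ˣ) : ZMod q) =
        ((z.2.1⁻¹ : (ZMod q)ˣ) : ZMod q) + ((z.2.2⁻¹ : (ZMod q)ˣ) : ZMod q) with hS
  set T := univ.filter fun z : ZMod q × ZMod q × ZMod q => z.1 * z.2.1 * z.2.2 = 0 with hT
  -- The quadruple (a,b,c,d) goes to (c−a, c−b, a+b). The two equations give (a+b)(ab−cd) = 0, and
  -- (c−a)(c−b) = ab − cd, so the three coordinates have product 0.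
  set φ : ((ZMod q)ˣ × (ZMod q)ˣ) × ((ZMod q)ˣ × (ZMod q)ˣ) → ZMod q × ZMod q × ZMod q :=
    fun z => ((z.2.1 : ZMod q) - z.1.1, (z.2.1 : ZMod q) - z.1.2, (z.1.1 : ZMod q) + z.1.2) with hφ
  have hmaps : ∀ z ∈ S, φ z ∈ T := by
    rintro ⟨⟨a, b⟩, ⟨c, d⟩⟩ hz
    simp only [hS, mem_filter, mem_univ, true_and] at hz
    simp only [hT, hφ, mem_filter, mem_univ, true_and]
    obtain ⟨h1, h2⟩ := hz
    have ha : (a : ZMod q) * ((a⁻¹ : (ZMod q)ˣ) : ZMod q) = 1 := a.mul_inv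
    have hb : (b : ZMod q) * ((b⁻¹ : (ZMod q)ˣ) : ZMod q) = 1 := b.mul_inv
    have hc : (c : ZMod q) * ((c⁻¹ : (ZMod q)ˣ) : ZMod q) = 1 := c.mul_inv
    have hd : (d : ZMod q) * ((d⁻¹ : (ZMod q)ˣ) : ZMod q) = 1 := d.mul_inv
    have h3 : ((a : ZMod q) + b) * c * d = (c + d) * a * b := by
      linear_combination ((a : ZMod q) * b * c * d) * h2 - b * c * d * ha - a * c * d * hb
        + a * b * d * hc + a * b * c * hd
    linear_combination -h3 + ((a : ZMod q) * b) * h1 - c * (a + b) * h1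
  -- The image determines 2c, hence c up to 2-torsion, which has at most two elements in a cyclic
  -- group; a, b, d then follow from c.
  have hfib : ∀ w ∈ T, (S.filter fun z => φ z = w).card ≤ 2 := by
    rintro ⟨x, y, s⟩ _
    have h2 := IsAddCyclic.card_nsmul_eq_zero_le (α := ZMod q) (n := 2) two_pos
    rcases (S.filter fun z => φ z = (x, y, s)).eq_empty_or_nonempty with h | ⟨⟨⟨a₀, b₀⟩, ⟨c₀, d₀⟩⟩, h₀⟩
    · rw [h]; simp
    have hval : ∀ z ∈ S.filter fun z => φ z = (x, y, s), (z.1.1 : ZMod q) = z.2.1 - x ∧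
        (z.1.2 : ZMod q) = z.2.1 - y ∧ (z.2.2 : ZMod q) = s - z.2.1 ∧
        (2 : ZMod q) * z.2.1 = x + y + s := by
      rintro ⟨⟨a, b⟩, ⟨c, d⟩⟩ hz
      simp only [hS, hφ, mem_filter, mem_univ, true_and, Prod.mk.injEq] at hz
      obtain ⟨⟨h1, -⟩, h3, h4, h5⟩ := hz
      refine ⟨?_, ?_, ?_, ?_⟩ <;> simp only [← h3, ← h4, ← h5]
      · ring
      · ring
      · linear_combination -h1
      · ring
    refine le_trans (card_le_card_of_injOn (fun z => (z.2.1 : ZMod q) - c₀) ?_ ?_) h2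
    · intro z hz
      have e1 := (hval z hz).2.2.2
      have e2 := (hval _ h₀).2.2.2
      simp only [coe_filter, mem_univ, true_and, Set.mem_ofPred_eq, nsmul_eq_mul, Nat.cast_ofNat]
      linear_combination e1 - e2
    · intro z hz w hw hzw
      obtain ⟨e1, e2, e3, -⟩ := hval z hz
      obtain ⟨f1, f2, f3, -⟩ := hval w hw
      have hcc : (z.2.1 : ZMod q) = w.2.1 := by simpa using hzw
      rw [hcc, ← f1] at e1
      rw [hcc, ← f2] at e2
      rw [hcc, ← f3] at e3
      exact Prod.ext (Prod.ext (Units.ext e1) (Units.ext e2))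
        (Prod.ext (Units.ext hcc) (Units.ext e3))
  calc S.card = ∑ w ∈ T, (S.filter fun z => φ z = w).card := card_eq_sum_card_fiberwise hmaps
    _ ≤ T.card • 2 := sum_le_card_nsmul _ _ _ hfib
    _ ≤ _ := by
      rw [smul_eq_mul, mul_comm]
      exact Nat.mul_le_mul_left 2 ZMod.card_filter_mul_mul_eq_zero_le

end ZModCounting

section Kloosterman

variable {q : ℕ} [NeZero q]

/-- The Kloosterman sum, as a sum over the unit group of `ZMod q`. -/
noncomputable def ZMod.kloosterman (m n : ZMod q) : ℂ :=
  ∑ u : (ZMod q)ˣ, ZMod.stdAddChar (N := q) (m * u + n * (u⁻¹ : (ZMod q)ˣ))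

theorem ZMod.kloosterman_mul_unit (m n : ZMod q) (t : (ZMod q)ˣ) :
    ZMod.kloosterman (q := q) (m * t) (n * (t⁻¹ : (ZMod q)ˣ)) = ZMod.kloosterman m n := by
  unfold ZMod.kloosterman
  refine Fintype.sum_equiv (Equiv.mulLeft t) _ _ fun u => ?_
  simp only [Equiv.coe_mulLeft, mul_inv, Units.val_mul]
  congr 1
  ring

theorem ZMod.sum_stdAddChar_mul (x : ZMod q) :
    ∑ m : ZMod q, ZMod.stdAddChar (N := q) (m * x) = if x = 0 then (q : ℂ) else 0 := by
  classical
  have := AddChar.sum_mulShift x (ZMod.isPrimitive_stdAddChar q)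
  rw [this, ZMod.card]
  split_ifs <;> simp

/-- Expand the fourth power into quadruples of units. Orthogonality in m imposes the equation
between the units, orthogonality in n the one between their inverses. -/
theorem ZMod.sum_norm_kloosterman_pow_four_eq :
    ∑ m : ZMod q, ∑ n : ZMod q, ‖ZMod.kloosterman m n‖ ^ 4 = (q : ℝ) ^ 2 *
      (univ.filter fun z : ((ZMod q)ˣ × (ZMod q)ˣ) × ((ZMod q)ˣ × (ZMod q)ˣ) =>
        (z.1.1 : ZMod q) + z.1.2 = z.2.1 + z.2.2 ∧
        ((z.1.1⁻¹ : (ZMod q)ˣ) : ZMod q) + ((z.1.2⁻¹ : (ZMod q)ˣ) : ZMod q) =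
          ((z.2.1⁻¹ : (ZMod q)ˣ) : ZMod q) + ((z.2.2⁻¹ : (ZMod q)ˣ) : ZMod q)).card := by
  have hexp : ∀ m n : ZMod q, ((‖ZMod.kloosterman m n‖ ^ 4 : ℝ) : ℂ) =
      ∑ z : ((ZMod q)ˣ × (ZMod q)ˣ) × ((ZMod q)ˣ × (ZMod q)ˣ),
        ZMod.stdAddChar (N := q) (m * ((z.1.1 : ZMod q) + z.1.2 - (z.2.1 + z.2.2))) *
        ZMod.stdAddChar (N := q) (n * (((z.1.1⁻¹ : (ZMod q)ˣ) : ZMod q) + ((z.1.2⁻¹ : (ZMod q)ˣ) : ZMod q) -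
          (((z.2.1⁻¹ : (ZMod q)ˣ) : ZMod q) + ((z.2.2⁻¹ : (ZMod q)ˣ) : ZMod q)))) := by
    intro m n
    have h1 : ((‖ZMod.kloosterman m n‖ ^ 4 : ℝ) : ℂ) =
        (ZMod.kloosterman m n * ZMod.kloosterman m n) *
          ((starRingEnd ℂ) (ZMod.kloosterman m n) * (starRingEnd ℂ) (ZMod.kloosterman m n)) := by
      have := Complex.mul_conj' (ZMod.kloosterman m n)
      push_cast
      linear_combination (-(‖ZMod.kloosterman m n‖ : ℂ) ^ 2 - ZMod.kloosterman m n *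
        (starRingEnd ℂ) (ZMod.kloosterman m n)) * this
    rw [h1]
    unfold ZMod.kloosterman
    simp only [map_sum, ← AddChar.map_neg_eq_conj]
    rw [Fintype.sum_mul_sum, Fintype.sum_mul_sum, ← Fintype.sum_prod_type',
      ← Fintype.sum_prod_type', Fintype.sum_mul_sum, ← Fintype.sum_prod_type']
    refine sum_congr rfl fun z _ => ?_
    simp only [← AddChar.map_add_eq_mul]
    congr 1
    ring
  have hC : ((∑ m : ZMod q, ∑ n : ZMod q, ‖ZMod.kloosterman m n‖ ^ 4 : ℝ) : ℂ) =
      ∑ z : ((ZMod q)ˣ × (ZMod q)ˣ) × ((ZMod q)ˣ × (ZMod q)ˣ),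
        if (z.1.1 : ZMod q) + z.1.2 = z.2.1 + z.2.2 ∧
        ((z.1.1⁻¹ : (ZMod q)ˣ) : ZMod q) + ((z.1.2⁻¹ : (ZMod q)ˣ) : ZMod q) =
          ((z.2.1⁻¹ : (ZMod q)ˣ) : ZMod q) + ((z.2.2⁻¹ : (ZMod q)ˣ) : ZMod q) then (q : ℂ) ^ 2 else 0 := by
    push_cast
    simp only [← Complex.ofReal_pow, hexp]
    simp_rw [sum_comm (s := (univ : Finset (ZMod q)))
      (t := (univ : Finset (((ZMod q)ˣ × (ZMod q)ˣ) × ((ZMod q)ˣ × (ZMod q)ˣ))))]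
    refine sum_congr rfl fun z _ => ?_
    simp_rw [← mul_sum, ZMod.sum_stdAddChar_mul, ← sum_mul, ZMod.sum_stdAddChar_mul, sub_eq_zero]
    split_ifs <;> simp_all [sq]
  rw [← sum_filter, sum_const, nsmul_eq_mul] at hC
  have : ((q : ℝ) ^ 2 : ℂ) = ((q : ℂ)) ^ 2 := by simp
  rw [mul_comm]
  exact_mod_cast hC

theorem ZMod.sum_norm_kloosterman_pow_four_le :
    ∑ m : ZMod q, ∑ n : ZMod q, ‖ZMod.kloosterman m n‖ ^ 4 ≤
      2 * (q : ℝ) ^ 4 * (q.divisors.card : ℝ) ^ 2 := by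
  rw [ZMod.sum_norm_kloosterman_pow_four_eq]
  have h := ZMod.card_unit_quadruples_le (q := q)
  calc _ ≤ (q : ℝ) ^ 2 * ((2 * (q * q.divisors.card) ^ 2 : ℕ) : ℝ) := by
        gcongr
    _ = _ := by push_cast; ring

/-- The fourth moment of Kloosterman sums in one variable. -/
theorem ZMod.sum_norm_kloosterman_pow_four_le_gcd (m : ZMod q) :
    ∑ n : ZMod q, ‖ZMod.kloosterman m n‖ ^ 4 ≤
      2 * (Nat.gcd m.val q : ℝ) * (q : ℝ) ^ 3 * (q.divisors.card : ℝ) ^ 3 := by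
  set B : ZMod q → ℝ := fun w => ∑ n : ZMod q, ‖ZMod.kloosterman w n‖ ^ 4 with hB
  have hB0 : ∀ w, 0 ≤ B w := fun w => sum_nonneg fun _ _ => by positivity
  -- The moment at m is unchanged when m is multiplied by a unit t. Averaging over t, extending the
  -- sum to all residues and noting that t ↦ mt has fibres of size at most gcd(m,q) reduces to the
  -- double moment; the loss q/φ(q) is at most τ(q).
  have hshift : ∀ t : (ZMod q)ˣ, B (m * t) = B m := by
    intro t
    refine (Fintype.sum_equiv (Units.mulRight t⁻¹) _ _ fun n => ?_).symm
    rw [← ZMod.kloosterman_mul_unit m n t]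
    rfl
  have h1 : (q.totient : ℝ) * B m = ∑ t : (ZMod q)ˣ, B (m * t) := by
    simp_rw [hshift]
    rw [sum_const, card_univ, ZMod.card_units_eq_totient, nsmul_eq_mul]
  have h2 : ∑ t : (ZMod q)ˣ, B (m * t) ≤ ∑ t : ZMod q, B (m * t) := by
    have : ∑ t : (ZMod q)ˣ, B (m * t) = ∑ t ∈ (univ : Finset (ZMod q)ˣ).map
        ⟨(Units.val : (ZMod q)ˣ → ZMod q), Units.val_injective⟩, B (m * t) := by rw [sum_map]; rfl
    rw [this]
    exact sum_le_sum_of_subset_of_nonneg (subset_univ _) fun _ _ _ => hB0 _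
  have h3 : ∑ t : ZMod q, B (m * t) ≤ (Nat.gcd m.val q : ℝ) * ∑ w : ZMod q, B w := by
    rw [← sum_fiberwise univ (fun t : ZMod q => m * t), mul_sum]
    refine sum_le_sum fun w _ => ?_
    rw [sum_congr rfl (g := fun _ => B w) (fun t ht => by rw [(mem_filter.1 ht).2]), sum_const,
      nsmul_eq_mul]
    gcongr
    exact ZMod.card_filter_mul_eq_le m w
  have h4 : (q.totient : ℝ) * B m ≤ (Nat.gcd m.val q : ℝ) *
      (2 * (q : ℝ) ^ 4 * (q.divisors.card : ℝ) ^ 2) := by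
    rw [h1]
    refine (h2.trans h3).trans ?_
    gcongr
    exact ZMod.sum_norm_kloosterman_pow_four_le
  have h5 : (q : ℝ) ≤ q.divisors.card * q.totient := by
    exact_mod_cast Nat.le_card_divisors_mul_totient q
  have hq : (0 : ℝ) < q := by exact_mod_cast NeZero.pos q
  refine le_of_mul_le_mul_left ?_ hq
  calc (q : ℝ) * B m ≤ (q.divisors.card * q.totient) * B m := by gcongr
    _ = q.divisors.card * (q.totient * B m) := by ring
    _ ≤ q.divisors.card * ((Nat.gcd m.val q : ℝ) *
      (2 * (q : ℝ) ^ 4 * (q.divisors.card : ℝ) ^ 2)) := by gcongr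
    _ = _ := by ring

end Kloosterman

end

/-! ### Ramanujan sums and the Chinese remainder theorem -/

section

open Finset

theorem sum_reducedResidues {q : ℕ} [NeZero q] (g : ZMod q → ℂ) :
    ∑ a ∈ reducedResidues q, g (a : ZMod q) = ∑ u : (ZMod q)ˣ, g u := by
  refine (sum_bij (fun (u : (ZMod q)ˣ) _ => (u : ZMod q).val) ?_ ?_ ?_ ?_).symm
  · intro u _
    simp only [reducedResidues, mem_filter, mem_range]
    exact ⟨ZMod.val_lt _, ZMod.val_coe_unit_coprime u⟩
  · intro u _ v _ h
    exact Units.ext (ZMod.val_injective q h)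
  · intro a ha
    simp only [reducedResidues, mem_filter, mem_range] at ha
    exact ⟨ZMod.unitOfCoprime a ha.2, mem_univ _, by simp [ZMod.val_natCast_of_lt ha.1]⟩
  · intro u _
    simp

theorem eAdd_intCast_div {q : ℕ} [NeZero q] (j : ℤ) :
    eAdd ((j : ℝ) / q) = ZMod.stdAddChar (N := q) (j : ZMod q) := by
  rw [ZMod.stdAddChar_coe, eAdd]
  congr 1
  push_cast
  ring

section Ramanujan

variable {q : ℕ} [NeZero q]

/-- The Ramanujan sum, as a sum over the unit group of `ZMod q`. -/
noncomputable def ZMod.ramanujan (n : ZMod q) : ℂ := ∑ u : (ZMod q)ˣ, ZMod.stdAddChar (N := q) (u * n)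

theorem ramanujanSum_eq (n : ℤ) : ramanujanSum n q = ZMod.ramanujan (n : ZMod q) := by
  rw [ramanujanSum, ZMod.ramanujan,
    ← sum_reducedResidues (fun a : ZMod q => ZMod.stdAddChar (N := q) (a * n))]
  refine sum_congr rfl fun a _ => ?_
  have := eAdd_intCast_div (q := q) (a * n)
  push_cast at this
  exact this

theorem psiSum_eq (n₁ n₂ : ℤ) : psiSum n₁ n₂ q =
    ∑ u : (ZMod q)ˣ, ZMod.ramanujan (q := q) ((u : ZMod q) + n₁) * ZMod.ramanujan (q := q) ((u : ZMod q) + n₂) := by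
  rw [psiSum, ← sum_reducedResidues
    (fun a : ZMod q => ZMod.ramanujan (q := q) (a + n₁) * ZMod.ramanujan (q := q) (a + n₂))]
  refine sum_congr rfl fun a _ => ?_
  rw [ramanujanSum_eq, ramanujanSum_eq]
  push_cast
  rfl

theorem kloostermanSum_eq (m n : ℤ) : kloostermanSum m n q = ZMod.kloosterman (m : ZMod q) n := by
  have h1 : ZMod.kloosterman (m : ZMod q) n =
      ∑ u : (ZMod q)ˣ, (fun a : ZMod q => ZMod.stdAddChar (N := q) (m * a + n * a⁻¹)) u := by
    refine sum_congr rfl fun u _ => ?_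
    simp only [ZMod.inv_coe_unit]
  rw [h1, ← sum_reducedResidues (fun a : ZMod q => ZMod.stdAddChar (N := q) (m * a + n * a⁻¹))]
  refine sum_congr rfl fun a _ => ?_
  have := eAdd_intCast_div (q := q) (m * a + n * ((a : ZMod q)⁻¹).val)
  push_cast at this
  rw [this]
  simp

theorem ZMod.ramanujan_unit_mul (t : (ZMod q)ˣ) (n : ZMod q) :
    ZMod.ramanujan (q := q) (t * n) = ZMod.ramanujan n := by
  refine Fintype.sum_equiv (Equiv.mulRight t) _ _ fun u => ?_
  simp [mul_assoc]

/-- e(dz/(de)) = e(z/e). -/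
theorem ZMod.stdAddChar_mul_eq_castHom {d e : ℕ} [NeZero d] [NeZero e] (hq : q = d * e)
    (z : ZMod q) : ZMod.stdAddChar (N := q) ((d : ZMod q) * z)
      = ZMod.stdAddChar (N := e) (ZMod.castHom (hq ▸ Dvd.intro_left d rfl : e ∣ q) (ZMod e) z) := by
  obtain ⟨k, rfl⟩ := ZMod.intCast_surjective z
  rw [map_intCast, ZMod.stdAddChar_coe]
  have : ((d : ZMod q) * (k : ZMod q)) = ((d * k : ℤ) : ZMod q) := by push_cast; rfl
  rw [this, ZMod.stdAddChar_coe]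
  congr 1
  have hd : (d : ℂ) ≠ 0 := by exact_mod_cast NeZero.ne d
  have he : (e : ℂ) ≠ 0 := by exact_mod_cast NeZero.ne e
  rw [hq]
  push_cast
  field_simp

/-- Ramanujan sums vanish at arguments prime to a prime dividing the modulus twice. -/
theorem ZMod.ramanujan_natCast_eq_zero {ℓ n : ℕ} (hℓ : ℓ ^ 2 ∣ q) (hn : ¬ ℓ ∣ n) :
    ZMod.ramanujan (n : ZMod q) = 0 := by
  obtain ⟨c, hc⟩ := hℓ
  have hℓ0 : ℓ ≠ 0 := by rintro rfl; exact NeZero.ne q (by simpa using hc)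
  have : NeZero ℓ := ⟨hℓ0⟩
  have hc0 : c ≠ 0 := by rintro rfl; exact NeZero.ne q (by simpa using hc)
  have : NeZero (ℓ * c) := ⟨mul_ne_zero hℓ0 hc0⟩
  -- With q = ℓ²c the element t = ℓc squares to 0, so u ↦ u + t permutes the units. It multiplies
  -- the Ramanujan sum by e(tn/q) = e(n/ℓ) ≠ 1.
  set t : ZMod q := ((ℓ * c : ℕ) : ZMod q) with ht
  have ht2 : t * t = 0 := by
    rw [ht, ← Nat.cast_mul, ZMod.natCast_eq_zero_iff, hc]
    exact ⟨c, by ring⟩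
  have hunit : ∀ u : (ZMod q)ˣ, ∀ s : ZMod q, s * s = 0 → IsUnit ((u : ZMod q) + s) := by
    intro u s hs
    refine IsUnit.of_mul_eq_one (u⁻¹ * (1 - u⁻¹ * s)) ?_
    have h1 : (u : ZMod q) * ((u⁻¹ : (ZMod q)ˣ) : ZMod q) = 1 := u.mul_inv
    linear_combination (1 - s * ((u⁻¹ : (ZMod q)ˣ) : ZMod q) + s * ((u⁻¹ : (ZMod q)ˣ) : ZMod q)) * h1
      - (((u⁻¹ : (ZMod q)ˣ) : ZMod q)) ^ 2 * hs
      - (((u⁻¹ : (ZMod q)ˣ) : ZMod q)) * s * h1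
  let E : (ZMod q)ˣ ≃ (ZMod q)ˣ :=
    { toFun := fun u => (hunit u t ht2).unit
      invFun := fun u => (hunit u (-t) (by rw [neg_mul_neg, ht2])).unit
      left_inv := fun u => Units.ext (by simp)
      right_inv := fun u => Units.ext (by simp) }
  have h1 : ZMod.ramanujan (n : ZMod q) =
      ZMod.stdAddChar (N := q) (t * n) * ZMod.ramanujan (n : ZMod q) := by
    conv_lhs => rw [ZMod.ramanujan, ← Equiv.sum_comp E]
    rw [ZMod.ramanujan, mul_sum]
    refine sum_congr rfl fun u _ => ?_
    rw [← AddChar.map_add_eq_mul]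
    congr 1
    simp only [E, Equiv.coe_fn_mk, IsUnit.unit_spec]
    ring
  have h2 : ZMod.stdAddChar (N := q) (t * n) ≠ 1 := by
    rw [ht, ZMod.stdAddChar_mul_eq_castHom (e := ℓ) (by rw [hc]; ring), map_natCast]
    intro h
    have := ZMod.injective_stdAddChar (h.trans (AddChar.map_zero_eq_one _).symm)
    exact hn ((ZMod.natCast_eq_zero_iff _ _).1 this)
  have h3 : (1 - ZMod.stdAddChar (N := q) (t * n)) * ZMod.ramanujan (n : ZMod q) = 0 := by
    linear_combination h1
  exact (mul_eq_zero.1 h3).resolve_left (sub_ne_zero.2 (Ne.symm h2))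

end Ramanujan

section CRT

variable {a b : ℕ} [NeZero a] [NeZero b]

/-- Summation over units by the Chinese remainder theorem. -/
theorem ZMod.sum_units_mul {M : Type*} [AddCommMonoid M] (h : a.Coprime b) (g : ZMod (a * b) → M) :
    ∑ u : (ZMod (a * b))ˣ, g u = ∑ x : (ZMod a)ˣ, ∑ y : (ZMod b)ˣ,
      g ((b : ZMod (a * b)) * ((x : ZMod a).val : ZMod (a * b)) +
        (a : ZMod (a * b)) * ((y : ZMod b).val : ZMod (a * b))) := by
  have : NeZero (a * b) := ⟨mul_ne_zero (NeZero.ne a) (NeZero.ne b)⟩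
  set c := ZMod.chineseRemainder h with hc
  let E : (ZMod (a * b))ˣ ≃ (ZMod a)ˣ × (ZMod b)ˣ :=
    ((Units.mapEquiv c.toMulEquiv).trans MulEquiv.prodUnits).toEquiv
  -- The residue bx + ay is bx modulo a and ay modulo b, so the coordinates must be twisted by the
  -- units b and a.
  let S : (ZMod a)ˣ × (ZMod b)ˣ ≃ (ZMod a)ˣ × (ZMod b)ˣ :=
    Equiv.prodCongr (Equiv.mulLeft (ZMod.unitOfCoprime b h.symm))
      (Equiv.mulLeft (ZMod.unitOfCoprime a h))
  rw [← Fintype.sum_prod_type', ← Equiv.sum_comp (S.trans E.symm)]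
  refine sum_congr rfl fun z _ => ?_
  congr 1
  apply c.injective
  have h1 : c (((S.trans E.symm) z : (ZMod (a * b))ˣ) : ZMod (a * b)) =
      (((S z).1 : ZMod a), ((S z).2 : ZMod b)) := by
    have h2 : E ((S.trans E.symm) z) = S z := by simp
    rw [← h2]
    rfl
  rw [h1]
  rw [map_add, map_mul, map_mul, map_natCast, map_natCast, map_natCast, map_natCast]
  ext <;> simp [S]

theorem ZMod.stdAddChar_mul_add_mul (x y : ℕ) :
    ZMod.stdAddChar (N := a * b) ((b : ZMod (a * b)) * x + (a : ZMod (a * b)) * y) =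
      ZMod.stdAddChar (N := a) (x : ZMod a) * ZMod.stdAddChar (N := b) (y : ZMod b) := by
  rw [AddChar.map_add_eq_mul, ZMod.stdAddChar_mul_eq_castHom (d := b) (e := a) (mul_comm a b),
    ZMod.stdAddChar_mul_eq_castHom (d := a) (e := b) rfl]
  simp only [map_natCast]

theorem ZMod.ramanujan_mul (h : a.Coprime b) (n : ℕ) :
    ZMod.ramanujan (n : ZMod (a * b)) =
      ZMod.ramanujan (n : ZMod a) * ZMod.ramanujan (n : ZMod b) := by
  unfold ZMod.ramanujan
  rw [ZMod.sum_units_mul h (fun u => ZMod.stdAddChar (N := a * b) (u * n)), sum_mul_sum]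
  refine sum_congr rfl fun x _ => sum_congr rfl fun y _ => ?_
  have := ZMod.stdAddChar_mul_add_mul (a := a) (b := b) ((x : ZMod a).val * n) ((y : ZMod b).val * n)
  push_cast at this
  simp only [ZMod.natCast_zmod_val] at this
  rw [← this]
  congr 1
  ring

/-- Reduction of a twisted sum over units modulo `a * b` to one modulo `b`. -/
theorem ZMod.sum_units_mul_stdAddChar (h : a.Coprime b) (m : ℤ) (H : ZMod b → ℂ) :
    ∑ x : (ZMod (a * b))ˣ, ZMod.stdAddChar (N := a * b) (m * x) *
        H (ZMod.castHom (Dvd.intro_left a rfl) (ZMod b) (x : ZMod (a * b))) =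
      ZMod.ramanujan (m : ZMod a) *
        ∑ y : (ZMod b)ˣ, ZMod.stdAddChar (N := b) (m * y) * H (a * y) := by
  rw [ZMod.sum_units_mul h (fun x => ZMod.stdAddChar (N := a * b) (m * x) *
        H (ZMod.castHom (Dvd.intro_left a rfl) (ZMod b) x)), ZMod.ramanujan, sum_mul_sum]
  refine sum_congr rfl fun x _ => sum_congr rfl fun y _ => ?_
  have e1 : (m : ZMod (a * b)) * ((b : ZMod (a * b)) * ((x : ZMod a).val : ZMod (a * b)) +
        (a : ZMod (a * b)) * ((y : ZMod b).val : ZMod (a * b))) =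
      (b : ZMod (a * b)) * (m * ((x : ZMod a).val : ZMod (a * b))) +
        (a : ZMod (a * b)) * (m * ((y : ZMod b).val : ZMod (a * b))) := by ring
  rw [e1, AddChar.map_add_eq_mul, ZMod.stdAddChar_mul_eq_castHom (d := b) (e := a) (mul_comm a b),
    ZMod.stdAddChar_mul_eq_castHom (d := a) (e := b) rfl]
  simp only [map_natCast, map_add, map_mul, map_intCast, ZMod.natCast_zmod_val, CharP.cast_eq_zero,
    zero_mul, zero_add]
  rw [mul_comm (m : ZMod a)]
  ring

end CRT

/-- Both sides are multiplicative. At a prime the full character sum 0 loses its term 1 at zero; at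
higher prime powers `ZMod.ramanujan_natCast_eq_zero` applies. -/
theorem ZMod.ramanujan_one (n : ℕ) [NeZero n] :
    ZMod.ramanujan (1 : ZMod n) = (ArithmeticFunction.moebius n : ℂ) := by
  have key : ∀ n : ℕ, ∀ _ : NeZero n,
      ZMod.ramanujan (1 : ZMod n) = (ArithmeticFunction.moebius n : ℂ) := by
    intro n
    induction n using Nat.recOnPosPrimePosCoprime with
    | zero => intro h; exact absurd rfl h.out
    | one => intro _; simp [ZMod.ramanujan, Subsingleton.elim _ (0 : ZMod 1)]
    | prime_pow p k hp hk =>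
      intro _
      rcases Nat.lt_or_ge k 2 with h2 | h2
      · obtain rfl : k = 1 := by omega
        have : Fact p.Prime := ⟨hp⟩
        have hq : ∀ q : ℕ, ∀ _ : NeZero q, q = p → ZMod.ramanujan (1 : ZMod q) = -1 := by
          rintro q _ rfl
          have h0 := ZMod.sum_stdAddChar_mul (q := q) 1
          rw [if_neg one_ne_zero] at h0
          simp only [mul_one] at h0
          have h3 : ZMod.ramanujan (1 : ZMod q) = ∑ x ∈ univ.erase (0 : ZMod q),
              ZMod.stdAddChar (N := q) x := by
            rw [ZMod.ramanujan]
            simp only [mul_one]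
            refine sum_bij (fun u _ => (u : ZMod q)) (fun u _ => by simp)
              (fun _ _ _ _ h => Units.ext h) (fun x hx => ?_) (fun _ _ => rfl)
            exact ⟨Units.mk0 x (ne_of_mem_erase hx), mem_univ _, rfl⟩
          rw [h3, sum_erase_eq_sub (mem_univ _), h0]
          simp
        rw [hq _ _ (pow_one p), pow_one, ArithmeticFunction.moebius_apply_prime hp]
        simp
      · have h3 : ArithmeticFunction.moebius (p ^ k) = 0 :=
          ArithmeticFunction.moebius_eq_zero_of_not_squarefree fun h => by
            have := (Nat.squarefree_pow_iff hp.ne_one hk.ne').1 h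
            omega
        have := ZMod.ramanujan_natCast_eq_zero (q := p ^ k) (ℓ := p) (n := 1) (pow_dvd_pow p h2)
          (by simpa using hp.ne_one)
        rw [h3]
        simpa using this
    | coprime a b ha hb hab iha ihb =>
      intro _
      have : NeZero a := ⟨by omega⟩
      have : NeZero b := ⟨by omega⟩
      have h1 := ZMod.ramanujan_mul hab 1
      simp only [Nat.cast_one] at h1
      rw [ArithmeticFunction.isMultiplicative_moebius.map_mul_of_coprime hab, Int.cast_mul,
        ← iha inferInstance, ← ihb inferInstance]
      exact h1
  exact key n inferInstance

end

/-! ### The mean of a product of two Kloosterman sums -/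

section

open Finset

theorem ZMod.ramanujan_natCast_of_coprime {n q : ℕ} [NeZero q] (h : n.Coprime q) :
    ZMod.ramanujan (n : ZMod q) = (ArithmeticFunction.moebius q : ℂ) := by
  have := ZMod.ramanujan_unit_mul (ZMod.unitOfCoprime n h) 1
  rw [ZMod.ramanujan_one, mul_one, ZMod.coe_unitOfCoprime] at this
  exact this

/-- Opening both Ramanujan sums and summing over u first leaves a Ramanujan sum at a + b, the shape
in which the mean of the Kloosterman product arises. -/
theorem psiSum_eq_sum_sum {q : ℕ} [NeZero q] (n₁ n₂ : ℤ) : psiSum n₁ n₂ q =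
    ∑ a : (ZMod q)ˣ, ∑ b : (ZMod q)ˣ, ZMod.stdAddChar (N := q) (n₁ * a) *
      (ZMod.stdAddChar (N := q) (n₂ * b) * ZMod.ramanujan ((a : ZMod q) + (b : ZMod q))) := by
  rw [psiSum_eq]
  simp only [ZMod.ramanujan, sum_mul_sum]
  simp only [mul_sum]
  rw [sum_comm]
  refine sum_congr rfl fun a _ => ?_
  rw [sum_comm]
  refine sum_congr rfl fun b _ => sum_congr rfl fun u _ => ?_
  simp only [← AddChar.map_add_eq_mul]
  congr 1
  ring

/-- Put x = d₂²a and y = d₁²b: the argument becomes d₁²d₂²(a+b), and the unit d₁²d₂² may be dropped.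
-/
theorem sum_sum_ramanujan_sq_mul {q d₁ d₂ : ℕ} [NeZero q] (h₁ : d₁.Coprime q) (h₂ : d₂.Coprime q)
    (m₁ m₂ : ℤ) :
    ∑ x : (ZMod q)ˣ, ∑ y : (ZMod q)ˣ, ZMod.stdAddChar (N := q) (m₁ * x) *
      (ZMod.stdAddChar (N := q) (m₂ * y) *
        ZMod.ramanujan (q := q) (d₁ * (d₁ * (x : ZMod q)) + d₂ * (d₂ * (y : ZMod q)))) =
      psiSum (m₁ * d₂ ^ 2) (m₂ * d₁ ^ 2) q := by
  rw [psiSum_eq_sum_sum]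
  set u₁ := ZMod.unitOfCoprime d₁ h₁ with hu₁
  set u₂ := ZMod.unitOfCoprime d₂ h₂ with hu₂
  have e₁ : (u₁ : ZMod q) = d₁ := rfl
  have e₂ : (u₂ : ZMod q) = d₂ := rfl
  refine (Fintype.sum_equiv (Equiv.mulLeft (u₂ ^ 2)) _ _ fun a => ?_).symm
  refine Fintype.sum_equiv (Equiv.mulLeft (u₁ ^ 2)) _ _ fun b => ?_
  simp only [Equiv.coe_mulLeft, Units.val_mul, Units.val_pow_eq_pow_val, e₁, e₂]
  have f₁ : ((m₁ * (d₂ : ℤ) ^ 2 : ℤ) : ZMod q) * a = m₁ * ((d₂ : ZMod q) ^ 2 * a) := by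
    push_cast; ring
  have f₂ : ((m₂ * (d₁ : ℤ) ^ 2 : ℤ) : ZMod q) * b = m₂ * ((d₁ : ZMod q) ^ 2 * b) := by
    push_cast; ring
  have f₃ : (d₁ : ZMod q) * (d₁ * ((d₂ : ZMod q) ^ 2 * a)) + d₂ * (d₂ * ((d₁ : ZMod q) ^ 2 * b)) =
      ((u₁ ^ 2 * u₂ ^ 2 : (ZMod q)ˣ) : ZMod q) * (a + b) := by
    simp only [Units.val_mul, Units.val_pow_eq_pow_val, e₁, e₂]
    ring
  rw [f₁, f₂, f₃, ZMod.ramanujan_unit_mul]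

theorem ZMod.coprime_val_units_inv {d₁ Q : ℕ} (x : (ZMod (d₁ * Q))ˣ) :
    (((x⁻¹ : (ZMod (d₁ * Q))ˣ) : ZMod (d₁ * Q)).val).Coprime d₁ :=
  (ZMod.val_coe_unit_coprime x⁻¹).coprime_dvd_right (dvd_mul_right _ _)

section MainTerm

variable {d₁ d₂ Q : ℕ} [NeZero d₁] [NeZero d₂] [NeZero Q]

/-- Over the common denominator, ax̄/(d₁Q) + aȳ/(d₂Q) = a(d₂x̄ + d₁ȳ)/(d₁d₂Q), so the sum over a is
a Ramanujan sum. -/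
theorem sum_kloosterman_mul_kloosterman_eq (m₁ m₂ : ℤ)
    (h₁ : d₁ * Q ∣ d₁ * d₂ * Q) (h₂ : d₂ * Q ∣ d₁ * d₂ * Q) :
    ∑ a : (ZMod (d₁ * d₂ * Q))ˣ,
        ZMod.kloosterman (q := d₁ * Q) m₁ (ZMod.castHom h₁ (ZMod (d₁ * Q)) a) *
        ZMod.kloosterman (q := d₂ * Q) m₂ (ZMod.castHom h₂ (ZMod (d₂ * Q)) a) =
      ∑ x : (ZMod (d₁ * Q))ˣ, ∑ y : (ZMod (d₂ * Q))ˣ,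
        ZMod.stdAddChar (N := d₁ * Q) (m₁ * x) * (ZMod.stdAddChar (N := d₂ * Q) (m₂ * y) *
        ZMod.ramanujan (((d₂ * ((x⁻¹ : (ZMod (d₁ * Q))ˣ) : ZMod (d₁ * Q)).val +
          d₁ * ((y⁻¹ : (ZMod (d₂ * Q))ˣ) : ZMod (d₂ * Q)).val : ℕ) : ZMod (d₁ * d₂ * Q)))) := by
  simp only [ZMod.kloosterman, ZMod.ramanujan, sum_mul_sum]
  simp only [mul_sum]
  rw [sum_comm]
  refine sum_congr rfl fun x _ => ?_
  rw [sum_comm]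
  refine sum_congr rfl fun y _ => sum_congr rfl fun a _ => ?_
  have ex := ZMod.stdAddChar_mul_eq_castHom (q := d₁ * d₂ * Q) (d := d₂) (e := d₁ * Q) (by ring)
    ((a : ZMod (d₁ * d₂ * Q)) * (((x⁻¹ : (ZMod (d₁ * Q))ˣ) : ZMod (d₁ * Q)).val : ZMod (d₁ * d₂ * Q)))
  have ey := ZMod.stdAddChar_mul_eq_castHom (q := d₁ * d₂ * Q) (d := d₁) (e := d₂ * Q) (by ring)
    ((a : ZMod (d₁ * d₂ * Q)) * (((y⁻¹ : (ZMod (d₂ * Q))ˣ) : ZMod (d₂ * Q)).val : ZMod (d₁ * d₂ * Q)))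
  simp only [map_mul, map_natCast, ZMod.natCast_zmod_val] at ex ey
  rw [AddChar.map_add_eq_mul, AddChar.map_add_eq_mul, ← ex, ← ey]
  have e : (a : ZMod (d₁ * d₂ * Q)) * (((d₂ * ((x⁻¹ : (ZMod (d₁ * Q))ˣ) : ZMod (d₁ * Q)).val +
      d₁ * ((y⁻¹ : (ZMod (d₂ * Q))ˣ) : ZMod (d₂ * Q)).val : ℕ) : ZMod (d₁ * d₂ * Q))) =
      d₂ * ((a : ZMod (d₁ * d₂ * Q)) *
        (((x⁻¹ : (ZMod (d₁ * Q))ˣ) : ZMod (d₁ * Q)).val : ZMod (d₁ * d₂ * Q))) +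
      d₁ * ((a : ZMod (d₁ * d₂ * Q)) *
        (((y⁻¹ : (ZMod (d₂ * Q))ˣ) : ZMod (d₂ * Q)).val : ZMod (d₁ * d₂ * Q))) := by
    push_cast; ring
  rw [e, AddChar.map_add_eq_mul]
  ring

/-- The Ramanujan sum at d₂x̄ + d₁ȳ factors over d₁, d₂ and Q. The argument is prime to d₁ and to
d₂, which gives μ(d₁)μ(d₂). The factor modulo Q sees only x and y modulo Q, so the remaining sums
over their components modulo d₁ and d₂ are R(m₁,d₁) and R(m₂,d₂). -/
theorem sum_kloosterman_mul_kloosterman_of_coprime (hd : d₁.Coprime d₂)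
    (hQ : (d₁ * d₂).Coprime Q) (m₁ m₂ : ℤ)
    (h₁ : d₁ * Q ∣ d₁ * d₂ * Q) (h₂ : d₂ * Q ∣ d₁ * d₂ * Q) :
    ∑ a : (ZMod (d₁ * d₂ * Q))ˣ,
        ZMod.kloosterman (q := d₁ * Q) m₁ (ZMod.castHom h₁ (ZMod (d₁ * Q)) a) *
        ZMod.kloosterman (q := d₂ * Q) m₂ (ZMod.castHom h₂ (ZMod (d₂ * Q)) a) =
      psiSum (m₁ * d₂ ^ 2) (m₂ * d₁ ^ 2) Q * ramanujanSum m₁ d₁ * ramanujanSum m₂ d₂ *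
        (ArithmeticFunction.moebius (d₁ * d₂) : ℂ) := by
  rw [sum_kloosterman_mul_kloosterman_eq]
  have hQ₁ : d₁.Coprime Q := hQ.coprime_dvd_left (dvd_mul_right _ _)
  have hQ₂ : d₂.Coprime Q := hQ.coprime_dvd_left (dvd_mul_left _ _)
  set c₁ := ZMod.castHom (Dvd.intro_left d₁ rfl : Q ∣ d₁ * Q) (ZMod Q) with hc₁
  set c₂ := ZMod.castHom (Dvd.intro_left d₂ rfl : Q ∣ d₂ * Q) (ZMod Q) with hc₂
  have hram : ∀ (x : (ZMod (d₁ * Q))ˣ) (y : (ZMod (d₂ * Q))ˣ),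
      ZMod.ramanujan (((d₂ * ((x⁻¹ : (ZMod (d₁ * Q))ˣ) : ZMod (d₁ * Q)).val +
          d₁ * ((y⁻¹ : (ZMod (d₂ * Q))ˣ) : ZMod (d₂ * Q)).val : ℕ) : ZMod (d₁ * d₂ * Q))) =
        (ArithmeticFunction.moebius (d₁ * d₂) : ℂ) *
          ZMod.ramanujan (q := Q) (d₁ * c₁ (x : ZMod (d₁ * Q)) + d₂ * c₂ (y : ZMod (d₂ * Q))) := by
    intro x y
    rw [ZMod.ramanujan_mul hQ, ZMod.ramanujan_mul hd]
    have hx : (d₂ * ((x⁻¹ : (ZMod (d₁ * Q))ˣ) : ZMod (d₁ * Q)).val +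
          d₁ * ((y⁻¹ : (ZMod (d₂ * Q))ˣ) : ZMod (d₂ * Q)).val).Coprime d₁ := by
      rw [Nat.coprime_add_mul_left_left]
      exact hd.symm.mul_left (ZMod.coprime_val_units_inv x)
    have hy : (d₂ * ((x⁻¹ : (ZMod (d₁ * Q))ˣ) : ZMod (d₁ * Q)).val +
          d₁ * ((y⁻¹ : (ZMod (d₂ * Q))ˣ) : ZMod (d₂ * Q)).val).Coprime d₂ := by
      rw [add_comm, Nat.coprime_add_mul_left_left]
      exact hd.mul_left (ZMod.coprime_val_units_inv y)
    rw [ZMod.ramanujan_natCast_of_coprime hx, ZMod.ramanujan_natCast_of_coprime hy,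
      ArithmeticFunction.isMultiplicative_moebius.map_mul_of_coprime hd]
    push_cast
    congr 1
    set ξ := Units.map c₁.toMonoidHom x with hξ
    set η := Units.map c₂.toMonoidHom y with hη
    have ex : (((x⁻¹ : (ZMod (d₁ * Q))ˣ) : ZMod (d₁ * Q)).val : ZMod Q) = ((ξ⁻¹ : (ZMod Q)ˣ) : ZMod Q) := by
      rw [hξ, ← map_inv, Units.coe_map]
      have := map_natCast c₁ ((x⁻¹ : (ZMod (d₁ * Q))ˣ) : ZMod (d₁ * Q)).val
      rw [ZMod.natCast_zmod_val] at this
      exact this.symm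
    have ey : (((y⁻¹ : (ZMod (d₂ * Q))ˣ) : ZMod (d₂ * Q)).val : ZMod Q) = ((η⁻¹ : (ZMod Q)ˣ) : ZMod Q) := by
      rw [hη, ← map_inv, Units.coe_map]
      have := map_natCast c₂ ((y⁻¹ : (ZMod (d₂ * Q))ˣ) : ZMod (d₂ * Q)).val
      rw [ZMod.natCast_zmod_val] at this
      exact this.symm
    have ex' : c₁ (x : ZMod (d₁ * Q)) = (ξ : ZMod Q) := rfl
    have ey' : c₂ (y : ZMod (d₂ * Q)) = (η : ZMod Q) := rfl
    -- Scaling by the unit ξη turns d₂ξ⁻¹ + d₁η⁻¹ into d₁ξ + d₂η.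
    rw [ex, ey, ex', ey', ← ZMod.ramanujan_unit_mul (ξ * η)]
    congr 1
    have h1 : (ξ : ZMod Q) * ((ξ⁻¹ : (ZMod Q)ˣ) : ZMod Q) = 1 := ξ.mul_inv
    have h2 : (η : ZMod Q) * ((η⁻¹ : (ZMod Q)ˣ) : ZMod Q) = 1 := η.mul_inv
    rw [Units.val_mul]
    linear_combination (d₂ * (η : ZMod Q)) * h1 + (d₁ * (ξ : ZMod Q)) * h2
  simp only [hram]
  have h3 : ∀ x : (ZMod (d₁ * Q))ˣ, ∑ y : (ZMod (d₂ * Q))ˣ,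
      ZMod.stdAddChar (N := d₁ * Q) (m₁ * x) * (ZMod.stdAddChar (N := d₂ * Q) (m₂ * y) *
        ((ArithmeticFunction.moebius (d₁ * d₂) : ℂ) *
          ZMod.ramanujan (q := Q) (d₁ * c₁ (x : ZMod (d₁ * Q)) + d₂ * c₂ (y : ZMod (d₂ * Q))))) =
      (ArithmeticFunction.moebius (d₁ * d₂) : ℂ) * ZMod.ramanujan (m₂ : ZMod d₂) *
        (ZMod.stdAddChar (N := d₁ * Q) (m₁ * x) *
        ∑ y : (ZMod Q)ˣ, ZMod.stdAddChar (N := Q) (m₂ * y) *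
          ZMod.ramanujan (q := Q) (d₁ * c₁ (x : ZMod (d₁ * Q)) + d₂ * (d₂ * (y : ZMod Q)))) := by
    intro x
    have := ZMod.sum_units_mul_stdAddChar hQ₂ m₂
      (fun z => ZMod.ramanujan (q := Q) (d₁ * c₁ (x : ZMod (d₁ * Q)) + d₂ * z))
    calc _ = (ArithmeticFunction.moebius (d₁ * d₂) : ℂ) * ZMod.stdAddChar (N := d₁ * Q) (m₁ * x) *
          ∑ y : (ZMod (d₂ * Q))ˣ, ZMod.stdAddChar (N := d₂ * Q) (m₂ * y) *
          ZMod.ramanujan (q := Q) (d₁ * c₁ (x : ZMod (d₁ * Q)) + d₂ * c₂ (y : ZMod (d₂ * Q))) := by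
          rw [mul_sum]
          refine sum_congr rfl fun y _ => ?_
          ring
      _ = _ := by
          rw [this]
          ring
  simp only [h3]
  rw [← mul_sum, ZMod.sum_units_mul_stdAddChar hQ₁ m₁ (fun z => ∑ y : (ZMod Q)ˣ,
    ZMod.stdAddChar (N := Q) (m₂ * y) * ZMod.ramanujan (q := Q) (d₁ * z + d₂ * (d₂ * (y : ZMod Q)))),
    ← sum_sum_ramanujan_sq_mul hQ₁ hQ₂, ramanujanSum_eq, ramanujanSum_eq]
  simp only [mul_sum]
  simp only [sum_mul]
  refine sum_congr rfl fun x _ => sum_congr rfl fun y _ => ?_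
  ring

/-- A prime dividing both d₁d₂ and Q divides the modulus twice but not the argument d₂x̄ + d₁ȳ, so
every Ramanujan sum is 0. -/
theorem sum_kloosterman_mul_kloosterman_of_not_coprime (hd : d₁.Coprime d₂)
    (hQ : ¬ (d₁ * d₂).Coprime Q) (m₁ m₂ : ℤ)
    (h₁ : d₁ * Q ∣ d₁ * d₂ * Q) (h₂ : d₂ * Q ∣ d₁ * d₂ * Q) :
    ∑ a : (ZMod (d₁ * d₂ * Q))ˣ,
        ZMod.kloosterman (q := d₁ * Q) m₁ (ZMod.castHom h₁ (ZMod (d₁ * Q)) a) *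
        ZMod.kloosterman (q := d₂ * Q) m₂ (ZMod.castHom h₂ (ZMod (d₂ * Q)) a) = 0 := by
  rw [sum_kloosterman_mul_kloosterman_eq]
  obtain ⟨ℓ, hℓ, hℓd, hℓQ⟩ := Nat.Prime.not_coprime_iff_dvd.1 hQ
  have hsq : ℓ ^ 2 ∣ d₁ * d₂ * Q := by rw [sq]; exact mul_dvd_mul hℓd hℓQ
  refine sum_eq_zero fun x _ => sum_eq_zero fun y _ => ?_
  rw [ZMod.ramanujan_natCast_eq_zero hsq, mul_zero, mul_zero]
  have hcop : ∀ {d e X Y : ℕ}, d.Coprime e → X.Coprime d → ℓ ∣ d → ¬ ℓ ∣ e * X + d * Y := by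
    intro d e X Y h1 h2 h3 h4
    have h5 : ℓ ∣ e * X := (Nat.dvd_add_left (dvd_mul_of_dvd_left h3 Y)).1 h4
    have h6 : (e * X).Coprime d := h1.symm.mul_left h2
    exact hℓ.one_lt.ne' (Nat.dvd_one.1 (h6 ▸ Nat.dvd_gcd h5 h3))
  rcases (Nat.Prime.dvd_mul hℓ).1 hℓd with h | h
  · exact hcop hd (ZMod.coprime_val_units_inv x) h
  · rw [add_comm]
    exact hcop hd.symm (ZMod.coprime_val_units_inv y) h

end MainTerm

end

/-! ### Bessel functions and the weight in logarithmic coordinates -/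

section

open MeasureTheory Set Filter Topology
open scoped ContDiff

section Bessel

/-- Oscillatory integrals generalising Bessel's integral. -/
noncomputable def besselIntegralAux (g φ : ℝ → ℝ) (x : ℝ) : ℝ :=
  ∫ θ in (0 : ℝ)..Real.pi, g θ * Real.cos (φ θ - x * Real.sin θ)

/-- Writing sin as a cosine shifted by π/2 keeps the family closed under differentiation, so
smoothness follows by induction. -/
theorem hasDerivAt_besselIntegralAux {g φ : ℝ → ℝ} (hg : Continuous g) (hφ : Continuous φ) (x : ℝ) :
    HasDerivAt (besselIntegralAux g φ)
      (besselIntegralAux (fun θ => g θ * Real.sin θ) (fun θ => φ θ - Real.pi / 2) x) x := by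
  have h := intervalIntegral.hasDerivAt_integral_of_dominated_loc_of_deriv_le (μ := volume)
    (a := 0) (b := Real.pi) (s := univ) (x₀ := x)
    (F := fun x θ => g θ * Real.cos (φ θ - x * Real.sin θ))
    (F' := fun x θ => g θ * Real.sin θ * Real.cos (φ θ - Real.pi / 2 - x * Real.sin θ))
    (bound := fun θ => |g θ|) univ_mem
    (Eventually.of_forall fun y => (by fun_prop : Continuous fun θ =>
      g θ * Real.cos (φ θ - y * Real.sin θ)).aestronglyMeasurable)
    (Continuous.intervalIntegrable (by fun_prop) _ _)
    (by fun_prop : Continuous fun θ =>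
      g θ * Real.sin θ * Real.cos (φ θ - Real.pi / 2 - x * Real.sin θ)).aestronglyMeasurable
    (Eventually.of_forall fun θ _ y _ => ?_) (Continuous.intervalIntegrable (by fun_prop) _ _)
    (Eventually.of_forall fun θ _ y _ => ?_)
  · exact h.2
  · rw [norm_mul, norm_mul, Real.norm_eq_abs, Real.norm_eq_abs, Real.norm_eq_abs, mul_assoc]
    refine mul_le_of_le_one_right (abs_nonneg _) ?_
    exact mul_le_one₀ (Real.abs_sin_le_one _) (abs_nonneg _) (Real.abs_cos_le_one _)
  · have h1 : HasDerivAt (fun y => φ θ - y * Real.sin θ) (-(1 * Real.sin θ)) y :=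
      ((hasDerivAt_id y).mul_const (Real.sin θ)).const_sub (φ θ)
    refine (h1.cos.const_mul (g θ)).congr_deriv ?_
    rw [show φ θ - Real.pi / 2 - y * Real.sin θ = φ θ - y * Real.sin θ - Real.pi / 2 by ring,
      Real.cos_sub_pi_div_two]
    ring

theorem contDiff_besselIntegralAux (n : ℕ) : ∀ {g φ : ℝ → ℝ}, Continuous g → Continuous φ →
    ContDiff ℝ n (besselIntegralAux g φ) := by
  induction n with
  | zero =>
    intro g φ hg hφ
    exact contDiff_zero.2 (continuous_iff_continuousAt.2 fun x =>
      (hasDerivAt_besselIntegralAux hg hφ x).continuousAt)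
  | succ n ih =>
    intro g φ hg hφ
    push_cast
    rw [contDiff_succ_iff_deriv]
    refine ⟨fun x => (hasDerivAt_besselIntegralAux hg hφ x).differentiableAt, by simp, ?_⟩
    have : deriv (besselIntegralAux g φ) =
        besselIntegralAux (fun θ => g θ * Real.sin θ) (fun θ => φ θ - Real.pi / 2) :=
      funext fun x => (hasDerivAt_besselIntegralAux hg hφ x).deriv
    rw [this]
    exact ih (by fun_prop) (by fun_prop)

theorem besselJ_eq (n : ℕ) :
    besselJ n = fun x => (1 / Real.pi) * besselIntegralAux (fun _ => 1) (fun θ => n * θ) x := by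
  ext x; simp [besselJ, besselIntegralAux]

theorem contDiff_besselJ (n : ℕ) : ContDiff ℝ ∞ (besselJ n) := by
  rw [besselJ_eq]
  exact contDiff_const.mul (contDiff_infty.2 fun m =>
    contDiff_besselIntegralAux m continuous_const (by fun_prop))

theorem abs_deriv_besselJ_le (n : ℕ) (x : ℝ) : |deriv (besselJ n) x| ≤ 1 := by
  have h := (hasDerivAt_besselIntegralAux (g := fun _ => 1) (φ := fun θ => n * θ)
    continuous_const (by fun_prop) x).const_mul (1 / Real.pi)
  rw [besselJ_eq, h.deriv, abs_mul, abs_of_pos (by positivity : 0 < 1 / Real.pi)]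
  have h2 := intervalIntegral.norm_integral_le_of_norm_le_const (a := 0) (b := Real.pi) (C := 1)
    (f := fun θ => 1 * Real.sin θ * Real.cos (n * θ - Real.pi / 2 - x * Real.sin θ)) (fun θ _ => by
      rw [one_mul, norm_mul]
      exact mul_le_one₀ (Real.abs_sin_le_one _) (abs_nonneg _) (Real.abs_cos_le_one _))
  rw [sub_zero, abs_of_pos Real.pi_pos, one_mul, Real.norm_eq_abs] at h2
  calc _ ≤ 1 / Real.pi * Real.pi := by gcongr; exact h2
    _ = 1 := by field_simp

theorem besselJ_zero {n : ℕ} (hn : n ≠ 0) : besselJ n 0 = 0 := by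
  have hn' : (n : ℝ) ≠ 0 := by exact_mod_cast hn
  simp only [besselJ, zero_mul, sub_zero]
  rw [intervalIntegral.integral_comp_mul_left (fun x => Real.cos x) hn', integral_cos]
  simp

/-- J_n(0) = 0 for n ≥ 1 and |J_n'| ≤ 1. One power of x from each Bessel factor is all that the
error term requires. -/
theorem abs_besselJ_le {n : ℕ} (hn : n ≠ 0) (x : ℝ) : |besselJ n x| ≤ |x| := by
  have hd : Differentiable ℝ (besselJ n) := (contDiff_besselJ n).differentiable (by simp)
  have := Convex.norm_image_sub_le_of_norm_deriv_le (f := besselJ n) (s := univ) (x := 0) (y := x)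
    (C := 1) (fun y _ => hd y) (fun y _ => abs_deriv_besselJ_le n y) convex_univ trivial trivial
  simpa [besselJ_zero hn] using this

end Bessel

section Weight

/-- The real factor of the weight, in logarithmic coordinates. -/
noncomputable def besselWeight (n₁ n₂ : ℕ) (α β v : ℝ) : ℝ :=
  Real.exp (-(v / 2)) * besselJ n₁ (α * Real.exp (v / 2)) * besselJ n₂ (β * Real.exp (v / 2))

variable {n₁ n₂ : ℕ} {α β : ℝ}

theorem contDiff_besselWeight : ContDiff ℝ ∞ (besselWeight n₁ n₂ α β) := by
  have h1 := contDiff_besselJ n₁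
  have h2 := contDiff_besselJ n₂
  unfold besselWeight
  fun_prop

theorem abs_besselJ_mul_exp_le {n : ℕ} (hn : n ≠ 0) {α : ℝ} (hα : 0 ≤ α) (v : ℝ) :
    |besselJ n (α * Real.exp v)| ≤ α * Real.exp v := by
  refine (abs_besselJ_le hn _).trans (le_of_eq (abs_of_nonneg (by positivity)))

theorem abs_besselWeight_le (hn₁ : n₁ ≠ 0) (hn₂ : n₂ ≠ 0) (hα : 0 ≤ α) (hβ : 0 ≤ β) (v : ℝ) :
    |besselWeight n₁ n₂ α β v| ≤ α * β * Real.exp (v / 2) := by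
  rw [besselWeight, abs_mul, abs_mul, abs_of_pos (Real.exp_pos _)]
  calc _ ≤ Real.exp (-(v / 2)) * (α * Real.exp (v / 2)) * (β * Real.exp (v / 2)) := by
        gcongr
        · exact abs_besselJ_mul_exp_le hn₁ hα _
        · exact abs_besselJ_mul_exp_le hn₂ hβ _
    _ = (Real.exp (-(v / 2)) * Real.exp (v / 2)) * (α * β * Real.exp (v / 2)) := by ring
    _ = _ := by rw [← Real.exp_add]; simp

/-- Each of the three product-rule terms is at most half of αβe^{v/2}, because e^{v/2} has
derivative e^{v/2}/2; their sum 3/2 is rounded up to 2. -/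
theorem abs_deriv_besselWeight_le (hn₁ : n₁ ≠ 0) (hn₂ : n₂ ≠ 0) (hα : 0 ≤ α) (hβ : 0 ≤ β) (v : ℝ) :
    |deriv (besselWeight n₁ n₂ α β) v| ≤ 2 * (α * β * Real.exp (v / 2)) := by
  have hE : HasDerivAt (fun v : ℝ => Real.exp (v / 2)) (Real.exp (v / 2) * (1 / 2)) v :=
    ((hasDerivAt_id v).div_const 2).exp
  have hE' : HasDerivAt (fun v : ℝ => Real.exp (-(v / 2))) (Real.exp (-(v / 2)) * (-(1 / 2))) v :=
    (((hasDerivAt_id v).div_const 2).neg).exp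
  have hJ : ∀ (n : ℕ) (γ : ℝ), HasDerivAt (fun v : ℝ => besselJ n (γ * Real.exp (v / 2)))
      (deriv (besselJ n) (γ * Real.exp (v / 2)) * (γ * (Real.exp (v / 2) * (1 / 2)))) v :=
    fun n γ => HasDerivAt.comp (h₂ := besselJ n) (h := fun v : ℝ => γ * Real.exp (v / 2)) v
      ((contDiff_besselJ n).differentiable (by simp) _).hasDerivAt (hE.const_mul γ)
  have hd := ((hE'.mul (hJ n₁ α)).mul (hJ n₂ β)).deriv
  have hd' : deriv (besselWeight n₁ n₂ α β) v = _ := hd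
  rw [hd']
  have he0 := Real.exp_pos (v / 2)
  have hee : Real.exp (-(v / 2)) * Real.exp (v / 2) = 1 := by rw [← Real.exp_add]; simp
  have j1 := abs_besselJ_mul_exp_le hn₁ hα (v / 2)
  have j2 := abs_besselJ_mul_exp_le hn₂ hβ (v / 2)
  have k1 := abs_deriv_besselJ_le n₁ (α * Real.exp (v / 2))
  have k2 := abs_deriv_besselJ_le n₂ (β * Real.exp (v / 2))
  simp only [Pi.mul_apply]
  generalize Real.exp (v / 2) = e at *
  have hf0 := Real.exp_pos (-(v / 2))
  generalize Real.exp (-(v / 2)) = f at *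
  generalize besselJ n₁ (α * e) = a at *
  generalize besselJ n₂ (β * e) = b at *
  generalize deriv (besselJ n₁) (α * e) = a' at *
  generalize deriv (besselJ n₂) (β * e) = b' at *
  have t1 : |f * a * b| ≤ α * β * e := by
    rw [abs_mul, abs_mul, abs_of_pos hf0]
    calc f * |a| * |b| ≤ f * (α * e) * (β * e) := by gcongr
      _ = (f * e) * (α * β * e) := by ring
      _ = _ := by rw [hee, one_mul]
  have t2 : |f * (a' * (α * e)) * b| ≤ α * β * e := by
    rw [abs_mul, abs_mul, abs_mul, abs_of_pos hf0, abs_of_nonneg (by positivity : 0 ≤ α * e)]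
    calc f * (|a'| * (α * e)) * |b| ≤ f * (1 * (α * e)) * (β * e) := by gcongr
      _ = (f * e) * (α * β * e) := by ring
      _ = _ := by rw [hee, one_mul]
  have t3 : |f * a * (b' * (β * e))| ≤ α * β * e := by
    rw [abs_mul, abs_mul, abs_mul, abs_of_pos hf0, abs_of_nonneg (by positivity : 0 ≤ β * e)]
    calc f * |a| * (|b'| * (β * e)) ≤ f * (α * e) * (1 * (β * e)) := by gcongr
      _ = (f * e) * (α * β * e) := by ring
      _ = _ := by rw [hee, one_mul]
  rw [abs_le] at *
  constructor <;> nlinarith [t1.1, t1.2, t2.1, t2.2, t3.1, t3.2]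

/-- The weight, in logarithmic coordinates. -/
noncomputable def logWeight (n₁ n₂ : ℕ) (α β L : ℝ) (g : ℝ → ℂ) (v : ℝ) : ℂ :=
  (besselWeight n₁ n₂ α β v : ℂ) * g (v / L)

variable {L A σ : ℝ} {g : ℝ → ℂ}

theorem contDiff_logWeight (hg : ContDiff ℝ ∞ g) : ContDiff ℝ ∞ (logWeight n₁ n₂ α β L g) := by
  have h1 : ContDiff ℝ ∞ fun v => (besselWeight n₁ n₂ α β v : ℂ) :=
    Complex.ofRealCLM.contDiff.comp contDiff_besselWeight
  exact h1.mul (hg.comp (by fun_prop))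

theorem logWeight_eq_zero (hL : 0 < L) (hg : tsupport g ⊆ Ioo (-σ) σ) {v : ℝ} (hv : σ * L ≤ |v|) :
    logWeight n₁ n₂ α β L g v = 0 := by
  have : v / L ∉ tsupport g := by
    intro h
    have h2 := abs_lt.2 (hg h)
    rw [abs_div, abs_of_pos hL, div_lt_iff₀ hL] at h2
    linarith
  rw [logWeight, image_eq_zero_of_notMem_tsupport this, mul_zero]

theorem hasCompactSupport_logWeight (hL : 0 < L) (hg : tsupport g ⊆ Ioo (-σ) σ) :
    HasCompactSupport (logWeight n₁ n₂ α β L g) := by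
  refine HasCompactSupport.intro (isCompact_Icc (a := -(σ * L)) (b := σ * L)) fun v hv => ?_
  refine logWeight_eq_zero hL hg ?_
  by_contra h
  push Not at h
  exact hv (abs_le.1 h.le)

theorem norm_logWeight_le (hn₁ : n₁ ≠ 0) (hn₂ : n₂ ≠ 0) (hα : 0 ≤ α) (hβ : 0 ≤ β)
    (hA : ∀ y, ‖g y‖ ≤ A) (v : ℝ) :
    ‖logWeight n₁ n₂ α β L g v‖ ≤ A * (α * β) * Real.exp (v / 2) := by
  rw [logWeight, norm_mul, Complex.norm_real, Real.norm_eq_abs]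
  calc _ ≤ (α * β * Real.exp (v / 2)) * A := by
        gcongr
        · exact abs_besselWeight_le hn₁ hn₂ hα hβ v
        · exact hA _
    _ = _ := by ring

/-- Here 3 = 2 + 1: the Bessel factor contributes 2, and the derivative of g(v/L) contributes 1/L ≤
1. -/
theorem norm_deriv_logWeight_le (hn₁ : n₁ ≠ 0) (hn₂ : n₂ ≠ 0) (hα : 0 ≤ α) (hβ : 0 ≤ β)
    (hL : 1 ≤ L) (hg : Differentiable ℝ g) (hA : ∀ y, ‖g y‖ ≤ A) (hA' : ∀ y, ‖deriv g y‖ ≤ A)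
    (v : ℝ) :
    ‖deriv (logWeight n₁ n₂ α β L g) v‖ ≤ 3 * A * (α * β) * Real.exp (v / 2) := by
  have hL0 : 0 < L := by linarith
  have h1 : HasDerivAt (fun v => (besselWeight n₁ n₂ α β v : ℂ))
      ((deriv (besselWeight n₁ n₂ α β) v : ℝ) : ℂ) v :=
    ((contDiff_besselWeight.differentiable (by simp)) v).hasDerivAt.ofReal_comp
  have h2 : HasDerivAt (fun v => g (v / L)) ((1 / L) • deriv g (v / L)) v :=
    HasDerivAt.scomp v (hg (v / L)).hasDerivAt ((hasDerivAt_id v).div_const L)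
  have h3 : deriv (logWeight n₁ n₂ α β L g) v = _ := (h1.mul h2).deriv
  rw [h3]
  have b1 := abs_besselWeight_le hn₁ hn₂ hα hβ v
  have b2 := abs_deriv_besselWeight_le hn₁ hn₂ hα hβ v
  have hA0 : 0 ≤ A := (norm_nonneg _).trans (hA 0)
  refine (norm_add_le _ _).trans ?_
  rw [norm_mul, norm_mul, norm_smul, Complex.norm_real, Complex.norm_real, Real.norm_eq_abs,
    Real.norm_eq_abs, Real.norm_of_nonneg (by positivity : 0 ≤ 1 / L)]
  calc _ ≤ 2 * (α * β * Real.exp (v / 2)) * A + α * β * Real.exp (v / 2) * (1 * A) := by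
        gcongr
        · exact hA _
        · rw [div_le_one hL0]; exact hL
        · exact hA' _
    _ = _ := by ring

theorem deriv_logWeight_eq_zero (hL : 0 < L) (hg : tsupport g ⊆ Ioo (-σ) σ) {v : ℝ}
    (hv : σ * L < v) : deriv (logWeight n₁ n₂ α β L g) v = 0 := by
  have : logWeight n₁ n₂ α β L g =ᶠ[𝓝 v] fun _ => 0 := by
    filter_upwards [lt_mem_nhds hv] with w hw
    exact logWeight_eq_zero hL hg (hw.le.trans (le_abs_self w))
  rw [this.deriv_eq, deriv_const]

/-- The integrand is at most a constant times e^{(2+2δ)v}, which is integrable at −∞ and is cut off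
at v = σL by the support of g. -/
theorem sqrt_integral_deriv_logWeight_le (hn₁ : n₁ ≠ 0) (hn₂ : n₂ ≠ 0) (hα : 0 ≤ α) (hβ : 0 ≤ β)
    (hL : 1 ≤ L) (hgd : ContDiff ℝ ∞ g) (hA : ∀ y, ‖g y‖ ≤ A) (hA' : ∀ y, ‖deriv g y‖ ≤ A)
    (hg : tsupport g ⊆ Ioo (-σ) σ) {δ : ℝ} (hδ : 0 < δ) :
    √(∫ v : ℝ, ‖deriv (logWeight n₁ n₂ α β L g) v‖ ^ 2 * Real.exp ((1 + 2 * δ) * v)) ≤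
      3 * A * (α * β) * Real.exp ((1 + δ) * (σ * L)) := by
  have hL0 : 0 < L := by linarith
  have hA0 : 0 ≤ A := (norm_nonneg _).trans (hA 0)
  set B := 3 * A * (α * β) with hB
  have hB0 : 0 ≤ B := by positivity
  refine Real.sqrt_le_iff.2 ⟨by positivity, ?_⟩
  have hint : IntegrableOn (fun v : ℝ => B ^ 2 * Real.exp ((2 + 2 * δ) * v)) (Iic (σ * L)) :=
    (integrableOn_exp_mul_Iic (by positivity) _).const_mul _
  have h0 : ∫ v : ℝ, ‖deriv (logWeight n₁ n₂ α β L g) v‖ ^ 2 * Real.exp ((1 + 2 * δ) * v) =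
      ∫ v in Iic (σ * L), ‖deriv (logWeight n₁ n₂ α β L g) v‖ ^ 2 * Real.exp ((1 + 2 * δ) * v) := by
    rw [setIntegral_eq_integral_of_forall_compl_eq_zero]
    intro v hv
    rw [deriv_logWeight_eq_zero hL0 hg (not_le.1 hv)]
    simp
  rw [h0]
  have h1 : ∫ v in Iic (σ * L), ‖deriv (logWeight n₁ n₂ α β L g) v‖ ^ 2 * Real.exp ((1 + 2 * δ) * v)
      ≤ ∫ v in Iic (σ * L), B ^ 2 * Real.exp ((2 + 2 * δ) * v) := by
    refine integral_mono_of_nonneg (Eventually.of_forall fun v => by positivity) hint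
      (Eventually.of_forall fun v => ?_)
    have := norm_deriv_logWeight_le hn₁ hn₂ hα hβ hL (hgd.differentiable (by simp)) hA hA' v
    calc _ ≤ (B * Real.exp (v / 2)) ^ 2 * Real.exp ((1 + 2 * δ) * v) :=
          mul_le_mul_of_nonneg_right (pow_le_pow_left₀ (norm_nonneg _) this 2) (Real.exp_pos _).le
      _ = B ^ 2 * (Real.exp (v / 2) * Real.exp (v / 2) * Real.exp ((1 + 2 * δ) * v)) := by ring
      _ = _ := by
        rw [← Real.exp_add, ← Real.exp_add]
        congr 2
        ring
  refine h1.trans ?_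
  rw [integral_const_mul, integral_exp_mul_Iic (by positivity), mul_pow B, ← Real.exp_nat_mul]
  refine mul_le_mul_of_nonneg_left ?_ (by positivity)
  rw [div_le_iff₀ (by positivity)]
  have : Real.exp ((2 + 2 * δ) * (σ * L)) = Real.exp ((2 : ℕ) * ((1 + δ) * (σ * L))) := by
    congr 1; push_cast; ring
  rw [this]
  nlinarith [Real.exp_pos ((2 : ℕ) * ((1 + δ) * (σ * L)))]

/-- The prime number theorem produces the integral over v > 0, while I runs over all v; this bounds
the difference. -/
theorem norm_integral_Iic_logWeight_le (hn₁ : n₁ ≠ 0) (hn₂ : n₂ ≠ 0) (hα : 0 ≤ α) (hβ : 0 ≤ β)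
    (hA : ∀ y, ‖g y‖ ≤ A) :
    ‖∫ v in Iic (0 : ℝ), logWeight n₁ n₂ α β L g v * Complex.exp v‖ ≤ A * (α * β) := by
  have hA0 : 0 ≤ A := (norm_nonneg _).trans (hA 0)
  have hint : IntegrableOn (fun v : ℝ => A * (α * β) * Real.exp ((3 / 2) * v)) (Iic 0) :=
    (integrableOn_exp_mul_Iic (by positivity) _).const_mul _
  refine (norm_integral_le_of_norm_le hint (Eventually.of_forall fun v => ?_)).trans ?_
  · rw [norm_mul, Complex.norm_exp, Complex.ofReal_re]
    calc _ ≤ A * (α * β) * Real.exp (v / 2) * Real.exp v := by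
          gcongr
          exact norm_logWeight_le hn₁ hn₂ hα hβ hA v
      _ = _ := by
        rw [mul_assoc, ← Real.exp_add]
        congr 2
        ring
  · rw [integral_const_mul, integral_exp_mul_Iic (by positivity)]
    refine mul_le_of_le_one_right (by positivity) ?_
    norm_num

end Weight

end

/-! ### From prime powers to primes -/

section

open MeasureTheory Set Filter Topology
open scoped ContDiff

section PrimeSums

/-- Substitute y = e^{v/2}: the Jacobian is ½e^{v/2} = ½e^{-v/2}·e^v, and e^{-v/2} belongs to the
weight. -/
theorem integral_Ioi_eq_integral_logWeight (n₁ n₂ : ℕ) (α β L : ℝ) (g : ℝ → ℂ) :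
    ∫ y in Ioi (0 : ℝ), (besselJ n₁ (α * y) : ℂ) * (besselJ n₂ (β * y) : ℂ) *
        g (2 * (Real.log y / L)) / (L : ℂ) =
      1 / (2 * L) * ∫ v : ℝ, logWeight n₁ n₂ α β L g v * Complex.exp v := by
  have himg : (fun v : ℝ => Real.exp (v / 2)) '' univ = Ioi 0 := by
    ext y
    simp only [mem_image, mem_univ, true_and, mem_Ioi]
    refine ⟨fun ⟨v, hv⟩ => hv ▸ Real.exp_pos _, fun hy => ⟨2 * Real.log y, ?_⟩⟩
    rw [mul_div_cancel_left₀ _ two_ne_zero, Real.exp_log hy]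
  have hinj : InjOn (fun v : ℝ => Real.exp (v / 2)) univ := fun a _ b _ hab => by
    have := Real.exp_injective hab
    linarith
  have h := integral_image_eq_integral_abs_deriv_smul (s := univ)
    (f := fun v : ℝ => Real.exp (v / 2)) (f' := fun v => Real.exp (v / 2) * (1 / 2))
    MeasurableSet.univ (fun v _ => (((hasDerivAt_id v).div_const 2).exp).hasDerivWithinAt) hinj
    (fun y => (besselJ n₁ (α * y) : ℂ) * (besselJ n₂ (β * y) : ℂ) *
        g (2 * (Real.log y / L)) / (L : ℂ))
  rw [himg, Measure.restrict_univ] at h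
  rw [h, ← integral_const_mul]
  refine integral_congr_ae (Eventually.of_forall fun v => ?_)
  have he : (Real.exp (v / 2) : ℂ) = (Real.exp (-(v / 2)) : ℂ) * Complex.exp v := by
    rw [← Complex.ofReal_exp, ← Complex.ofReal_mul, ← Real.exp_add]
    congr 2; ring
  simp only [logWeight, besselWeight, Real.log_exp]
  rw [abs_of_pos (by positivity), Complex.real_smul]
  push_cast [-Complex.ofReal_exp]
  rw [he, show 2 * (v / 2 / L) = v / L by ring]
  ring

/-- With X = e^V, the non-primes have total Λ-mass ψ(X) − θ(X) ≤ 2√X log X, and h is at most B√X on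
them. -/
theorem norm_tsum_vonMangoldt_sub_sum_primes_le {h : ℝ → ℂ} {B V : ℝ} (hV : 0 ≤ V)
    (hB : ∀ v, ‖h v‖ ≤ B * Real.exp (v / 2)) (h0 : ∀ v, V ≤ v → h v = 0)
    {c : ℕ → ℂ} (hc : ∀ n, ‖c n‖ ≤ 1) :
    ‖∑' n : ℕ, c n * ArithmeticFunction.vonMangoldt n * h (Real.log n) -
        ∑ p ∈ Finset.Ioc 0 ⌊Real.exp V⌋₊ with p.Prime, c p * Real.log p * h (Real.log p)‖ ≤
      2 * B * V * Real.exp V := by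
  have hB0 : 0 ≤ B := by simpa using (norm_nonneg _).trans (hB 0)
  have hX : 1 ≤ Real.exp V := Real.one_le_exp hV
  have hbig : ∀ n ∉ Finset.Ioc 0 ⌊Real.exp V⌋₊,
      c n * ArithmeticFunction.vonMangoldt n * h (Real.log n) = 0 := by
    intro n hn
    rcases Nat.eq_zero_or_pos n with rfl | hn0
    · simp
    rw [Finset.mem_Ioc, not_and, not_le, Nat.floor_lt (Real.exp_pos _).le] at hn
    rw [h0, mul_zero]
    exact (Real.le_log_iff_exp_le (by exact_mod_cast hn0)).2 (hn hn0).le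
  rw [tsum_eq_sum hbig, ← Finset.sum_filter_add_sum_filter_not _ Nat.Prime]
  have hp : ∑ p ∈ Finset.Ioc 0 ⌊Real.exp V⌋₊ with p.Prime,
      c p * ArithmeticFunction.vonMangoldt p * h (Real.log p) =
      ∑ p ∈ Finset.Ioc 0 ⌊Real.exp V⌋₊ with p.Prime, c p * Real.log p * h (Real.log p) :=
    Finset.sum_congr rfl fun p hp => by
      rw [ArithmeticFunction.vonMangoldt_apply_prime (Finset.mem_filter.1 hp).2]
  rw [hp, add_sub_cancel_left]
  have hψ := Chebyshev.psi_sub_theta_le hX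
  rw [Chebyshev.psi_sub_theta_eq_sum_not_prime, Real.log_exp] at hψ
  calc _ ≤ ∑ n ∈ Finset.Ioc 0 ⌊Real.exp V⌋₊ with ¬n.Prime,
        ArithmeticFunction.vonMangoldt n * (B * √(Real.exp V)) := by
        refine norm_sum_le_of_le _ fun n hn => ?_
        have hn' := Finset.mem_Ioc.1 (Finset.mem_filter.1 hn).1
        have hn0 : (0 : ℝ) < n := by exact_mod_cast hn'.1
        have hnX : (n : ℝ) ≤ Real.exp V := (Nat.le_floor_iff (Real.exp_pos _).le).1 hn'.2
        have hΛ : 0 ≤ ArithmeticFunction.vonMangoldt n := ArithmeticFunction.vonMangoldt_nonneg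
        rw [norm_mul, norm_mul, Complex.norm_real, Real.norm_of_nonneg hΛ]
        refine mul_le_mul (mul_le_of_le_one_left hΛ (hc n)) ((hB _).trans ?_) (norm_nonneg _) hΛ
        refine mul_le_mul_of_nonneg_left ?_ hB0
        rw [Real.exp_half, Real.exp_log hn0]
        exact Real.sqrt_le_sqrt hnX
    _ ≤ (2 * √(Real.exp V) * V) * (B * √(Real.exp V)) := by
        rw [← Finset.sum_mul]
        exact mul_le_mul_of_nonneg_right hψ (by positivity)
    _ = 2 * B * V * (√(Real.exp V) * √(Real.exp V)) := by ring
    _ = _ := by rw [Real.mul_self_sqrt (Real.exp_pos _).le]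

/-- There are at most τ(q) such primes, each bounded trivially. -/
theorem norm_sum_primes_dvd_le {h : ℝ → ℂ} {B V : ℝ} (hV : 0 ≤ V)
    (hB : ∀ v, ‖h v‖ ≤ B * Real.exp (v / 2)) {q : ℕ} (hq : q ≠ 0) {c : ℕ → ℂ} {M : ℝ}
    (hc : ∀ n, ‖c n‖ ≤ M) :
    ‖∑ p ∈ Finset.Ioc 0 ⌊Real.exp V⌋₊ with p.Prime ∧ p ∣ q, c p * Real.log p * h (Real.log p)‖ ≤
      q.divisors.card * (M * V * (B * √(Real.exp V))) := by
  have hB0 : 0 ≤ B := by simpa using (norm_nonneg _).trans (hB 0)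
  have hM0 : 0 ≤ M := (norm_nonneg _).trans (hc 0)
  have hcard : ((Finset.Ioc 0 ⌊Real.exp V⌋₊).filter fun p => p.Prime ∧ p ∣ q).card ≤
      q.divisors.card :=
    Finset.card_le_card fun p hp => Nat.mem_divisors.2 ⟨(Finset.mem_filter.1 hp).2.2, hq⟩
  calc _ ≤ ∑ p ∈ Finset.Ioc 0 ⌊Real.exp V⌋₊ with p.Prime ∧ p ∣ q,
        M * V * (B * √(Real.exp V)) := by
        refine norm_sum_le_of_le _ fun n hn => ?_
        have hn' := Finset.mem_Ioc.1 (Finset.mem_filter.1 hn).1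
        have hn1 : (1 : ℝ) ≤ n := by exact_mod_cast hn'.1
        have hn0 : (0 : ℝ) < n := by linarith
        have hnX : (n : ℝ) ≤ Real.exp V := (Nat.le_floor_iff (Real.exp_pos _).le).1 hn'.2
        rw [norm_mul, norm_mul, Complex.norm_real, Real.norm_of_nonneg (Real.log_nonneg hn1)]
        have hlog : Real.log n ≤ V := (Real.log_le_iff_le_exp hn0).2 hnX
        have hh : ‖h (Real.log n)‖ ≤ B * √(Real.exp V) := by
          refine (hB _).trans (mul_le_mul_of_nonneg_left ?_ hB0)
          rw [Real.exp_half, Real.exp_log hn0]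
          exact Real.sqrt_le_sqrt hnX
        have := hc n
        have := Real.log_nonneg hn1
        gcongr
    _ ≤ _ := by
        rw [Finset.sum_const, nsmul_eq_mul]
        have : (((Finset.Ioc 0 ⌊Real.exp V⌋₊).filter fun p => p.Prime ∧ p ∣ q).card : ℝ) ≤
          q.divisors.card := by exact_mod_cast hcard
        gcongr

end PrimeSums

end

/-! ### Weighted prime sums twisted by a character -/

section

open MeasureTheory Set Filter Topology
open scoped ContDiff

section CharacterSums

variable {n₁ n₂ : ℕ} {α β L A σ : ℝ} {g : ℝ → ℂ}

theorem le_exp_mul_div {δ : ℝ} (hδ : 0 < δ) (V : ℝ) : V ≤ Real.exp (δ * V) / δ := by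
  rw [le_div_iff₀ hδ]
  linarith [Real.add_one_le_exp (δ * V)]

-- For the principal character the sum is compared with that of Λ itself, after removing the primes
-- dividing q; this avoids treating the imprimitive L-function.
open Classical in
theorem GRHDirichlet.exists_norm_sum_primes_character_le (hG : GRHDirichlet) {δ : ℝ}
    (hδ : 0 < δ) (hδ1 : δ ≤ 1) (hσ : 0 < σ) (hgd : ContDiff ℝ ∞ g) (hg : tsupport g ⊆ Ioo (-σ) σ)
    (hA : ∀ y, ‖g y‖ ≤ A) (hA' : ∀ y, ‖deriv g y‖ ≤ A) :
    ∃ C : ℝ, 0 ≤ C ∧ ∀ (q : ℕ) [NeZero q] (χ : DirichletCharacter ℂ q) (n₁ n₂ : ℕ) (α β L : ℝ),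
      n₁ ≠ 0 → n₂ ≠ 0 → 0 ≤ α → 0 ≤ β → 1 ≤ L →
      ‖∑ p ∈ Finset.Ioc 0 ⌊Real.exp (σ * L)⌋₊ with p.Prime,
          χ p * Real.log p * logWeight n₁ n₂ α β L g (Real.log p) -
        if χ = 1 then ∫ v : ℝ, logWeight n₁ n₂ α β L g v * Complex.exp v else 0‖ ≤
      C * (α * β) * (q : ℝ) ^ δ * Real.exp ((1 + δ) * (σ * L)) := by
  obtain ⟨C₁, hC₁, H₁⟩ := hG.exists_norm_tsum_vonMangoldt_character_le hδ hδ1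
  obtain ⟨C₂, hC₂, H₂⟩ := hG.exists_norm_tsum_vonMangoldt_sub_integral_le hδ hδ1
  obtain ⟨C₃, hC₃, H₃⟩ := exists_card_divisors_le_rpow hδ
  have hA0 : 0 ≤ A := (norm_nonneg _).trans (hA 0)
  -- The terms cover, in order: nonprincipal characters, the principal one, prime powers, primes
  -- dividing q, and v < 0. The factors 1/δ come from V ≤ e^{δV}/δ.
  refine ⟨A * (3 * C₁ + 3 * C₂ + 2 / δ + C₃ / δ + 1), by positivity,
    fun q _ χ n₁ n₂ α β L hn₁ hn₂ hα hβ hL => ?_⟩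
  have hL0 : 0 < L := by linarith
  have hV : 0 ≤ σ * L := by positivity
  set h := logWeight n₁ n₂ α β L g with hh
  set V := σ * L with hVdef
  have hd : ContDiff ℝ ∞ h := contDiff_logWeight hgd
  have hs : HasCompactSupport h := hasCompactSupport_logWeight hL0 hg
  have hB : ∀ v, ‖h v‖ ≤ A * (α * β) * Real.exp (v / 2) := norm_logWeight_le hn₁ hn₂ hα hβ hA
  have h0 : ∀ v, V ≤ v → h v = 0 := fun v hv =>
    logWeight_eq_zero hL0 hg (hv.trans (le_abs_self v))
  have hq0 : q ≠ 0 := NeZero.ne q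
  have hq1 : (1 : ℝ) ≤ q := by exact_mod_cast Nat.one_le_iff_ne_zero.2 hq0
  have hqδ : 1 ≤ (q : ℝ) ^ δ := Real.one_le_rpow hq1 hδ.le
  have hVδ : V ≤ Real.exp (δ * V) / δ := le_exp_mul_div hδ V
  have hE : Real.exp ((1 + δ) * V) = Real.exp (δ * V) * Real.exp V := by
    rw [← Real.exp_add]; congr 1; ring
  have hE1 : 1 ≤ Real.exp ((1 + δ) * V) := Real.one_le_exp (by positivity)
  have hX : 1 ≤ Real.exp V := Real.one_le_exp hV
  have hsq := sqrt_integral_deriv_logWeight_le hn₁ hn₂ hα hβ hL hgd hA hA' hg hδ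
  rw [← hh] at hsq
  set P := A * (α * β) with hP
  have hP0 : 0 ≤ P := by positivity
  set E := Real.exp ((1 + δ) * V) with hEdef
  have hsq' : √(∫ v : ℝ, ‖deriv h v‖ ^ 2 * Real.exp ((1 + 2 * δ) * v)) ≤ 3 * P * E :=
    hsq.trans (le_of_eq (by rw [hP]; ring))
  have hVX : V * Real.exp V ≤ E / δ := by
    rw [hE]
    calc V * Real.exp V ≤ Real.exp (δ * V) / δ * Real.exp V := by gcongr
      _ = _ := by ring
  have b2 : 2 * P * V * Real.exp V ≤ 2 / δ * P * (q : ℝ) ^ δ * E := by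
    calc 2 * P * V * Real.exp V = 2 * P * (V * Real.exp V) := by ring
      _ ≤ 2 * P * (E / δ) := by gcongr
      _ = (2 / δ * P * E) * 1 := by ring
      _ ≤ (2 / δ * P * E) * (q : ℝ) ^ δ := by gcongr
      _ = _ := by ring
  by_cases hχ : χ = 1
  · subst hχ
    rw [if_pos rfl]
    have e1 := H₂ h hd hs
    have e2 := norm_tsum_vonMangoldt_sub_sum_primes_le hV hB h0 (c := fun _ => 1) (by simp)
    have e3 := norm_sum_primes_dvd_le hV hB hq0 (c := fun _ => 1) (M := 1) (by simp)
    have e4 := norm_integral_Iic_logWeight_le (L := L) hn₁ hn₂ hα hβ hA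
    rw [← hh] at e4
    simp only [one_mul] at e2 e3
    have hint : Integrable fun v : ℝ => h v * Complex.exp v :=
      (hd.continuous.mul (by fun_prop)).integrable_of_hasCompactSupport hs.mul_right
    have hsplit : ∫ v : ℝ, h v * Complex.exp v =
        (∫ v in Iic (0 : ℝ), h v * Complex.exp v) + ∫ v in Ioi (0 : ℝ), h v * Complex.exp v := by
      rw [← setIntegral_univ, ← Iic_union_Ioi (a := (0 : ℝ)),
        setIntegral_union (Iic_disjoint_Ioi le_rfl) measurableSet_Ioi hint.integrableOn
          hint.integrableOn]
    have hps : ∑ p ∈ Finset.Ioc 0 ⌊Real.exp V⌋₊ with p.Prime,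
        (1 : DirichletCharacter ℂ q) p * Real.log p * h (Real.log p) =
        ∑ p ∈ Finset.Ioc 0 ⌊Real.exp V⌋₊ with p.Prime, Real.log p * h (Real.log p) -
        ∑ p ∈ Finset.Ioc 0 ⌊Real.exp V⌋₊ with p.Prime ∧ p ∣ q,
          Real.log p * h (Real.log p) := by
      rw [← Finset.filter_filter, Finset.sum_filter (p := fun p => p ∣ q),
        ← Finset.sum_sub_distrib]
      refine Finset.sum_congr rfl fun p hp => ?_
      have hp' := (Finset.mem_filter.1 hp).2
      split_ifs with hpq
      · rw [MulChar.map_nonunit, zero_mul, zero_mul, sub_self]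
        rw [ZMod.isUnit_iff_coprime]
        exact fun hc => (Nat.Prime.coprime_iff_not_dvd hp').1 hc hpq
      · rw [MulChar.one_apply, one_mul, sub_zero]
        rw [ZMod.isUnit_iff_coprime]
        exact (Nat.Prime.coprime_iff_not_dvd hp').2 hpq
    have b1 : C₂ * √(∫ v : ℝ, ‖deriv h v‖ ^ 2 * Real.exp ((1 + 2 * δ) * v)) ≤
        3 * C₂ * P * (q : ℝ) ^ δ * E := by
      calc _ ≤ C₂ * (3 * P * E) := by gcongr
        _ = (3 * C₂ * P * E) * 1 := by ring
        _ ≤ (3 * C₂ * P * E) * (q : ℝ) ^ δ := by gcongr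
        _ = _ := by ring
    have b3 : (q.divisors.card : ℝ) * (V * (P * √(Real.exp V))) ≤
        C₃ / δ * P * (q : ℝ) ^ δ * E := by
      have : √(Real.exp V) ≤ Real.exp V := Real.sqrt_le_iff.2 ⟨by linarith, by nlinarith⟩
      calc _ ≤ (C₃ * (q : ℝ) ^ δ) * (V * (P * Real.exp V)) := by
            gcongr
            exact H₃ q hq0
        _ = (C₃ * (q : ℝ) ^ δ) * P * (V * Real.exp V) := by ring
        _ ≤ (C₃ * (q : ℝ) ^ δ) * P * (E / δ) := by gcongr
        _ = _ := by ring
    have b4 : P ≤ 1 * P * (q : ℝ) ^ δ * E := by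
      calc P = P * 1 * 1 := by ring
        _ ≤ P * (q : ℝ) ^ δ * E := by gcongr
        _ = _ := by ring
    rw [hps, hsplit]
    generalize ∑' n : ℕ, (ArithmeticFunction.vonMangoldt n : ℂ) * h (Real.log n) = T at e1 e2
    generalize ∑ p ∈ Finset.Ioc 0 ⌊Real.exp V⌋₊ with p.Prime, Real.log p * h (Real.log p) = U at e2 ⊢
    generalize ∑ p ∈ Finset.Ioc 0 ⌊Real.exp V⌋₊ with p.Prime ∧ p ∣ q,
          Real.log p * h (Real.log p) = W at e3 ⊢
    generalize ∫ v in Iic (0 : ℝ), h v * Complex.exp v = I₀ at e4 ⊢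
    generalize ∫ v in Ioi (0 : ℝ), h v * Complex.exp v = I₁ at e1 ⊢
    have hc1 : 0 ≤ 3 * C₁ * P * (q : ℝ) ^ δ * E := by positivity
    calc ‖U - W - (I₀ + I₁)‖ = ‖(T - I₁) - (T - U) - W - I₀‖ := by congr 1; ring
      _ ≤ ‖T - I₁‖ + ‖T - U‖ + ‖W‖ + ‖I₀‖ := by
        refine (norm_sub_le _ _).trans (add_le_add_left ?_ _)
        refine (norm_sub_le _ _).trans (add_le_add_left ?_ _)
        exact norm_sub_le _ _
      _ ≤ 3 * C₂ * P * (q : ℝ) ^ δ * E + 2 / δ * P * (q : ℝ) ^ δ * E +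
          C₃ / δ * P * (q : ℝ) ^ δ * E + 1 * P * (q : ℝ) ^ δ * E :=
        add_le_add (add_le_add (add_le_add (e1.trans b1) (e2.trans b2)) (e3.trans b3)) (e4.trans b4)
      _ ≤ 3 * C₁ * P * (q : ℝ) ^ δ * E + (3 * C₂ * P * (q : ℝ) ^ δ * E +
          2 / δ * P * (q : ℝ) ^ δ * E +
          C₃ / δ * P * (q : ℝ) ^ δ * E + 1 * P * (q : ℝ) ^ δ * E) := le_add_of_nonneg_left hc1
      _ = _ := by rw [hP]; ring
  · rw [if_neg hχ, sub_zero]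
    have e1 := H₁ q χ hχ h hd hs
    have e2 := norm_tsum_vonMangoldt_sub_sum_primes_le hV hB h0 (c := fun n => χ n)
      (fun n => χ.norm_le_one _)
    have b1 : C₁ * (q : ℝ) ^ δ * √(∫ v : ℝ, ‖deriv h v‖ ^ 2 * Real.exp ((1 + 2 * δ) * v)) ≤
        3 * C₁ * P * (q : ℝ) ^ δ * E := by
      calc _ ≤ C₁ * (q : ℝ) ^ δ * (3 * P * E) := by gcongr
        _ = _ := by ring
    generalize ∑' n : ℕ, χ n * (ArithmeticFunction.vonMangoldt n : ℂ) * h (Real.log n) = T at e1 e2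
    generalize ∑ p ∈ Finset.Ioc 0 ⌊Real.exp V⌋₊ with p.Prime,
      χ p * Real.log p * h (Real.log p) = U at e2 ⊢
    have hc1 : 0 ≤ 3 * C₂ * P * (q : ℝ) ^ δ * E + C₃ / δ * P * (q : ℝ) ^ δ * E +
      1 * P * (q : ℝ) ^ δ * E := by positivity
    calc ‖U‖ = ‖T - (T - U)‖ := by congr 1; ring
      _ ≤ ‖T‖ + ‖T - U‖ := norm_sub_le _ _
      _ ≤ 3 * C₁ * P * (q : ℝ) ^ δ * E + 2 / δ * P * (q : ℝ) ^ δ * E :=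
        add_le_add (e1.trans b1) (e2.trans b2)
      _ ≤ _ := le_add_of_nonneg_right hc1
      _ = _ := by rw [hP]; ring

end CharacterSums

end

/-! ### Expansion in Dirichlet characters -/

section

open Finset

section CharacterExpansion

variable {q : ℕ} [NeZero q]

/-- The coefficients in the expansion of a function on the reduced residues into Dirichlet
characters. -/
noncomputable def ZMod.charCoeff (f : ZMod q → ℂ) (χ : DirichletCharacter ℂ q) : ℂ :=
  (q.totient : ℂ)⁻¹ * ∑ a : (ZMod q)ˣ, f a * χ ((a : ZMod q)⁻¹)

theorem ZMod.totient_ne_zero_complex : (q.totient : ℂ) ≠ 0 := by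
  exact_mod_cast (Nat.totient_pos.2 (NeZero.pos q)).ne'

theorem ZMod.charCoeff_one (f : ZMod q → ℂ) :
    ZMod.charCoeff f 1 = (q.totient : ℂ)⁻¹ * ∑ a : (ZMod q)ˣ, f a := by
  rw [ZMod.charCoeff]
  congr 1
  refine sum_congr rfl fun a _ => ?_
  rw [ZMod.inv_coe_unit, MulChar.one_apply_coe, mul_one]

theorem ZMod.sum_charCoeff_mul (f : ZMod q → ℂ) (b : (ZMod q)ˣ) :
    ∑ χ : DirichletCharacter ℂ q, ZMod.charCoeff f χ * χ b = f b := by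
  classical
  have h : ∀ a : (ZMod q)ˣ, ∑ χ : DirichletCharacter ℂ q, χ ((a : ZMod q)⁻¹) * χ b =
      if a = b then (q.totient : ℂ) else 0 := fun a => by
    rw [DirichletCharacter.sum_char_inv_mul_char_eq ℂ a.isUnit]
    simp only [Units.ext_iff]
  simp only [ZMod.charCoeff, mul_sum, sum_mul]
  rw [sum_comm]
  calc _ = ∑ a : (ZMod q)ˣ, (q.totient : ℂ)⁻¹ * f a *
        ∑ χ : DirichletCharacter ℂ q, χ ((a : ZMod q)⁻¹) * χ b := by
        refine sum_congr rfl fun a _ => ?_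
        rw [mul_sum]
        exact sum_congr rfl fun χ _ => by ring
    _ = f b := by
        simp only [h, mul_ite, mul_zero, sum_ite_eq', mem_univ, if_true]
        field_simp [ZMod.totient_ne_zero_complex (q := q)]

theorem DirichletCharacter.star_apply_inv_unit {q : ℕ} (χ : DirichletCharacter ℂ q) (a : (ZMod q)ˣ) :
    (starRingEnd ℂ) (χ ((a : ZMod q)⁻¹)) = χ a := by
  have h : χ ((a : ZMod q)⁻¹) * χ a = 1 := by
    rw [← map_mul, ZMod.inv_coe_unit, Units.inv_mul, map_one]
  have hn : ‖χ ((a : ZMod q)⁻¹)‖ = 1 := by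
    rw [ZMod.inv_coe_unit]
    exact χ.unit_norm_eq_one _
  rw [← Complex.inv_eq_conj hn]
  exact inv_eq_of_mul_eq_one_right h

/-- Parseval on the unit group: expand one conjugated coefficient and apply the inversion formula to
the other. -/
theorem ZMod.sum_norm_charCoeff_sq (f : ZMod q → ℂ) :
    ∑ χ : DirichletCharacter ℂ q, ‖ZMod.charCoeff f χ‖ ^ 2 =
      (q.totient : ℝ)⁻¹ * ∑ a : (ZMod q)ˣ, ‖f a‖ ^ 2 := by
  have hs : ∀ χ : DirichletCharacter ℂ q,
      ((‖ZMod.charCoeff f χ‖ ^ 2 : ℝ) : ℂ) = ∑ a : (ZMod q)ˣ,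
        ((q.totient : ℂ)⁻¹ * (starRingEnd ℂ) (f a)) * (ZMod.charCoeff f χ * χ a) := fun χ => by
    push_cast
    rw [← Complex.mul_conj']
    nth_rewrite 2 [ZMod.charCoeff]
    rw [map_mul, map_sum, map_inv₀, Complex.conj_natCast, mul_sum, mul_sum]
    refine sum_congr rfl fun a _ => ?_
    rw [map_mul, DirichletCharacter.star_apply_inv_unit]
    ring
  have : ((∑ χ : DirichletCharacter ℂ q, ‖ZMod.charCoeff f χ‖ ^ 2 : ℝ) : ℂ) =
      (((q.totient : ℝ)⁻¹ * ∑ a : (ZMod q)ˣ, ‖f a‖ ^ 2 : ℝ) : ℂ) := by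
    rw [Complex.ofReal_sum, sum_congr rfl fun χ _ => hs χ, sum_comm]
    push_cast
    rw [mul_sum]
    refine sum_congr rfl fun a _ => ?_
    rw [← mul_sum, ZMod.sum_charCoeff_mul, ← Complex.conj_mul', mul_assoc]
  exact_mod_cast this

/-- Cauchy–Schwarz over the φ(q) characters; the factor φ(q) cancels the one in Parseval. -/
theorem ZMod.sq_sum_norm_charCoeff_le (f : ZMod q → ℂ) :
    (∑ χ : DirichletCharacter ℂ q, ‖ZMod.charCoeff f χ‖) ^ 2 ≤ ∑ a : (ZMod q)ˣ, ‖f a‖ ^ 2 := by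
  have h0 : (0 : ℝ) < q.totient := by exact_mod_cast Nat.totient_pos.2 (NeZero.pos q)
  refine sq_sum_le_card_mul_sum_sq.trans (le_of_eq ?_)
  rw [ZMod.sum_norm_charCoeff_sq, card_univ, ← Nat.card_eq_fintype_card,
    DirichletCharacter.card_eq_totient_of_hasEnoughRootsOfUnity, ← mul_assoc,
    mul_inv_cancel₀ h0.ne', one_mul]

/-- A second Cauchy–Schwarz separates the two factors, so that only moments of single Kloosterman
sums are needed. -/
theorem ZMod.sum_norm_charCoeff_mul_pow_four_le (f₁ f₂ : ZMod q → ℂ) :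
    (∑ χ : DirichletCharacter ℂ q, ‖ZMod.charCoeff (fun a => f₁ a * f₂ a) χ‖) ^ 4 ≤
      (∑ a : ZMod q, ‖f₁ a‖ ^ 4) * ∑ a : ZMod q, ‖f₂ a‖ ^ 4 := by
  have hu : ∀ f : ZMod q → ℂ, ∑ a : (ZMod q)ˣ, ‖f a‖ ^ 4 ≤ ∑ a : ZMod q, ‖f a‖ ^ 4 := fun f => by
    have := sum_map univ (⟨fun a : (ZMod q)ˣ => (a : ZMod q), Units.val_injective⟩ :
      (ZMod q)ˣ ↪ ZMod q) (fun a => ‖f a‖ ^ 4)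
    simp only [Function.Embedding.coeFn_mk] at this
    rw [← this]
    exact sum_le_sum_of_subset_of_nonneg (subset_univ _) fun _ _ _ => by positivity
  calc _ = ((∑ χ : DirichletCharacter ℂ q, ‖ZMod.charCoeff (fun a => f₁ a * f₂ a) χ‖) ^ 2) ^ 2 := by
        ring
    _ ≤ (∑ a : (ZMod q)ˣ, ‖f₁ a * f₂ a‖ ^ 2) ^ 2 :=
        pow_le_pow_left₀ (by positivity) (ZMod.sq_sum_norm_charCoeff_le _) 2
    _ = (∑ a : (ZMod q)ˣ, ‖f₁ a‖ ^ 2 * ‖f₂ a‖ ^ 2) ^ 2 := by simp only [norm_mul, mul_pow]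
    _ ≤ (∑ a : (ZMod q)ˣ, (‖f₁ a‖ ^ 2) ^ 2) * ∑ a : (ZMod q)ˣ, (‖f₂ a‖ ^ 2) ^ 2 :=
        sum_mul_sq_le_sq_mul_sq _ _ _
    _ = (∑ a : (ZMod q)ˣ, ‖f₁ a‖ ^ 4) * ∑ a : (ZMod q)ˣ, ‖f₂ a‖ ^ 4 := by simp only [← pow_mul]
    _ ≤ _ := mul_le_mul (hu f₁) (hu f₂) (sum_nonneg fun _ _ => by positivity)
        (sum_nonneg fun _ _ => by positivity)

-- All characters vanish at primes dividing q while f need not, so these primes enter separately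
-- through E'. The rest costs ∑|coefficient| times the worst error of a single character.
open Classical in
theorem ZMod.norm_sum_sub_charCoeff_le (f : ZMod q → ℂ) (S : Finset ℕ) (hS : ∀ p ∈ S, p.Prime)
    (w : ℕ → ℂ) (T : ℂ) {D E E' : ℝ} (hD : ∑ χ : DirichletCharacter ℂ q, ‖ZMod.charCoeff f χ‖ ≤ D)
    (hE0 : 0 ≤ E)
    (hE : ∀ χ : DirichletCharacter ℂ q, ‖∑ p ∈ S, χ p * w p - if χ = 1 then T else 0‖ ≤ E)
    (hE' : ‖∑ p ∈ S with p ∣ q, f p * w p‖ ≤ E') :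
    ‖∑ p ∈ S, f p * w p - ZMod.charCoeff f 1 * T‖ ≤ D * E + E' := by
  have hexp : ∑ p ∈ S, f p * w p = ∑ p ∈ S with p ∣ q, f p * w p +
      ∑ χ : DirichletCharacter ℂ q, ZMod.charCoeff f χ * ∑ p ∈ S, χ p * w p := by
    rw [← sum_filter_add_sum_filter_not S (· ∣ q)]
    congr 1
    simp only [mul_sum]
    rw [sum_comm, sum_filter]
    refine sum_congr rfl fun p hp => ?_
    have hcop := Nat.Prime.coprime_iff_not_dvd (n := q) (hS p hp)
    split_ifs with hpq
    · refine (sum_eq_zero fun χ _ => ?_).symm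
      rw [MulChar.map_nonunit, zero_mul, mul_zero]
      rw [ZMod.isUnit_iff_coprime, hcop]
      exact not_not.2 hpq
    · have := ZMod.sum_charCoeff_mul f (ZMod.unitOfCoprime p (hcop.2 hpq))
      rw [ZMod.coe_unitOfCoprime] at this
      rw [← this, sum_mul]
      exact sum_congr rfl fun χ _ => by ring
  have hT : ZMod.charCoeff f 1 * T =
      ∑ χ : DirichletCharacter ℂ q, ZMod.charCoeff f χ * if χ = 1 then T else 0 := by
    simp
  rw [hexp, hT, add_sub_assoc, ← sum_sub_distrib, add_comm]
  refine (norm_add_le _ _).trans (add_le_add ?_ hE')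
  calc _ ≤ ∑ χ : DirichletCharacter ℂ q, ‖ZMod.charCoeff f χ‖ * E := by
        refine norm_sum_le_of_le _ fun χ _ => ?_
        rw [← mul_sub, norm_mul]
        exact mul_le_mul_of_nonneg_left (hE χ) (norm_nonneg _)
    _ ≤ D * E := by
        rw [← sum_mul]
        exact mul_le_mul_of_nonneg_right hD hE0

end CharacterExpansion

/-! ### Size of the product of Kloosterman sums and of its character coefficients -/

section KloostermanBounds

/-- Evaluate ∑_{x,y} F(f(x) + y) in both orders; it transfers moments from modulus q to a multiple
of q. -/
theorem Fintype.card_mul_sum_comp_surjective {G H : Type*} [AddCommGroup G] [AddCommGroup H]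
    [Fintype G] [Fintype H] (f : G →+ H) (hf : Function.Surjective f) (F : H → ℝ) :
    (Fintype.card H : ℝ) * ∑ x, F (f x) = Fintype.card G * ∑ y, F y := by
  have h1 : ∀ x, ∑ y, F (f x + y) = ∑ y, F y := fun x =>
    Fintype.sum_equiv (Equiv.addLeft (f x)) _ _ fun _ => rfl
  have h2 : ∀ y, ∑ x, F (f x + y) = ∑ x, F (f x) := fun y => by
    obtain ⟨x₀, rfl⟩ := hf y
    exact Fintype.sum_equiv (Equiv.addRight x₀) _ _ fun _ => by simp
  have h3 : ∑ x, ∑ y, F (f x + y) = ∑ y, ∑ x, F (f x + y) := sum_comm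
  simp only [h1, h2, sum_const, card_univ, nsmul_eq_mul] at h3
  exact h3.symm

theorem ZMod.gcd_val_natCast_le {q m : ℕ} [NeZero q] (hm : 0 < m) :
    Nat.gcd (m : ZMod q).val q ≤ m := by
  rw [ZMod.val_natCast, (Nat.mod_modEq m q).gcd_eq]
  exact Nat.gcd_le_left _ hm

theorem ZMod.sum_norm_kloosterman_natCast_pow_four_le {q m : ℕ} [NeZero q] (hm : 0 < m) :
    ∑ n : ZMod q, ‖ZMod.kloosterman (m : ZMod q) n‖ ^ 4 ≤
      2 * (m : ℝ) * (q : ℝ) ^ 3 * (q.divisors.card : ℝ) ^ 3 := by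
  refine (ZMod.sum_norm_kloosterman_pow_four_le_gcd _).trans ?_
  have : (Nat.gcd (m : ZMod q).val q : ℝ) ≤ m := by exact_mod_cast ZMod.gcd_val_natCast_le hm
  gcongr

theorem ZMod.sum_norm_kloosterman_castHom_pow_four_le {n q e m : ℕ} [NeZero q] [NeZero n]
    (hm : 0 < m) (hn : n = e * q) (h : q ∣ n) :
    ∑ a : ZMod n, ‖ZMod.kloosterman (m : ZMod q) (ZMod.castHom h (ZMod q) a)‖ ^ 4 ≤
      e * (2 * (m : ℝ) * (q : ℝ) ^ 3 * (q.divisors.card : ℝ) ^ 3) := by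
  have h1 := Fintype.card_mul_sum_comp_surjective (ZMod.castHom h (ZMod q)).toAddMonoidHom
    (ZMod.castHom_surjective h) (fun a => ‖ZMod.kloosterman (m : ZMod q) a‖ ^ 4)
  have hq : (0 : ℝ) < q := by exact_mod_cast NeZero.pos q
  have hnR : (n : ℝ) = e * q := by exact_mod_cast hn
  rw [ZMod.card, ZMod.card, hnR] at h1
  have h2 : ∑ a : ZMod n, ‖ZMod.kloosterman (m : ZMod q) (ZMod.castHom h (ZMod q) a)‖ ^ 4 =
      e * ∑ a : ZMod q, ‖ZMod.kloosterman (m : ZMod q) a‖ ^ 4 := by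
    refine mul_left_cancel₀ hq.ne' (h1.trans ?_)
    ring
  rw [h2]
  exact mul_le_mul_of_nonneg_left (ZMod.sum_norm_kloosterman_natCast_pow_four_le hm) (by positivity)

variable (d₁ d₂ Q : ℕ) [NeZero d₁] [NeZero d₂] [NeZero Q]

/-- The product of the Kloosterman sums of moduli `d₁ Q` and `d₂ Q`, as a function modulo
`d₁ d₂ Q`. -/
noncomputable def kloostermanProduct (m₁ m₂ : ℤ) (a : ZMod (d₁ * d₂ * Q)) : ℂ :=
  ZMod.kloosterman (q := d₁ * Q) m₁ (ZMod.castHom ⟨d₂, by ring⟩ (ZMod (d₁ * Q)) a) *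
    ZMod.kloosterman (q := d₂ * Q) m₂ (ZMod.castHom ⟨d₁, by ring⟩ (ZMod (d₂ * Q)) a)

theorem kloostermanProduct_natCast (m₁ m₂ : ℤ) (n : ℕ) :
    kloostermanProduct d₁ d₂ Q m₁ m₂ n =
      kloostermanSum m₁ n (d₁ * Q) * kloostermanSum m₂ n (d₂ * Q) := by
  rw [kloostermanProduct, kloostermanSum_eq, kloostermanSum_eq, map_natCast, map_natCast,
    Int.cast_natCast, Int.cast_natCast]

variable {d₁ d₂ Q}

theorem sum_norm_charCoeff_kloostermanProduct_le {m₁ m₂ : ℕ} (hm₁ : 0 < m₁) (hm₂ : 0 < m₂)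
    {D : ℝ} (hD0 : 0 ≤ D)
    (hD : 4 * ((m₁ : ℝ) * m₂) * (d₁ * d₂) * ((d₁ * Q : ℕ) * (d₂ * Q : ℕ)) ^ 3 *
      ((d₁ * Q).divisors.card * (d₂ * Q).divisors.card) ^ 3 ≤ D ^ 4) :
    ∑ χ : DirichletCharacter ℂ (d₁ * d₂ * Q),
      ‖ZMod.charCoeff (kloostermanProduct d₁ d₂ Q m₁ m₂) χ‖ ≤ D := by
  have h := ZMod.sum_norm_charCoeff_mul_pow_four_le (q := d₁ * d₂ * Q)
    (fun a => ZMod.kloosterman (q := d₁ * Q) m₁ (ZMod.castHom ⟨d₂, by ring⟩ (ZMod (d₁ * Q)) a))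
    (fun a => ZMod.kloosterman (q := d₂ * Q) m₂ (ZMod.castHom ⟨d₁, by ring⟩ (ZMod (d₂ * Q)) a))
  have b1 := ZMod.sum_norm_kloosterman_castHom_pow_four_le (n := d₁ * d₂ * Q) (q := d₁ * Q)
    (e := d₂) hm₁ (by ring) ⟨d₂, by ring⟩
  have b2 := ZMod.sum_norm_kloosterman_castHom_pow_four_le (n := d₁ * d₂ * Q) (q := d₂ * Q)
    (e := d₁) hm₂ (by ring) ⟨d₁, by ring⟩
  refine le_of_pow_le_pow_left₀ four_ne_zero hD0 ?_
  unfold kloostermanProduct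
  simp only [Int.cast_natCast]
  refine h.trans ((mul_le_mul b1 b2 (sum_nonneg fun _ _ => by positivity)
    (by positivity)).trans (le_trans (le_of_eq ?_) hD))
  ring

/-- A single value is bounded by the whole fourth moment. This is crude, but it is needed only at
primes dividing the modulus. -/
theorem norm_kloostermanProduct_le {m₁ m₂ : ℕ} (hm₁ : 0 < m₁) (hm₂ : 0 < m₂)
    {D : ℝ} (hD0 : 0 ≤ D)
    (hD : 4 * ((m₁ : ℝ) * m₂) * (d₁ * d₂) * ((d₁ * Q : ℕ) * (d₂ * Q : ℕ)) ^ 3 *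
      ((d₁ * Q).divisors.card * (d₂ * Q).divisors.card) ^ 3 ≤ D ^ 4) (a : ZMod (d₁ * d₂ * Q)) :
    ‖kloostermanProduct d₁ d₂ Q m₁ m₂ a‖ ≤ D := by
  have hb : ∀ {q m : ℕ} [NeZero q] (_ : 0 < m) (n : ZMod q),
      ‖ZMod.kloosterman (m : ZMod q) n‖ ^ 4 ≤
        2 * (m : ℝ) * (q : ℝ) ^ 3 * (q.divisors.card : ℝ) ^ 3 := fun {q m} _ hm n =>
    (single_le_sum (f := fun n : ZMod q => ‖ZMod.kloosterman (m : ZMod q) n‖ ^ 4)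
      (fun _ _ => by positivity) (mem_univ n)).trans
      (ZMod.sum_norm_kloosterman_natCast_pow_four_le hm)
  have h1 : (1 : ℝ) ≤ d₁ * d₂ := by
    exact_mod_cast Nat.one_le_iff_ne_zero.2 (mul_ne_zero (NeZero.ne d₁) (NeZero.ne d₂))
  refine le_of_pow_le_pow_left₀ four_ne_zero hD0 ?_
  unfold kloostermanProduct
  simp only [Int.cast_natCast]
  rw [norm_mul, mul_pow]
  refine (mul_le_mul (hb hm₁ _) (hb hm₂ _) (by positivity) (by positivity)).trans
    (le_trans ?_ hD)
  set P := ((m₁ : ℝ) * m₂) * ((d₁ * Q : ℕ) * (d₂ * Q : ℕ)) ^ 3 *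
      ((d₁ * Q).divisors.card * (d₂ * Q).divisors.card) ^ 3 with hP
  have hP0 : 0 ≤ P := by positivity
  calc _ = 4 * P * 1 := by rw [hP]; ring
    _ ≤ 4 * P * (d₁ * d₂) := by gcongr
    _ = _ := by rw [hP]; ring

end KloostermanBounds

end

/-! ### Q*, I and the main coefficient in logarithmic form -/

section

open MeasureTheory Set Filter Topology
open scoped ContDiff

section Assembly

theorem rsConductor_eq_mul (k₁ k₂ N : ℕ) :
    rsConductor k₁ k₂ N = rsConductor k₁ k₂ 1 * (N : ℝ) ^ 2 := by
  unfold rsConductor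
  split_ifs <;> simp

theorem four_le_rsConductor_one {k₁ k₂ : ℕ} (hk₁ : 2 ≤ k₁) (hk₂ : 2 ≤ k₂) :
    4 ≤ rsConductor k₁ k₂ 1 := by
  have h1 : (2 : ℝ) ≤ k₁ := by exact_mod_cast hk₁
  have h2 : (2 : ℝ) ≤ k₂ := by exact_mod_cast hk₂
  unfold rsConductor
  split_ifs with h
  · simp only [Nat.cast_one, one_pow, mul_one]
    nlinarith
  · simp only [Nat.cast_one, one_pow, mul_one]
    have h3 : (1 : ℝ) ≤ ((k₁ : ℝ) - k₂) ^ 2 := by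
      have : (1 : ℤ) ≤ ((k₁ : ℤ) - k₂) ^ 2 := by
        have : ((k₁ : ℤ) - k₂) ≠ 0 := by omega
        have := sq_pos_of_ne_zero this
        omega
      exact_mod_cast this
    nlinarith

theorem one_le_log_rsConductor {k₁ k₂ N : ℕ} (hk₁ : 2 ≤ k₁) (hk₂ : 2 ≤ k₂) (hN : 1 ≤ N) :
    1 ≤ Real.log (rsConductor k₁ k₂ N) := by
  have h1 := four_le_rsConductor_one hk₁ hk₂
  have hN' : (1 : ℝ) ≤ N := by exact_mod_cast hN
  have h4 : 4 ≤ rsConductor k₁ k₂ N := by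
    rw [rsConductor_eq_mul]
    nlinarith
  rw [Real.le_log_iff_exp_le (by linarith)]
  linarith [Real.exp_one_lt_d9]

variable {k₁ k₂ : ℕ} {φ : SchwartzMap ℝ ℂ} {σ : ℝ}

/-- The support of φ̂ cuts the sum at p ≤ e^{σL} = R^σ, and 1/√p is the factor e^{-v/2} of the
weight at v = log p. -/
theorem Qstar_eq_sum (hsupp : tsupport (𝓕 (φ : ℝ → ℂ)) ⊆ Ioo (-σ) σ)
    (m₁ b₁ m₂ b₂ N : ℕ) (hL : 0 < Real.log (rsConductor k₁ k₂ N)) :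
    Qstar k₁ k₂ φ m₁ b₁ m₂ b₂ N = (2 / Real.log (rsConductor k₁ k₂ N) : ℂ) *
      ∑ p ∈ Finset.Ioc 0 ⌊Real.exp (σ * Real.log (rsConductor k₁ k₂ N))⌋₊ with p.Prime,
        kloostermanSum ((m₁ : ℤ) ^ 2) p (b₁ * N) * kloostermanSum ((m₂ : ℤ) ^ 2) p (b₂ * N) *
        (Real.log p * logWeight (k₁ - 1) (k₂ - 1) (4 * Real.pi * m₁ / (b₁ * N))
          (4 * Real.pi * m₂ / (b₂ * N)) (Real.log (rsConductor k₁ k₂ N)) (𝓕 (φ : ℝ → ℂ))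
          (Real.log p)) := by
  unfold Qstar
  set L := Real.log (rsConductor k₁ k₂ N) with hLdef
  set h := logWeight (k₁ - 1) (k₂ - 1) (4 * Real.pi * m₁ / (b₁ * N))
          (4 * Real.pi * m₂ / (b₂ * N)) L (𝓕 (φ : ℝ → ℂ)) with hh
  set F : ℕ → ℂ := fun p => (2 / L : ℂ) *
    (kloostermanSum ((m₁ : ℤ) ^ 2) p (b₁ * N) * kloostermanSum ((m₂ : ℤ) ^ 2) p (b₂ * N) *
        (Real.log p * h (Real.log p))) with hF
  have hterm : ∀ p : Nat.Primes,
    kloostermanSum ((m₁ : ℤ) ^ 2) ((p : ℕ) : ℤ) (b₁ * N) *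
    kloostermanSum ((m₂ : ℤ) ^ 2) ((p : ℕ) : ℤ) (b₂ * N) *
    ((besselJ (k₁ - 1) (4 * Real.pi * (m₁ : ℝ) * √((p : ℕ) : ℝ) / ((b₁ : ℝ) * (N : ℝ))) : ℝ) : ℂ) *
    ((besselJ (k₂ - 1) (4 * Real.pi * (m₂ : ℝ) * √((p : ℕ) : ℝ) / ((b₂ : ℝ) * (N : ℝ))) : ℝ) : ℂ) *
    ((2 * Real.log ((p : ℕ) : ℝ) / (√((p : ℕ) : ℝ) * L) : ℝ) : ℂ) *
    𝓕 (φ : ℝ → ℂ) (Real.log ((p : ℕ) : ℝ) / L) = F p := by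
    intro p
    have hp : (0 : ℝ) < (p : ℕ) := by exact_mod_cast p.2.pos
    have he : Real.exp (Real.log (p : ℕ) / 2) = √((p : ℕ) : ℝ) := by
      rw [Real.exp_half, Real.exp_log hp]
    simp only [hF, hh, logWeight, besselWeight, Real.exp_neg, he]
    rw [show 4 * Real.pi * (m₁ : ℝ) * √((p : ℕ) : ℝ) / ((b₁ : ℝ) * (N : ℝ)) =
        4 * Real.pi * m₁ / (b₁ * N) * √((p : ℕ) : ℝ) by ring,
      show 4 * Real.pi * (m₂ : ℝ) * √((p : ℕ) : ℝ) / ((b₂ : ℝ) * (N : ℝ)) =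
        4 * Real.pi * m₂ / (b₂ * N) * √((p : ℕ) : ℝ) by ring]
    push_cast
    ring
  rw [tsum_congr hterm, Finset.mul_sum]
  have hsub : ∑' p : Nat.Primes, F p = ∑' n : ℕ, indicator {p : ℕ | p.Prime} F n :=
    tsum_subtype {p : ℕ | p.Prime} F
  rw [hsub, tsum_eq_sum (s := Finset.Ioc 0 ⌊Real.exp (σ * L)⌋₊), Finset.sum_filter]
  · exact Finset.sum_congr rfl fun p _ => by
      simp only [indicator_apply, mem_ofPred_eq, hF]
  · intro n hn
    rcases Nat.eq_zero_or_pos n with rfl | hn0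
    · simp [Nat.not_prime_zero]
    rw [Finset.mem_Ioc, not_and, not_le, Nat.floor_lt (Real.exp_pos _).le] at hn
    have hv : σ * L ≤ Real.log n :=
      (Real.le_log_iff_exp_le (by exact_mod_cast hn0)).2 (hn hn0).le
    have h0 : h (Real.log n) = 0 := logWeight_eq_zero hL hsupp (hv.trans (le_abs_self _))
    simp [indicator_apply, hF, h0]

theorem besselIntegral_eq (b₁ b₂ m₁ m₂ N : ℕ) :
    besselIntegral k₁ k₂ φ b₁ b₂ m₁ m₂ N = 1 / (2 * Real.log (rsConductor k₁ k₂ N)) *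
      ∫ v : ℝ, logWeight (k₁ - 1) (k₂ - 1) (4 * Real.pi * m₁ / (b₁ * N))
          (4 * Real.pi * m₂ / (b₂ * N)) (Real.log (rsConductor k₁ k₂ N)) (𝓕 (φ : ℝ → ℂ)) v *
        Complex.exp v := by
  rw [← integral_Ioi_eq_integral_logWeight, besselIntegral]
  refine integral_congr_ae (Eventually.of_forall fun y => ?_)
  simp only
  rw [show 4 * Real.pi * (m₁ : ℝ) * y / ((b₁ : ℝ) * (N : ℝ)) =
        4 * Real.pi * m₁ / (b₁ * N) * y by ring,
      show 4 * Real.pi * (m₂ : ℝ) * y / ((b₂ : ℝ) * (N : ℝ)) =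
        4 * Real.pi * m₂ / (b₂ * N) * y by ring]

/-- Since N is prime to d₁d₂, the coprimality of d₁d₂ to rN is that of d₁d₂ to r, which is what the
principal character modulo d₁d₂ detects. -/
theorem charCoeff_kloostermanProduct_one {d₁ d₂ r N : ℕ} [NeZero d₁] [NeZero d₂] [NeZero r]
    [NeZero N] (hd : d₁.Coprime d₂) (hN : (d₁ * d₂).Coprime N) (m₁ m₂ : ℤ) :
    ZMod.charCoeff (kloostermanProduct d₁ d₂ (r * N) m₁ m₂) 1 =
      psiSum (m₁ * (d₂ : ℤ) ^ 2) (m₂ * (d₁ : ℤ) ^ 2) (N * r) /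
          ((Nat.totient (d₁ * d₂ * r * N) : ℕ) : ℂ) *
        ramanujanSum m₁ d₁ * ramanujanSum m₂ d₂ *
        ((ArithmeticFunction.moebius (d₁ * d₂) : ℤ) : ℂ) *
        (1 : DirichletCharacter ℂ (d₁ * d₂)) (r : ZMod (d₁ * d₂)) := by
  rw [ZMod.charCoeff_one, mul_assoc (d₁ * d₂) r N, mul_comm N r]
  simp only [kloostermanProduct]
  by_cases hc : (d₁ * d₂).Coprime r
  · rw [sum_kloosterman_mul_kloosterman_of_coprime hd (hc.mul_right hN), MulChar.one_apply]
    · ring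
    · exact (ZMod.isUnit_iff_coprime _ _).2 hc.symm
  · rw [sum_kloosterman_mul_kloosterman_of_not_coprime hd
      (fun h => hc (h.coprime_dvd_right (dvd_mul_right _ _))), MulChar.map_nonunit]
    · ring
    · rw [ZMod.isUnit_iff_coprime]
      exact fun h => hc h.symm

end Assembly

end

/-! ### Numerical bounds and conclusion -/

section

open MeasureTheory Set Filter Topology
open scoped ContDiff

section MainTheorem

/-- On taking fourth roots, N⁶ becomes N^{3/2}. The other factors are rounded up: d₁d₂ ≤ b₁b₂,
(m₁m₂)² ≤ (m₁m₂)⁴, and the cube of the divisor counts is at most s⁴ because s ≥ 1. -/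
theorem kloosterman_fourth_moment_numerics {δ C : ℝ} (hC : 1 ≤ C) (hδ : 0 < δ)
    (hτ : ∀ n : ℕ, n ≠ 0 → (n.divisors.card : ℝ) ≤ C * (n : ℝ) ^ δ)
    {d₁ d₂ r N m₁ m₂ : ℕ} (hd₁ : 0 < d₁) (hd₂ : 0 < d₂) (hr : 0 < r) (hN : 0 < N) (hm₁ : 0 < m₁)
    (hm₂ : 0 < m₂) {b₁ b₂ : ℕ} (hb₁ : b₁ = d₁ * r) (hb₂ : b₂ = d₂ * r) :
    4 * (((m₁ ^ 2 : ℕ) : ℝ) * (m₂ ^ 2 : ℕ)) * (d₁ * d₂) *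
        ((d₁ * (r * N) : ℕ) * (d₂ * (r * N) : ℕ)) ^ 3 *
      ((d₁ * (r * N)).divisors.card * (d₂ * (r * N)).divisors.card) ^ 3 ≤
    (2 * (m₁ * m₂) * (b₁ * b₂) * (N * √N) * (C ^ 2 * ((b₁ * b₂) * (N : ℝ) ^ 2) ^ δ)) ^ 4 := by
  have hB₁ : d₁ * (r * N) = b₁ * N := by rw [hb₁, mul_assoc]
  have hB₂ : d₂ * (r * N) = b₂ * N := by rw [hb₂, mul_assoc]
  have hb₁0 : 0 < b₁ := by rw [hb₁]; positivity
  have hb₂0 : 0 < b₂ := by rw [hb₂]; positivity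
  rw [hB₁, hB₂]
  have hr1 : (1 : ℝ) ≤ r := by exact_mod_cast hr
  have hN1 : (1 : ℝ) ≤ N := by exact_mod_cast hN
  have hb₁1 : (1 : ℝ) ≤ b₁ := by exact_mod_cast hb₁0
  have hb₂1 : (1 : ℝ) ≤ b₂ := by exact_mod_cast hb₂0
  have hdb : (d₁ : ℝ) * d₂ ≤ b₁ * b₂ := by
    rw [hb₁, hb₂]
    exact_mod_cast Nat.mul_le_mul (Nat.le_mul_of_pos_right _ hr) (Nat.le_mul_of_pos_right _ hr)
  set s := C ^ 2 * ((b₁ * b₂) * (N : ℝ) ^ 2) ^ δ with hs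
  have hs1 : 1 ≤ s := by
    refine one_le_mul_of_one_le_of_one_le (one_le_pow₀ hC) (Real.one_le_rpow ?_ hδ.le)
    exact one_le_mul_of_one_le_of_one_le (one_le_mul_of_one_le_of_one_le hb₁1 hb₂1)
      (one_le_pow₀ hN1)
  have ht : ((b₁ * N).divisors.card : ℝ) * (b₂ * N).divisors.card ≤ s := by
    calc _ ≤ (C * ((b₁ * N : ℕ) : ℝ) ^ δ) * (C * ((b₂ * N : ℕ) : ℝ) ^ δ) := by
          gcongr
          · exact hτ _ (by positivity)
          · exact hτ _ (by positivity)
      _ = C ^ 2 * (((b₁ * N : ℕ) : ℝ) ^ δ * ((b₂ * N : ℕ) : ℝ) ^ δ) := by ring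
      _ = s := by
        rw [← Real.mul_rpow (by positivity) (by positivity), hs]
        push_cast
        congr 2
        ring
  have hsqrt : √(N : ℝ) ^ 4 = (N : ℝ) ^ 2 := by
    rw [show √(N : ℝ) ^ 4 = (√(N : ℝ) ^ 2) ^ 2 by ring, Real.sq_sqrt (by positivity)]
  have hm₁1 : (1 : ℝ) ≤ m₁ := by exact_mod_cast hm₁
  have hm₂1 : (1 : ℝ) ≤ m₂ := by exact_mod_cast hm₂
  have hM1 : (1 : ℝ) ≤ m₁ * m₂ := one_le_mul_of_one_le_of_one_le hm₁1 hm₂1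
  set M := (m₁ : ℝ) * m₂ with hM
  set b := (b₁ : ℝ) * b₂ with hb
  have hb0 : 0 ≤ b := by positivity
  calc _ = 4 * M ^ 2 * ((d₁ : ℝ) * d₂) * (b ^ 3 * (N : ℝ) ^ 6) *
        (((b₁ * N).divisors.card : ℝ) * (b₂ * N).divisors.card) ^ 3 := by
        rw [hM, hb]; push_cast; ring
    _ ≤ 16 * M ^ 4 * b * (b ^ 3 * (N : ℝ) ^ 6) * s ^ 4 := by
        have : M ^ 2 ≤ M ^ 4 := pow_le_pow_right₀ hM1 (by norm_num)
        have h3 : (((b₁ * N).divisors.card : ℝ) * (b₂ * N).divisors.card) ^ 3 ≤ s ^ 4 :=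
          (pow_le_pow_left₀ (by positivity) ht 3).trans (pow_le_pow_right₀ hs1 (by norm_num))
        have h4 : 4 * M ^ 2 ≤ 16 * M ^ 4 := by nlinarith [sq_nonneg M]
        gcongr
    _ = (2 * M * b * (N * √N) * s) ^ 4 := by
        clear_value M b s
        rw [show (2 * M * b * (N * √N) * s) ^ 4 = 16 * M ^ 4 * b ^ 4 * N ^ 4 * √N ^ 4 * s ^ 4 by
          ring, hsqrt]
        ring

theorem mul_sqrt_exp_le {δ V : ℝ} (hδ : 0 < δ) (hV : 0 ≤ V) :
    V * √(Real.exp V) ≤ Real.exp ((1 + δ) * V) / δ := by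
  have h1 : √(Real.exp V) ≤ Real.exp V :=
    Real.sqrt_le_iff.2 ⟨(Real.exp_pos _).le, by nlinarith [Real.one_le_exp hV]⟩
  calc _ ≤ Real.exp (δ * V) / δ * Real.exp V :=
        mul_le_mul (le_exp_mul_div hδ V) h1 (by positivity) (by positivity)
    _ = _ := by rw [add_mul, one_mul, Real.exp_add]; ring

theorem exists_forall_norm_le_and_norm_deriv_le {g : ℝ → ℂ} (hg : ContDiff ℝ ∞ g)
    (hs : HasCompactSupport g) : ∃ A : ℝ, (∀ y, ‖g y‖ ≤ A) ∧ ∀ y, ‖deriv g y‖ ≤ A := by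
  obtain ⟨A₁, h₁⟩ := hs.exists_bound_of_continuous hg.continuous
  obtain ⟨A₂, h₂⟩ := hs.deriv.exists_bound_of_continuous (hg.continuous_deriv (by simp))
  exact ⟨max A₁ A₂, fun y => (h₁ y).trans (le_max_left _ _), fun y => (h₂ y).trans (le_max_right _ _)⟩

/-- The powers of N combine as 3/2 − 2 + 2σ = 2σ − 1/2, plus 2δ + δ + 2σδ = (2σ+3)δ ≤ ε. The main
powers of b cancel and leave b^{2δ} ≤ b^ε; m² is relaxed to m³. -/
theorem error_numerics {N b m σ δ ε c F : ℝ} (hN : 1 ≤ N) (hb : 1 ≤ b) (hm : 1 ≤ m) (hF : 0 ≤ F)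
    (hc : 0 ≤ c) (hσ : 0 < σ) (hδ : 0 < δ) (hε : (2 * σ + 3) * δ ≤ ε) (C : ℝ) :
    (2 * m * b * (N * √N) * (C ^ 2 * (b * N ^ 2) ^ δ)) *
      (F * (16 * Real.pi ^ 2 * m / (b * N ^ 2)) * (b * N) ^ δ * (c * N ^ 2) ^ (σ * (1 + δ))) ≤
    (32 * Real.pi ^ 2 * C ^ 2 * F * c ^ (σ * (1 + δ))) * m ^ 3 * N ^ (2 * σ - 1 / 2 + ε) *
      b ^ ε := by
  have hN0 : 0 < N := by linarith
  have hb0 : 0 < b := by linarith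
  have hm0 : 0 < m := by linarith
  have e1 : (b * N ^ 2) ^ δ = b ^ δ * N ^ (2 * δ) := by
    rw [Real.mul_rpow hb0.le (by positivity), ← Real.rpow_natCast, ← Real.rpow_mul hN0.le]
    norm_num
  have e2 : (b * N) ^ δ = b ^ δ * N ^ δ := Real.mul_rpow hb0.le hN0.le
  have e3 : (c * N ^ 2) ^ (σ * (1 + δ)) = c ^ (σ * (1 + δ)) * N ^ (2 * (σ * (1 + δ))) := by
    rw [Real.mul_rpow hc (by positivity), ← Real.rpow_natCast, ← Real.rpow_mul hN0.le]
    norm_num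
  have e4 : N * √N / N ^ 2 = N ^ (-(1 / 2) : ℝ) := by
    rw [Real.sqrt_eq_rpow, ← Real.rpow_one_add' hN0.le (by norm_num), ← Real.rpow_natCast,
      ← Real.rpow_sub hN0]
    norm_num
  have e5 : b ^ δ * b ^ δ ≤ b ^ ε := by
    rw [← Real.rpow_add hb0]
    exact Real.rpow_le_rpow_of_exponent_le hb (by nlinarith)
  have e6 : N ^ (-(1 / 2) : ℝ) * N ^ (2 * δ) * N ^ δ * N ^ (2 * (σ * (1 + δ))) ≤
      N ^ (2 * σ - 1 / 2 + ε) := by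
    rw [← Real.rpow_add hN0, ← Real.rpow_add hN0, ← Real.rpow_add hN0]
    exact Real.rpow_le_rpow_of_exponent_le hN (by nlinarith)
  have e7 : m ^ 2 ≤ m ^ 3 := pow_le_pow_right₀ hm (by norm_num)
  rw [e1, e2, e3]
  set G := 32 * Real.pi ^ 2 * C ^ 2 * F * c ^ (σ * (1 + δ)) with hG
  have hG0 : 0 ≤ G := by positivity
  calc _ = G * m ^ 2 * ((N * √N / N ^ 2) * N ^ (2 * δ) * N ^ δ * N ^ (2 * (σ * (1 + δ)))) *
        (b ^ δ * b ^ δ) := by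
        rw [hG]
        field_simp
        ring
    _ ≤ _ := by
        rw [e4]
        gcongr

set_option maxHeartbeats 1000000 in
theorem proposition6p1 (hGRH : GRHDirichlet)
    (k₁ k₂ : ℕ) (hk₁ : 2 ≤ k₁) (hk₂ : 2 ≤ k₂) (hk₁e : Even k₁) (hk₂e : Even k₂)
    (φ : SchwartzMap ℝ ℂ) (hφ : ∀ x : ℝ, φ (-x) = φ x)
    (σ : ℝ) (hσ : 0 < σ) (hsupp : tsupport (𝓕 (φ : ℝ → ℂ)) ⊆ Set.Ioo (-σ) σ)
    (ε : ℝ) (hε : 0 < ε) :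
    ∃ C : ℝ, ∀ N : ℕ, N.Prime → ∀ b₁ b₂ m₁ m₂ : ℕ,
      ¬ N ∣ b₁ → ¬ N ∣ b₂ → ¬ N ∣ m₁ → ¬ N ∣ m₂ →
      ∀ r d₁ d₂ : ℕ, r = Nat.gcd b₁ b₂ → b₁ = d₁ * r → b₂ = d₂ * r →
        ‖Qstar k₁ k₂ φ m₁ b₁ m₂ b₂ N -
            4 * psiSum ((m₁ : ℤ) ^ 2 * (d₂ : ℤ) ^ 2) ((m₂ : ℤ) ^ 2 * (d₁ : ℤ) ^ 2) (N * r) /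
                ((Nat.totient (d₁ * d₂ * r * N) : ℕ) : ℂ) *
              ramanujanSum ((m₁ : ℤ) ^ 2) d₁ * ramanujanSum ((m₂ : ℤ) ^ 2) d₂ *
              ((ArithmeticFunction.moebius (d₁ * d₂) : ℤ) : ℂ) *
              (1 : DirichletCharacter ℂ (d₁ * d₂)) (r : ZMod (d₁ * d₂)) *
              besselIntegral k₁ k₂ φ b₁ b₂ m₁ m₂ N‖ ≤
          C * (m₁ : ℝ) ^ 3 * (m₂ : ℝ) ^ 3 * (N : ℝ) ^ (2 * σ - 1 / 2 + ε) *
            ((b₁ : ℝ) * (b₂ : ℝ)) ^ ε := by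
  classical
  set g := 𝓕 (φ : ℝ → ℂ) with hg
  have hgd : ContDiff ℝ ∞ g := by
    rw [hg, ← SchwartzMap.fourier_coe]
    exact (𝓕 φ).smooth ⊤
  have hgs : HasCompactSupport g :=
    HasCompactSupport.of_support_subset_isCompact (isCompact_Icc (a := -σ) (b := σ))
      ((subset_tsupport g).trans (hsupp.trans Ioo_subset_Icc_self))
  obtain ⟨A, hA, hA'⟩ := exists_forall_norm_le_and_norm_deriv_le hgd hgs
  have hA0 : 0 ≤ A := (norm_nonneg _).trans (hA 0)
  -- The exponents δ accumulate to (2σ+3)δ in N; the contour shift needs δ ≤ 1.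
  set δ := min 1 (ε / (2 * σ + 3)) with hδdef
  have hδ : 0 < δ := lt_min one_pos (by positivity)
  have hδ1 : δ ≤ 1 := min_le_left _ _
  have hδε : (2 * σ + 3) * δ ≤ ε := by
    have : δ ≤ ε / (2 * σ + 3) := min_le_right _ _
    rw [le_div_iff₀ (by positivity)] at this
    linarith
  obtain ⟨C₁, hC₁, H₁⟩ :=
    hGRH.exists_norm_sum_primes_character_le hδ hδ1 hσ hgd hsupp hA hA'
  obtain ⟨C₂, hC₂, H₂⟩ := exists_card_divisors_le_rpow hδ
  set c := rsConductor k₁ k₂ 1 with hc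
  have hc4 : 4 ≤ c := four_le_rsConductor_one hk₁ hk₂
  set F := 2 * (C₁ + C₂ * A / δ) with hF
  have hF0 : 0 ≤ F := by positivity
  refine ⟨32 * Real.pi ^ 2 * C₂ ^ 2 * F * c ^ (σ * (1 + δ)), ?_⟩
  intro N hN b₁ b₂ m₁ m₂ hNb₁ hNb₂ hNm₁ hNm₂ r d₁ d₂ hr hb₁ hb₂
  -- N divides 0, so indivisibility by N already gives positivity.
  have hpos : ∀ {n : ℕ}, ¬ N ∣ n → 0 < n := fun {n} h =>
    Nat.pos_of_ne_zero (by rintro rfl; exact h (dvd_zero _))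
  have hb₁0 := hpos hNb₁
  have hb₂0 := hpos hNb₂
  have hm₁0 := hpos hNm₁
  have hm₂0 := hpos hNm₂
  have hN0 := hN.pos
  have hr0 : 0 < r := hr ▸ Nat.gcd_pos_of_pos_left _ hb₁0
  have hd₁0 : 0 < d₁ := Nat.pos_of_mul_pos_right (hb₁ ▸ hb₁0)
  have hd₂0 : 0 < d₂ := Nat.pos_of_mul_pos_right (hb₂ ▸ hb₂0)
  have : NeZero d₁ := ⟨hd₁0.ne'⟩
  have : NeZero d₂ := ⟨hd₂0.ne'⟩
  have : NeZero r := ⟨hr0.ne'⟩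
  have : NeZero N := ⟨hN0.ne'⟩
  have hd : d₁.Coprime d₂ := by
    have h : Nat.gcd (d₁ * r) (d₂ * r) = r := by rw [← hb₁, ← hb₂, ← hr]
    rw [Nat.gcd_mul_right] at h
    exact Nat.eq_of_mul_eq_mul_right hr0 (h.trans (one_mul r).symm)
  have hdN : (d₁ * d₂).Coprime N := by
    have h1 : ¬ N ∣ d₁ := fun h => hNb₁ (hb₁ ▸ h.mul_right r)
    have h2 : ¬ N ∣ d₂ := fun h => hNb₂ (hb₂ ▸ h.mul_right r)
    exact Nat.Coprime.mul_left ((Nat.Prime.coprime_iff_not_dvd hN).2 h1).symm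
      ((Nat.Prime.coprime_iff_not_dvd hN).2 h2).symm
  set L := Real.log (rsConductor k₁ k₂ N) with hL
  have hL1 : 1 ≤ L := one_le_log_rsConductor hk₁ hk₂ hN0
  have hL0 : 0 < L := by linarith
  set α := 4 * Real.pi * (m₁ : ℝ) / (b₁ * N) with hα
  set β := 4 * Real.pi * (m₂ : ℝ) / (b₂ * N) with hβ
  have hα0 : 0 ≤ α := by positivity
  have hβ0 : 0 ≤ β := by positivity
  have hn₁ : k₁ - 1 ≠ 0 := by omega
  have hn₂ : k₂ - 1 ≠ 0 := by omega
  set h := logWeight (k₁ - 1) (k₂ - 1) α β L g with hh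
  set T := ∫ v : ℝ, h v * Complex.exp v with hT
  set V := σ * L with hV
  have hV0 : 0 ≤ V := by positivity
  -- This is the least common multiple of b₁N and b₂N, since d₁ and d₂ are coprime.
  set q := d₁ * d₂ * (r * N) with hq
  have hq0 : q ≠ 0 := NeZero.ne q
  set f := kloostermanProduct d₁ d₂ (r * N) ((m₁ ^ 2 : ℕ) : ℤ) ((m₂ ^ 2 : ℕ) : ℤ) with hf
  set D := 2 * ((m₁ : ℝ) * m₂) * (b₁ * b₂) * (N * √N) *
    (C₂ ^ 2 * ((b₁ * b₂) * (N : ℝ) ^ 2) ^ δ) with hD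
  have hD0 : 0 ≤ D := by positivity
  have hDnum := kloosterman_fourth_moment_numerics hC₂ hδ H₂ hd₁0 hd₂0 hr0 hN0 hm₁0 hm₂0 hb₁ hb₂
  have hcoef : ∑ χ : DirichletCharacter ℂ q, ‖ZMod.charCoeff f χ‖ ≤ D :=
    sum_norm_charCoeff_kloostermanProduct_le (by positivity) (by positivity) hD0 hDnum
  have hfD : ∀ a, ‖f a‖ ≤ D :=
    norm_kloostermanProduct_le (by positivity) (by positivity) hD0 hDnum
  have hQ := Qstar_eq_sum (k₁ := k₁) (k₂ := k₂) hsupp m₁ b₁ m₂ b₂ N hL0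
  have hI := besselIntegral_eq (k₁ := k₁) (k₂ := k₂) (φ := φ) b₁ b₂ m₁ m₂ N
  have hM := charCoeff_kloostermanProduct_one (r := r) hd hdN ((m₁ ^ 2 : ℕ) : ℤ) ((m₂ ^ 2 : ℕ) : ℤ)
  rw [← hL, ← hα, ← hβ, ← hg, ← hh, ← hV] at hQ
  rw [← hL, ← hα, ← hβ, ← hg, ← hh, ← hT] at hI
  rw [← hf] at hM
  have hfsum : ∑ p ∈ Finset.Ioc 0 ⌊Real.exp V⌋₊ with p.Prime,
        kloostermanSum ((m₁ : ℤ) ^ 2) p (b₁ * N) * kloostermanSum ((m₂ : ℤ) ^ 2) p (b₂ * N) *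
        (Real.log p * h (Real.log p)) =
      ∑ p ∈ Finset.Ioc 0 ⌊Real.exp V⌋₊ with p.Prime, f p * (Real.log p * h (Real.log p)) := by
    refine Finset.sum_congr rfl fun p _ => ?_
    rw [hf, kloostermanProduct_natCast, hb₁, hb₂, mul_assoc d₁, mul_assoc d₂]
    push_cast
    rfl
  rw [hfsum] at hQ
  set E := C₁ * (α * β) * (q : ℝ) ^ δ * Real.exp ((1 + δ) * V) with hE
  have hchar : ∀ χ : DirichletCharacter ℂ q,
      ‖∑ p ∈ Finset.Ioc 0 ⌊Real.exp V⌋₊ with p.Prime, χ p * (Real.log p * h (Real.log p)) -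
        if χ = 1 then T else 0‖ ≤ E := fun χ => by
    have := H₁ q χ (k₁ - 1) (k₂ - 1) α β L hn₁ hn₂ hα0 hβ0 hL1
    simp only [mul_assoc] at this ⊢
    rw [hE]
    simp only [mul_assoc]
    exact this
  have hdvd := norm_sum_primes_dvd_le (h := h) hV0
    (norm_logWeight_le (L := L) hn₁ hn₂ hα0 hβ0 hA) hq0 (c := fun n => f n) (fun n => hfD n)
  rw [← Finset.filter_filter] at hdvd
  simp only [mul_assoc (f _)] at hdvd
  have hmain := ZMod.norm_sum_sub_charCoeff_le f _
    (fun p hp => (Finset.mem_filter.1 hp).2) (fun p => (Real.log p : ℂ) * h (Real.log p)) T hcoef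
    (by positivity) hchar hdvd
  -- The constant 4 arises from I = T/(2L): the principal character contributes (2/L)T = 4I times
  -- its coefficient.
  have hlhs : Qstar k₁ k₂ φ m₁ b₁ m₂ b₂ N -
            4 * psiSum ((m₁ : ℤ) ^ 2 * (d₂ : ℤ) ^ 2) ((m₂ : ℤ) ^ 2 * (d₁ : ℤ) ^ 2) (N * r) /
                ((Nat.totient (d₁ * d₂ * r * N) : ℕ) : ℂ) *
              ramanujanSum ((m₁ : ℤ) ^ 2) d₁ * ramanujanSum ((m₂ : ℤ) ^ 2) d₂ *
              ((ArithmeticFunction.moebius (d₁ * d₂) : ℤ) : ℂ) *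
              (1 : DirichletCharacter ℂ (d₁ * d₂)) (r : ZMod (d₁ * d₂)) *
              besselIntegral k₁ k₂ φ b₁ b₂ m₁ m₂ N =
      (2 / L : ℂ) * (∑ p ∈ Finset.Ioc 0 ⌊Real.exp V⌋₊ with p.Prime,
        f p * (Real.log p * h (Real.log p)) - ZMod.charCoeff f 1 * T) := by
    rw [hQ, hI, hM]
    push_cast
    ring
  rw [hlhs, norm_mul]
  have h2L : ‖(2 / L : ℂ)‖ ≤ 2 := by
    rw [norm_div, Complex.norm_real, Real.norm_of_nonneg hL0.le, Complex.norm_ofNat]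
    exact div_le_self (by norm_num) hL1
  -- V = σ log R and R = cN², with c depending only on the weights.
  have hR : Real.exp ((1 + δ) * V) = (c * (N : ℝ) ^ 2) ^ (σ * (1 + δ)) := by
    have hR0 : 0 < c * (N : ℝ) ^ 2 := by positivity
    rw [Real.rpow_def_of_pos hR0, hV, hL, rsConductor_eq_mul]
    congr 1
    ring
  have hN1 : (1 : ℝ) ≤ N := by exact_mod_cast hN0
  have hb1 : (1 : ℝ) ≤ (b₁ : ℝ) * b₂ := by exact_mod_cast Nat.mul_pos hb₁0 hb₂0
  have hm1 : (1 : ℝ) ≤ (m₁ : ℝ) * m₂ := by exact_mod_cast Nat.mul_pos hm₁0 hm₂0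
  have hqb : (q : ℝ) ≤ (b₁ : ℝ) * b₂ * N := by
    have : q ≤ b₁ * b₂ * N := by
      rw [hq, hb₁, hb₂]
      calc d₁ * d₂ * (r * N) = (d₁ * d₂ * r * N) * 1 := by ring
        _ ≤ (d₁ * d₂ * r * N) * r := Nat.mul_le_mul_left _ hr0
        _ = _ := by ring
    exact_mod_cast this
  have hαβ : α * β = 16 * Real.pi ^ 2 * ((m₁ : ℝ) * m₂) / ((b₁ * b₂) * (N : ℝ) ^ 2) := by
    rw [hα, hβ]
    field_simp
    ring
  have hVX := mul_sqrt_exp_le hδ hV0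
  calc _ ≤ 2 * (D * E + q.divisors.card * (D * V * (A * (α * β) * √(Real.exp V)))) :=
        mul_le_mul h2L hmain (norm_nonneg _) (by norm_num)
    _ = 2 * (D * E + q.divisors.card * (D * (A * (α * β)) * (V * √(Real.exp V)))) := by ring
    _ ≤ 2 * (D * E + C₂ * (q : ℝ) ^ δ *
          (D * (A * (α * β)) * (Real.exp ((1 + δ) * V) / δ))) := by
        gcongr
        exact H₂ q hq0
    _ = D * (F * (α * β) * (q : ℝ) ^ δ * Real.exp ((1 + δ) * V)) := by
        rw [hE, hF]; ring
    _ ≤ D * (F * (α * β) * ((b₁ : ℝ) * b₂ * N) ^ δ * Real.exp ((1 + δ) * V)) := by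
        gcongr
    _ ≤ (32 * Real.pi ^ 2 * C₂ ^ 2 * F * c ^ (σ * (1 + δ))) * ((m₁ : ℝ) * m₂) ^ 3 *
          (N : ℝ) ^ (2 * σ - 1 / 2 + ε) * ((b₁ : ℝ) * b₂) ^ ε := by
        rw [hR, hαβ]
        exact error_numerics hN1 hb1 hm1 hF0 (by linarith) hσ hδ hδε C₂
    _ = _ := by ring

end MainTheorem

end
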